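/- **Setting.** Let $k\subset K$ be fields, $k$ algebraically closed of characteristic $0$. Let $m_1,\dots,m_s\ge 1$ ($s\ge 1$) be integers with $m_1\ge 2$, and put $m=\sum_i m_i$. Let $B$ be the affine $K$-variety with coordinates $u_{ij}$ ($1\le i\le s$, $0\le j<m_i$), subject to $$u_{10}=1,\qquad \sum_i u_{i,m_i-1}=0,\qquad \prod_i u_{i0}\neq 0 ,$$ so that $\dim B=m-2$. (If $\mathcal D=\sum_i m_ic_i$ is a divisor of $K$-rational points on a smooth projective curve $C$ over $K$, with local parameters $t_i$ at $c_i$, then $B$ is the variety of trivializations $\sum_{i,j}u_{ij}\,dt_i/t_i^{m_i-j}$, up to a common scalar, of $\Omega^1_{C/K}(\mathcal D)|_{\mathcal D}$ with vanishing sum of residues.) Define relative $1$-forms $\tau_{ij}$ on $B$ by $$\sum_{j=0}^{m_i-1}\tau_{ij}T^j\equiv\Big(\sum_j u_{ij}T^j\Big)^{-1}\sum_j du_{ij}\,T^j \pmod{T^{m_i}} ,$$ and let $\Xi=\sum_{i,j}\lambda_{ij}\tau_{ij}\in H^0(B,\Omega^1_{B/K})$ with $\lambda_{ij}\in K$ and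 $\lambda_{i,m_i-1}\ne 0$ for all $i$. Let $\Psi\in H^0(B,\Omega^1_{B/k})$ be an absolute $1$-form that lifts $\Xi$ and is closed, or more generally has $d\Psi$ in the image of $\mathcal O_B\otimes_K\Omega^2_{K/k}$. The Gauß–Manin connection $\nabla_{GM}:H\to\Omega^1_{K/k}\otimes_K H$ on $H=H^{m-2}_{DR/K}(B,(\mathcal O,d+\Xi))$ is defined as follows: lift a relatively closed form to an absolute form $x$, apply $d+\Psi$, and write the result modulo the forms divisible by $\Omega^2_{K/k}$ as $\sum_l\eta_l\wedge x_l$, with $\eta_l\in\Omega^1_{K/k}$ and with $x_l$ absolute forms whose relative forms are closed under $d+\Xi$; then $\nabla_{GM}[x]=\sum_l\eta_l\otimes[x_l]$. Let $\sigma$ be a relative closed $1$-form on $\operatorname{Spec}K[[t_1,\dots,t_n]]$ with $\sigma(0)=0$. Write $\sigma=dh$ with $h(0)=0$, and let $h_2=\sum_{i,j} M_{ij}t_it_j$ ($M$ symmetric) be the quadratic part of $h$. If $h_2$ is nondegenerate, put $\operatorname{disc}(\sigma)=\det M\in K^\times/K^{\times 2}$. **Theorem.** There is exactly one closed point $b\in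 B$ where $\Xi$ vanishes (that is, $\Xi\in\mathfrak m_b\Omega^1_{B/K}$), and $b$ is $K$-rational. The space $H$ is one-dimensional over $K$, and the Gauß–Manin connection on it exists and is uniquely determined by the above description. The completion $\widehat{\mathcal O}_{B,b}$ is a power series ring over $K$ in $m-2$ variables, and for every choice of formal parameters at $b$ the form $\Xi|_{\widehat{\mathcal O}_{B,b}}$ has a primitive $h$ with $h(0)=0$, the quadratic part of $h$ is nondegenerate, and $$(H,\nabla_{GM})\;\cong\;(d+\Psi)|_{\{b\}}+\tfrac12\,d\log\operatorname{disc}\big(\Xi|_{\widehat{\mathcal O}_{B,b}}\big),$$ that is, $(H,\nabla_{GM})$ is isomorphic to the connection $1\mapsto \Psi|_b+\frac12\,\frac{d\delta}{\delta}$ on $K$, where $\Psi|_b\in\Omega^1_{K/k}$ is the pull back of $\Psi$ to the $K$-point $b$ and $\delta=\det M\in K^\times$ represents the discriminant. -/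

import Mathlib

noncomputable section
open scoped TensorProduct
namespace GM

/-- The algebra of algebraic differential forms of `A` over `R`: the exterior algebra of the
Kähler differentials. -/
abbrev Forms (R A : Type*) [CommRing R] [CommRing A] [Algebra R A] : Type _ :=
  ExteriorAlgebra A (Ω[A⁄R])

section ExteriorDerivative
variable (R A : Type*) [CommRing R] [CommRing A] [Algebra R A]

/-- A 1-form, seen in the algebra of all forms. -/
abbrev form1 : Ω[A⁄R] →ₗ[A] Forms R A := ExteriorAlgebra.ι A

/-- The automorphism that multiplies a `p`-form by `(-1)^p`. -/
abbrev signInv : Forms R A →ₐ[A] Forms R A := CliffordAlgebra.involute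

theorem form1_mul_swap (w : Ω[A⁄R]) (x : Forms R A) :
    form1 R A w * x = signInv R A x * form1 R A w := by
  induction x using ExteriorAlgebra.induction with
  | algebraMap r => 
    rw [AlgHom.commutes]
    exact (Algebra.commutes r _).symm
  | ι v =>
    rw [CliffordAlgebra.involute_ι, neg_mul]
    exact eq_neg_of_add_eq_zero_left (ExteriorAlgebra.ι_add_mul_swap w v)
  | mul a b ha hb => rw [map_mul, ← mul_assoc, ha, mul_assoc, hb, mul_assoc]
  | add a b ha hb => rw [map_add, mul_add, add_mul, ha, hb]

/-- Auxiliary ring for the exterior derivative: the matrices `!![(-1)^deg z, y; 0, z]`. An algebra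
map `x ↦ !![(-1)^deg x, d x; 0, x]` into it is the same thing as a graded derivation `d`. -/
def jetSubring : Subring (Matrix (Fin 2) (Fin 2) (Forms R A)) where
  carrier := {M | M 1 0 = 0 ∧ M 0 0 = signInv R A (M 1 1)}
  mul_mem' := by
    rintro M N ⟨h1, h2⟩ ⟨h3, h4⟩
    constructor
    · simp [Matrix.mul_apply, Fin.sum_univ_two, h1, h3]
    · simp [Matrix.mul_apply, Fin.sum_univ_two, h1, h2, h3, h4]
  one_mem' := by simp
  add_mem' := by
    rintro M N ⟨h1, h2⟩ ⟨h3, h4⟩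
    exact ⟨by simp [h1, h3], by simp [h2, h4]⟩
  zero_mem' := by simp
  neg_mem' := by
    rintro M ⟨h1, h2⟩
    exact ⟨by simp [h1], by simp [h2]⟩

/-- The ring `jetSubring`, with its own name because it gets a twisted `A`-algebra structure. -/
def Jet : Type _ := jetSubring R A

instance : Ring (Jet R A) := inferInstanceAs (Ring (jetSubring R A))

variable {R A}
def Jet.mk (z y : Forms R A) : Jet R A :=
  ⟨!![signInv R A z, y; 0, z], by simp [jetSubring]⟩

def Jet.val (t : Jet R A) : Forms R A := t.1 1 1
def Jet.der (t : Jet R A) : Forms R A := t.1 0 1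

@[simp] theorem Jet.val_mk (z y : Forms R A) : (Jet.mk z y).val = z := rfl
@[simp] theorem Jet.der_mk (z y : Forms R A) : (Jet.mk z y).der = y := rfl

theorem Jet.ext {s t : Jet R A} (h1 : s.val = t.val) (h2 : s.der = t.der) : s = t := by
  apply Subtype.ext
  ext i j
  fin_cases i <;> fin_cases j
  · exact s.2.2.trans ((congrArg (signInv R A) h1).trans t.2.2.symm)
  · exact h2
  · exact s.2.1.trans t.2.1.symm
  · exact h1

@[simp] theorem Jet.val_add (s t : Jet R A) : (s + t).val = s.val + t.val := rfl
@[simp] theorem Jet.der_add (s t : Jet R A) : (s + t).der = s.der + t.der := rfl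
@[simp] theorem Jet.val_zero : (0 : Jet R A).val = 0 := rfl
@[simp] theorem Jet.der_zero : (0 : Jet R A).der = 0 := rfl
@[simp] theorem Jet.val_one : (1 : Jet R A).val = 1 := by
  change (1 : Matrix (Fin 2) (Fin 2) (Forms R A)) 1 1 = 1
  simp
@[simp] theorem Jet.der_one : (1 : Jet R A).der = 0 := by
  change (1 : Matrix (Fin 2) (Fin 2) (Forms R A)) 0 1 = 0
  simp
@[simp] theorem Jet.val_mul (s t : Jet R A) : (s * t).val = s.val * t.val := by
  change (s.1 * t.1) 1 1 = s.1 1 1 * t.1 1 1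
  rw [Matrix.mul_apply, Fin.sum_univ_two, s.2.1, zero_mul, zero_add]
@[simp] theorem Jet.der_mul (s t : Jet R A) :
    (s * t).der = signInv R A s.val * t.der + s.der * t.val := by
  change (s.1 * t.1) 0 1 = signInv R A (s.1 1 1) * t.1 0 1 + s.1 0 1 * t.1 1 1
  rw [Matrix.mul_apply, Fin.sum_univ_two, s.2.2]

variable (R A)
/-- The twisted structure map `a ↦ !![a, da; 0, a]`. -/
def jetFun : A →+* Jet R A where
  toFun a := Jet.mk (algebraMap A _ a) (form1 R A (KaehlerDifferential.D R A a))
  map_one' := by apply Jet.ext <;> simp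
  map_zero' := by apply Jet.ext <;> simp
  map_add' a b := by apply Jet.ext <;> simp
  map_mul' a b := by
    apply Jet.ext
    · simp
    · simp only [Jet.der_mk, Jet.der_mul, Jet.val_mk, Derivation.leibniz, map_add, map_smul,
        AlgHom.commutes, Algebra.smul_def]
      rw [Algebra.commutes b]

instance : Algebra A (Jet R A) :=
  (jetFun R A).toAlgebra' fun a t => by
    apply Jet.ext
    · simp [jetFun, Algebra.commutes]
    · simp only [jetFun, RingHom.coe_mk, MonoidHom.coe_mk, OneHom.coe_mk, Jet.der_mul,
        Jet.val_mk, Jet.der_mk, AlgHom.commutes]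
      rw [form1_mul_swap, Algebra.commutes a, add_comm]

@[simp] theorem Jet.val_smul (a : A) (t : Jet R A) : (a • t).val = a • t.val := by
  rw [Algebra.smul_def, Jet.val_mul, Algebra.smul_def]; rfl
@[simp] theorem Jet.der_smul (a : A) (t : Jet R A) :
    (a • t).der = a • t.der + form1 R A (KaehlerDifferential.D R A a) * t.val := by
  rw [Algebra.smul_def, Jet.der_mul, Algebra.smul_def]
  change signInv R A (algebraMap A _ a) * _ + _ = _
  rw [AlgHom.commutes]; rfl

instance : Algebra R (Jet R A) := Algebra.compHom _ (algebraMap R A)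
instance : IsScalarTower R A (Jet R A) := IsScalarTower.of_algebraMap_eq' rfl

/-- The derivation `b ↦ !![-db, 0; 0, db]`; it encodes `d(db) = 0`. -/
def jetDer : Derivation R A (Jet R A) :=
  Derivation.mk'
    { toFun := fun b => Jet.mk (form1 R A (KaehlerDifferential.D R A b)) 0
      map_add' := fun a b => by apply Jet.ext <;> simp
      map_smul' := fun r b => by
        rw [RingHom.id_apply, ← algebraMap_smul A r (Jet.mk (form1 R A _) 0)]
        apply Jet.ext
        · rw [Jet.val_smul, Jet.val_mk, Jet.val_mk, Derivation.map_smul, algebraMap_smul,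
            ← algebraMap_smul A r (KaehlerDifferential.D R A b), map_smul, algebraMap_smul]
        · simp only [Jet.der_mk, Jet.der_smul, smul_zero, Derivation.map_algebraMap, map_zero,
            zero_mul, add_zero] }
    (fun a b => by
      apply Jet.ext
      · simp
      · simp)

theorem jetDer_lift_val (w : Ω[A⁄R]) :
    ((jetDer R A).liftKaehlerDifferential w).val = form1 R A w := by
  have hw : w ∈ Submodule.span A (Set.range (KaehlerDifferential.D R A)) := by
    rw [KaehlerDifferential.span_range_derivation]; trivial
  induction hw using Submodule.span_induction with
  | mem x hx =>
    obtain ⟨b, rfl⟩ := hx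
    rw [Derivation.liftKaehlerDifferential_comp_D]; rfl
  | zero => simp
  | add x y _ _ hx hy => rw [map_add, Jet.val_add, hx, hy, map_add]
  | smul a x _ hx => rw [map_smul, Jet.val_smul, hx, map_smul]

theorem jetDer_lift_der_even (w : Ω[A⁄R]) :
    signInv R A ((jetDer R A).liftKaehlerDifferential w).der =
      ((jetDer R A).liftKaehlerDifferential w).der := by
  have hw : w ∈ Submodule.span A (Set.range (KaehlerDifferential.D R A)) := by
    rw [KaehlerDifferential.span_range_derivation]; trivial
  induction hw using Submodule.span_induction with
  | mem x hx =>
    obtain ⟨b, rfl⟩ := hx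
    rw [Derivation.liftKaehlerDifferential_comp_D]
    exact map_zero _
  | zero => simp
  | add x y _ _ hx hy => rw [map_add, Jet.der_add, map_add, hx, hy]
  | smul a x _ hx =>
    rw [map_smul, Jet.der_smul, map_add, map_smul, hx, jetDer_lift_val, map_mul,
      CliffordAlgebra.involute_ι, CliffordAlgebra.involute_ι, neg_mul_neg]

/-- The algebra map `x ↦ !![(-1)^deg x, d x; 0, x]`. -/
def jetLift : Forms R A →ₐ[A] Jet R A :=
  ExteriorAlgebra.lift A ⟨(jetDer R A).liftKaehlerDifferential, fun w => by
    apply Jet.ext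
    · rw [Jet.val_mul, jetDer_lift_val]
      exact ExteriorAlgebra.ι_sq_zero w
    · rw [Jet.der_mul, jetDer_lift_val, CliffordAlgebra.involute_ι, neg_mul, form1_mul_swap,
        jetDer_lift_der_even]
      exact neg_add_cancel _⟩

theorem jetLift_val (x : Forms R A) : (jetLift R A x).val = x := by
  induction x using ExteriorAlgebra.induction with
  | algebraMap r => rw [AlgHom.commutes]; rfl
  | ι v =>
    rw [jetLift, ExteriorAlgebra.lift_ι_apply]
    exact jetDer_lift_val R A v
  | mul a b ha hb => rw [map_mul, Jet.val_mul, ha, hb]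
  | add a b ha hb => rw [map_add, Jet.val_add, ha, hb]

/-- The exterior derivative on algebraic differential forms. It is characterised by the three
theorems that follow: the graded Leibniz rule, `d(a) = da` for functions, and `d(da) = 0`. -/
def extD : Forms R A →ₗ[R] Forms R A where
  toFun x := (jetLift R A x).der
  map_add' x y := by rw [map_add, Jet.der_add]
  map_smul' r x := by
    rw [RingHom.id_apply, ← algebraMap_smul A r x, map_smul, Jet.der_smul, Derivation.map_algebraMap,
      map_zero, zero_mul, add_zero, algebraMap_smul]

theorem extD_mul (x y : Forms R A) :
    extD R A (x * y) = extD R A x * y + signInv R A x * extD R A y := by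
  change (jetLift R A (x * y)).der = _
  rw [map_mul, Jet.der_mul, jetLift_val, jetLift_val, add_comm]
  rfl

theorem extD_algebraMap (a : A) :
    extD R A (algebraMap A _ a) = form1 R A (KaehlerDifferential.D R A a) := by
  change (jetLift R A _).der = _
  rw [AlgHom.commutes]; rfl

theorem extD_form1_D (a : A) : extD R A (form1 R A (KaehlerDifferential.D R A a)) = 0 := by
  change (jetLift R A _).der = _
  rw [jetLift, ExteriorAlgebra.lift_ι_apply, Derivation.liftKaehlerDifferential_comp_D]
  rfl

end ExteriorDerivative

section DeRham
variable (K A : Type*) [Field K] [CommRing A] [Algebra K A]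

/-- The forms of degree `p`. -/
def pForms (p : ℕ) : Submodule K (Forms K A) :=
  (⋀[A]^p (Ω[A⁄K])).restrictScalars K

variable {K A}

/-- The operator `d + ξ`, `ω ↦ dω + ξ ∧ ω`. -/
def twistedD (ξ : Ω[A⁄K]) : Forms K A →ₗ[K] Forms K A :=
  extD K A + LinearMap.mulLeft K (form1 K A ξ)

/-- The `p`-forms killed by `d + ξ`. -/
def closedForms (ξ : Ω[A⁄K]) (p : ℕ) : Submodule K (Forms K A) :=
  pForms K A p ⊓ LinearMap.ker (twistedD ξ)

/-- The image under `d + ξ` of the forms of degree `p - 1` (zero if `p = 0`). -/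
def exactForms (ξ : Ω[A⁄K]) (p : ℕ) : Submodule K (Forms K A) :=
  ⨆ (q : ℕ) (_ : q + 1 = p), (pForms K A q).map (twistedD ξ)

/-- `H^p_DR(Spec A / K, (𝒪, d + ξ))`, for `Spec A` an affine variety: the `p`-th cohomology of the
global forms with differential `d + ξ`. -/
abbrev DeRhamH (ξ : Ω[A⁄K]) (p : ℕ) : Type _ :=
  closedForms ξ p ⧸ (exactForms ξ p).submoduleOf (closedForms ξ p)

end DeRham

section Connections
variable (k K : Type*) [Field k] [Field K] [Algebra k K]

/-- A connection on the `K`-vector space `V`, relative to `k`. -/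
structure Conn (V : Type*) [AddCommGroup V] [Module K V] where
  toFun : V →+ Ω[K⁄k] ⊗[K] V
  leibniz : ∀ (c : K) (v : V), toFun (c • v) = KaehlerDifferential.D k K c ⊗ₜ[K] v + c • toFun v

variable {K}

/-- The connection `d + α` on `K`, i.e. `1 ↦ α`. -/
def Conn.ofForm (α : Ω[K⁄k]) : Conn k K K where
  toFun := AddMonoidHom.mk' (fun c => (KaehlerDifferential.D k K c + c • α) ⊗ₜ[K] (1 : K))
    (fun a b => by
      rw [← TensorProduct.add_tmul, map_add, add_smul]
      congr 1
      abel)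
  leibniz c v := by
    simp only [AddMonoidHom.mk'_apply, smul_eq_mul, Derivation.leibniz]
    rw [TensorProduct.smul_tmul', ← mul_one v, ← smul_eq_mul v, ← TensorProduct.smul_tmul,
      ← TensorProduct.add_tmul]
    simp only [smul_eq_mul, mul_one]
    congr 1
    rw [smul_add, smul_smul]
    abel

variable {k}

/-- Two vector spaces with connection are isomorphic. -/
def Conn.Iso {V W : Type*} [AddCommGroup V] [Module K V] [AddCommGroup W] [Module K W]
    (s : Conn k K V) (t : Conn k K W) : Prop :=
  ∃ e : V ≃ₗ[K] W, ∀ v, t.toFun (e v) = e.toLinearMap.lTensor (Ω[K⁄k]) (s.toFun v)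

end Connections

section GaussManin
variable (k K A : Type*) [Field k] [Field K] [Algebra k K] [CommRing A] [Algebra K A]
  [Algebra k A] [IsScalarTower k K A]

/-- The reduction of absolute forms (over `k`) to relative forms (over `K`). -/
def relForms : Forms k A →ₐ[A] Forms K A :=
  ExteriorAlgebra.map (KaehlerDifferential.map k K A A)

/-- The pull back to `A` of the 1-forms of `K` over `k`. -/
def baseForm : Ω[K⁄k] →ₗ[K] Ω[A⁄k] := KaehlerDifferential.map k k K A

/-- The forms of `A` over `k` that are divisible by 2-forms of `K`: the ideal generated by
`Ω²_{K/k}`. -/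
def fil2 : Submodule A (Forms k A) :=
  Submodule.span A {z | ∃ (η η' : Ω[K⁄k]) (x : Forms k A),
    z = form1 k A (baseForm k K A η) * form1 k A (baseForm k K A η') * x}

variable {K A}

/-- The absolute `p`-forms whose relative form is closed under `d + ξ`. -/
def liftedForms (ξ : Ω[A⁄K]) (p : ℕ) : Submodule K (Forms k A) :=
  (⋀[A]^p (Ω[A⁄k])).restrictScalars K ⊓
    (LinearMap.ker (twistedD ξ)).comap ((relForms k K A).toLinearMap.restrictScalars K)

theorem relForms_mem (ξ : Ω[A⁄K]) (p : ℕ) (x : Forms k A) (hx : x ∈ liftedForms k ξ p) :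
    relForms k K A x ∈ closedForms ξ p := by
  refine ⟨?_, hx.2⟩
  have h := Submodule.mem_map_of_mem (f := (relForms k K A).toLinearMap) hx.1
  rw [ExteriorAlgebra.exteriorPower, Submodule.map_pow] at h
  have hle : Submodule.map (relForms k K A).toLinearMap
      (LinearMap.range (ExteriorAlgebra.ι A : Ω[A⁄k] →ₗ[A] Forms k A)) ≤
      LinearMap.range (ExteriorAlgebra.ι A : Ω[A⁄K] →ₗ[A] Forms K A) := by
    rintro _ ⟨_, ⟨w, rfl⟩, rfl⟩
    exact ⟨KaehlerDifferential.map k K A A w, (ExteriorAlgebra.map_apply_ι _ _).symm⟩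
  have hpow := pow_le_pow_left' hle p
  exact hpow h

/-- The relative cohomology class of an absolute form. -/
def relClass (ξ : Ω[A⁄K]) (p : ℕ) : liftedForms k ξ p →ₗ[K] DeRhamH ξ p :=
  (Submodule.mkQ _).comp
    (LinearMap.codRestrict (closedForms ξ p)
      (((relForms k K A).toLinearMap.restrictScalars K).comp (liftedForms k ξ p).subtype)
      (fun x => relForms_mem k ξ p x.1 x.2))

/-- The map `η ⊗ x ↦ η ∧ x`, for `η` a 1-form of `K`. -/
def wedgeBase (ξ : Ω[A⁄K]) (p : ℕ) : Ω[K⁄k] ⊗[K] liftedForms k ξ p →ₗ[K] Forms k A :=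
  TensorProduct.lift
    ((LinearMap.mul K (Forms k A)).compl₁₂
      ((form1 k A).restrictScalars K ∘ₗ baseForm k K A) (liftedForms k ξ p).subtype)

variable {k}

/-- `nabla` is the Gauß–Manin connection on `H^p_DR(A/K, (𝒪, d + ξ))` attached to an absolute
lifting `Ψ` of `ξ`: lift a closed relative form to an absolute form `x`, apply `d + Ψ`, and write
the result modulo `Ω²_K` as `∑ ηᵢ ∧ xᵢ` with `ηᵢ` in `Ω¹_K`; then `nabla [x] = ∑ ηᵢ ⊗ [xᵢ]`. -/
def IsGaussManin (Ψ : Ω[A⁄k]) (ξ : Ω[A⁄K]) (p : ℕ) (nabla : Conn k K (DeRhamH ξ p)) : Prop :=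
  ∀ x : liftedForms k ξ p, ∃ y : Ω[K⁄k] ⊗[K] liftedForms k ξ p,
    twistedD Ψ x.1 - wedgeBase k ξ p y ∈ fil2 k K A ∧
      nabla.toFun (relClass k ξ p x) = (relClass k ξ p).lTensor (Ω[K⁄k]) y

/-- The restriction (pull back) of an absolute 1-form to a `K`-point `b : Spec K ⟶ Spec A`. -/
def restrictPoint (b : A →ₐ[K] K) : Ω[A⁄k] →+ Ω[K⁄k] :=
  letI : Algebra A K := b.toRingHom.toAlgebra
  haveI : IsScalarTower k A K := IsScalarTower.of_algebraMap_eq fun c => by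
    rw [IsScalarTower.algebraMap_apply k K A]
    exact (b.commutes _).symm
  (KaehlerDifferential.map k k A K).toAddMonoidHom

theorem restrictPoint_smul_D (b : A →ₐ[K] K) (f g : A) :
    restrictPoint (k := k) b (f • KaehlerDifferential.D k A g) =
      b f • KaehlerDifferential.D k K (b g) := by
  let : Algebra A K := b.toRingHom.toAlgebra
  have : IsScalarTower k A K := IsScalarTower.of_algebraMap_eq fun c => by
    rw [IsScalarTower.algebraMap_apply k K A]
    exact (b.commutes _).symm
  have h : restrictPoint (k := k) b (f • KaehlerDifferential.D k A g) =
    KaehlerDifferential.map k k A K (f • KaehlerDifferential.D k A g) := rfl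
  rw [h, map_smul, KaehlerDifferential.map_D, ← algebraMap_smul K f]
  rfl

end GaussManin

section Disc
variable {K A : Type*} [Field K] [CommRing A] [Algebra K A] {n : ℕ}

/-- `φ` identifies the completion of `A` at the `K`-point `b` with `K[[t₁, …, tₙ]]`: for every `N`
it induces a bijection `A / 𝔪_b ^ N ⟶ K[[t]] / 𝔪 ^ N`. -/
def IsFormalParameters (b : A →ₐ[K] K) (φ : A →ₐ[K] MvPowerSeries (Fin n) K) : Prop :=
  ∀ N : ℕ,
    (∀ f : A, φ f ∈ (RingHom.ker (MvPowerSeries.constantCoeff (σ := Fin n) (R := K))) ^ N ↔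
      f ∈ (RingHom.ker b) ^ N) ∧
    ∀ g : MvPowerSeries (Fin n) K, ∃ f : A,
      g - φ f ∈ (RingHom.ker (MvPowerSeries.constantCoeff (σ := Fin n) (R := K))) ^ N

/-- The coefficient of `dtᵢ` in the expansion of the relative form `ξ` along `φ`; the form `f dg`
has the coefficient `φ(f) ∂φ(g)/∂tᵢ`. -/
def formalCoeff (φ : A →ₐ[K] MvPowerSeries (Fin n) K) (i : Fin n) (ξ : Ω[A⁄K]) :
    MvPowerSeries (Fin n) K :=
  letI : Module A (MvPowerSeries (Fin n) K) := Module.compHom _ φ.toRingHom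
  haveI : IsScalarTower K A (MvPowerSeries (Fin n) K) := ⟨fun c a g => by
    change φ (c • a) * g = c • (φ a * g)
    rw [map_smul, smul_mul_assoc]⟩
  Derivation.liftKaehlerDifferential
    (Derivation.mk' ((MvPowerSeries.pderiv K i).toLinearMap.comp φ.toLinearMap) (fun f g => by
      change MvPowerSeries.pderiv K i (φ (f * g)) =
        φ f * MvPowerSeries.pderiv K i (φ g) + φ g * MvPowerSeries.pderiv K i (φ f)
      rw [map_mul, Derivation.leibniz, smul_eq_mul, smul_eq_mul])) ξ

theorem formalCoeff_smul_D (φ : A →ₐ[K] MvPowerSeries (Fin n) K) (i : Fin n) (f g : A) :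
    formalCoeff φ i (f • KaehlerDifferential.D K A g) =
      φ f * MvPowerSeries.pderiv K i (φ g) := by
  let : Module A (MvPowerSeries (Fin n) K) := Module.compHom _ φ.toRingHom
  unfold formalCoeff
  rw [map_smul, Derivation.liftKaehlerDifferential_comp_D]
  rfl

/-- `h` is the formal primitive of `ξ` with `h(0) = 0`. -/
def IsPrimitive (φ : A →ₐ[K] MvPowerSeries (Fin n) K) (ξ : Ω[A⁄K])
    (h : MvPowerSeries (Fin n) K) : Prop :=
  MvPowerSeries.constantCoeff h = 0 ∧ ∀ i, MvPowerSeries.pderiv K i h = formalCoeff φ i ξ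

/-- The symmetric matrix `M` of the quadratic part `h₂` of `h`, i.e. `h₂(t) = ∑ Mᵢⱼ tᵢ tⱼ`. Its
determinant is the discriminant of `h₂`. -/
def quadMatrix (h : MvPowerSeries (Fin n) K) : Matrix (Fin n) (Fin n) K :=
  Matrix.of fun i j =>
    if i = j then MvPowerSeries.coeff (Finsupp.single i 2) h
    else MvPowerSeries.coeff (Finsupp.single i 1 + Finsupp.single j 1) h / 2

end Disc

section Setup
variable {r : ℕ}

/-- The indices of the independent coordinates `u_{ij}` of `B`. The points are numbered from `0`. -/
abbrev FreeIdx (m : Fin (r + 1) → ℕ) : Type :=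
  {q : Fin (r + 1) × ℕ // q.2 < m q.1 ∧ q ≠ (0, 0) ∧ q ≠ (0, m 0 - 1)}

/-- The multiplicative set generated by the independent coordinates `u_{i0}`. -/
def unitCoords (K : Type*) [Field K] (m : Fin (r + 1) → ℕ) :
    Submonoid (MvPolynomial (FreeIdx m) K) :=
  Submonoid.closure {f | ∃ q : FreeIdx m, q.1.2 = 0 ∧ f = MvPolynomial.X q}

/-- The coordinate ring of
`B = {(u_{ij}) : u_{00} = 1, ∑ i, u_{i, mᵢ - 1} = 0, ∏ i, u_{i0} ≠ 0}`, `0 ≤ j < mᵢ`, in terms of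
the independent coordinates. -/
abbrev CoordB (K : Type*) [Field K] (m : Fin (r + 1) → ℕ) : Type _ :=
  Localization (unitCoords K m)

variable (K : Type*) [Field K] (m : Fin (r + 1) → ℕ)

/-- The independent coordinates, as functions on `B`. -/
def coordX (i : Fin (r + 1)) (j : ℕ) : CoordB K m :=
  if h : j < m i ∧ (i, j) ≠ (0, 0) ∧ (i, j) ≠ (0, m 0 - 1) then
    algebraMap (MvPolynomial (FreeIdx m) K) (CoordB K m) (MvPolynomial.X ⟨(i, j), h⟩)
  else 0

/-- All the coordinates `u_{ij}`, as functions on `B` (and `0` for `mᵢ ≤ j`). -/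
def coordU (i : Fin (r + 1)) (j : ℕ) : CoordB K m :=
  if i = 0 ∧ j = 0 then 1
  else if i = 0 ∧ j = m 0 - 1 then - ∑ l ∈ Finset.univ.erase 0, coordX K m l (m l - 1)
  else coordX K m i j

theorem coordU_zero_zero : coordU K m 0 0 = 1 := by simp [coordU]

theorem sum_coordU (hm : 2 ≤ m 0) : ∑ i, coordU K m i (m i - 1) = 0 := by
  rw [← Finset.add_sum_erase _ _ (Finset.mem_univ 0)]
  have h0 : m 0 - 1 ≠ 0 := by omega
  have h1 : ∑ i ∈ Finset.univ.erase 0, coordU K m i (m i - 1) =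
      ∑ i ∈ Finset.univ.erase 0, coordX K m i (m i - 1) := by
    refine Finset.sum_congr rfl fun i hi => ?_
    simp [coordU, Finset.ne_of_mem_erase hi]
  rw [h1]
  simp [coordU, h0]

theorem isUnit_coordU (hm : ∀ i, 1 ≤ m i) (i : Fin (r + 1)) : IsUnit (coordU K m i 0) := by
  by_cases hi : i = 0
  · simp [coordU, hi]
  · have h : 0 < m i ∧ (i, 0) ≠ (0, 0) ∧ (i, 0) ≠ (0, m 0 - 1) :=
      ⟨hm i, by simp [hi], by simp [hi]⟩
    have h2 : coordU K m i 0 = algebraMap (MvPolynomial (FreeIdx m) K) (CoordB K m)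
        (MvPolynomial.X ⟨(i, 0), h⟩) := by
      simp only [coordU, hi, false_and, if_false, coordX]
      exact dif_pos h
    rw [h2]
    exact IsLocalization.map_units (M := unitCoords K m) (CoordB K m)
      ⟨_, Submonoid.subset_closure ⟨⟨(i, 0), h⟩, rfl, rfl⟩⟩

/-- The coefficients `ν_{ij}` of the inverse of `∑ j, u_{ij} T^j`; the constant term `u_{i0}` is a
unit, so that `Ring.inverse` is the inverse. -/
def coordNu (i : Fin (r + 1)) (j : ℕ) : CoordB K m :=
  PowerSeries.coeff j (Ring.inverse (PowerSeries.mk (coordU K m i)))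

/-- The relative form `τ_{ij}`, the coefficient of `T^j` in
`(∑ j, u_{ij} T^j)⁻¹ * ∑ j, du_{ij} T^j`, restricted to `B`. -/
def tau (i : Fin (r + 1)) (j : ℕ) : Ω[CoordB K m⁄K] :=
  ∑ p ∈ Finset.HasAntidiagonal.antidiagonal j,
    coordNu K m i p.1 • KaehlerDifferential.D K (CoordB K m) (coordU K m i p.2)

variable {K}

/-- The form `Ξ = ∑ λ_{ij} τ_{ij}` on `B`, the sum over all `i` and `0 ≤ j < mᵢ`. -/
def Xi (lam : Fin (r + 1) → ℕ → K) : Ω[CoordB K m⁄K] :=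
  ∑ i, ∑ j ∈ Finset.range (m i), lam i j • tau K m i j

end Setup

end GM

end

/-!
The idea is to bring `Ξ` into a normal form in suitable coordinates of `B`, where the twisted
cohomology, the Gauß–Manin connection and the discriminant can all be computed one coordinate (or one
pair of coordinates) at a time.

**Normal form.** There are coordinates `z` on `B`, some of them invertible, in which
`Ξ = ∑ lam (dz/z - dz) + ∑ d(eps z²) + ∑ (lam dx/x + d((1 - x) y))`, the last sum running over pairs
`(x, y)` of coordinates (`NormalData`, `normalCoord`, `lift_Xi_eq_sum_coeff`). To find them, fix a
point of the divisor, let `u = ∑ j, u_j T ^ j` be the series there and `M` its last exponent. Write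
`u = u_0 * g * V` with a constant series `g` and `V = 1 + W`. The contribution of the point is
`lam_0 du_0/u_0` plus the differential of the potential `∑ j, lam_j coeff_j (log V)`. The series `g`
is chosen such that the part of the potential linear in `W` is a multiple of `u_M/u_0`. A
monomial of higher degree in `W` has its smallest index at most `M/2`, and attributing it to that
index writes the potential as a sum of products of `W_a`, `2 a < M`, with a function equal to
`-lam_M W_{M - a}` up to earlier coefficients, and of a multiple of `W_{M/2}²` (`sum_normalTerm`). The
condition on the sum of the residues allows one to subtract a multiple of `∑ du_M`, which supplies
the terms `-dz` and, at the pairs with `x = u_0` up to a factor, the term `-d(x y)`. The functions found in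
this way generate the coordinate ring; so they define a surjective endomorphism of a Noetherian ring,
which is injective as well, and they are coordinates (`IsTorusCoord.of_adjoin`,
`isTorusCoord_normalCoord`).

**Cohomology.** In the top degree, a form `f dz_1 ∧ ⋯ ∧ dz_n` is exact if and only if `f` is a twisted
divergence `∑ q, (∂_q g_q + a_q g_q)`, where `Ξ = ∑ q, a_q dz_q` (`topClass_eq_zero_iff`). For a form
in normal form the divergences of Laurent monomials are recursion relations between two or three
monomials. They reduce every monomial to a multiple of a fixed one
(`NormalData.exists_smul_sub_mem`), and a product of solutions of the recursions in one coordinate or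
one pair is a functional that vanishes on the exact forms but not on that monomial
(`NormalData.exists_exact_functional`). Hence `H` is one-dimensional.

**Connection.** Let `θ` be the derivation that lifts a derivation of `K` over `k` and kills the
coordinates, and let `Ψ(θ)` be the contraction. By Cartan's formula, the Gauß–Manin connection
along `θ` is `f ↦ θ f + Ψ(θ) f` on the functions representing the top degree forms
(`exists_gaussManin`). The condition on `dΨ` says that `∂_q Ψ(θ) = θ(a_q)`. As a derivative has no
residue, the numbers `lam` are horizontal (`NormalData.residue_horizontal`), and then integration
gives `Ψ(θ) = Ψ|_b(θ) + ∑ θ(eps) z²` (`NormalData.exists_eq_add_sum_sq`). Integration by parts shows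
that `z²` acts on the generator as `-1 / (2 eps)`, so that the connection form is
`Ψ|_b - ½ ∑ d log eps` (`NormalData.gaussManin`).

**Discriminant.** The formal Poincaré lemma gives the primitive `h`. The chain rule at the zero `b`
shows that `det M` is, up to a square and a rational factor, the determinant of the Hessian
`(∂_p a_q)(b)` (`exists_isPrimitive`), which is `± 1` times the product of the numbers `2 eps`, `-lam`
(for the first sum of the normal form) and `-1` (`NormalData.det_hessian`). Thus `det M` is the product
of the numbers `eps` up to a square and a horizontal factor (`NormalData.prod_hessEntry`). Finally
`-½ d log` and `+½ d log` of a function differ by a logarithmic differential, and connection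
forms that differ by a logarithmic differential define isomorphic connections (`Conn.ofForm_iso`).
-/

noncomputable section
open scoped TensorProduct
namespace GM

universe u v

/-! ### Exterior algebra of a free module -/

section Exterior
variable {R V : Type*} [CommRing R] [AddCommGroup V] [Module R V]

/-- Contraction of a form with a linear functional. -/
abbrev contract (d : Module.Dual R V) : ExteriorAlgebra R V →ₗ[R] ExteriorAlgebra R V :=
  CliffordAlgebra.contractLeft d

theorem contract_ι_mul (d : Module.Dual R V) (v : V) (x : ExteriorAlgebra R V) :
    contract d (ExteriorAlgebra.ι R v * x) = d v • x - ExteriorAlgebra.ι R v * contract d x :=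
  CliffordAlgebra.contractLeft_ι_mul d v x

theorem exteriorPower_induction {p : ℕ} {P : ℕ → ExteriorAlgebra R V → Prop}
    (hone : P 0 1)
    (hadd : ∀ p x y, P p x → P p y → P p (x + y)) (hsmul : ∀ p (r : R) x, P p x → P p (r • x))
    (hmul : ∀ p v x, x ∈ ⋀[R]^p V → P p x → P (p + 1) (ExteriorAlgebra.ι R v * x))
    {x : ExteriorAlgebra R V} (hx : x ∈ ⋀[R]^p V) : P p x := by
  refine Submodule.pow_induction_on_left' (LinearMap.range (ExteriorAlgebra.ι R : V →ₗ[R] _))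
    (C := fun n x _ => P n x) (fun r => ?_) (fun x y i _ _ h1 h2 => hadd _ _ _ h1 h2) ?_ hx
  · rw [Algebra.algebraMap_eq_smul_one]
    exact hsmul _ _ _ hone
  · rintro _ ⟨v, rfl⟩ i x hx h
    exact hmul _ _ _ hx h

theorem ι_mul_mem {p : ℕ} (v : V) {x : ExteriorAlgebra R V} (hx : x ∈ ⋀[R]^p V) :
    ExteriorAlgebra.ι R v * x ∈ ⋀[R]^(p + 1) V := by
  change _ ∈ (LinearMap.range (ExteriorAlgebra.ι R : V →ₗ[R] _)) ^ (p + 1)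
  rw [pow_succ']
  exact Submodule.mul_mem_mul ⟨v, rfl⟩ hx

theorem one_mem_exteriorPower : (1 : ExteriorAlgebra R V) ∈ ⋀[R]^0 V := by
  change _ ∈ (LinearMap.range (ExteriorAlgebra.ι R : V →ₗ[R] _)) ^ 0
  rw [pow_zero]
  exact Submodule.one_le.mp le_rfl

theorem contract_mem {p : ℕ} (d : Module.Dual R V) {x : ExteriorAlgebra R V}
    (hx : x ∈ ⋀[R]^p V) : p = 0 ∧ contract d x = 0 ∨ ∃ q, p = q + 1 ∧ contract d x ∈ ⋀[R]^q V := by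
  refine exteriorPower_induction
    (P := fun p x => p = 0 ∧ contract d x = 0 ∨ ∃ q, p = q + 1 ∧ contract d x ∈ ⋀[R]^q V)
    ?_ ?_ ?_ ?_ hx
  · exact Or.inl ⟨rfl, CliffordAlgebra.contractLeft_one 0 d⟩
  · rintro p x y (⟨rfl, hx⟩ | ⟨q, rfl, hx⟩) (⟨hp, hy⟩ | ⟨q', hq, hy⟩)
    · exact Or.inl ⟨rfl, by rw [map_add, hx, hy, add_zero]⟩
    · omega
    · omega
    · obtain rfl : q = q' := by omega
      exact Or.inr ⟨q, rfl, by rw [map_add]; exact add_mem hx hy⟩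
  · rintro p r x (⟨rfl, hx⟩ | ⟨q, rfl, hx⟩)
    · exact Or.inl ⟨rfl, by rw [map_smul, hx, smul_zero]⟩
    · exact Or.inr ⟨q, rfl, by rw [map_smul]; exact Submodule.smul_mem _ _ hx⟩
  · rintro p v x hx (⟨rfl, h⟩ | ⟨q, rfl, h⟩)
    · refine Or.inr ⟨0, rfl, ?_⟩
      rw [contract_ι_mul, h, mul_zero, sub_zero]
      exact Submodule.smul_mem _ _ hx
    · refine Or.inr ⟨q + 1, rfl, ?_⟩
      rw [contract_ι_mul]
      exact sub_mem (Submodule.smul_mem _ _ hx) (ι_mul_mem v h)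

theorem contract_mem_succ {p : ℕ} (d : Module.Dual R V) {x : ExteriorAlgebra R V}
    (hx : x ∈ ⋀[R]^(p + 1) V) : contract d x ∈ ⋀[R]^p V := by
  obtain ⟨h, _⟩ | ⟨q, hq, h⟩ := contract_mem d hx
  · omega
  · obtain rfl : p = q := by omega
    exact h

/-- Euler's formula: `∑ e_q ∧ ι_q` multiplies a `p`-form by `p`. -/
theorem sum_ι_mul_contract {ι : Type*} [Fintype ι] (b : Module.Basis ι R V) {p : ℕ}
    {x : ExteriorAlgebra R V} (hx : x ∈ ⋀[R]^p V) :
    ∑ q, ExteriorAlgebra.ι R (b q) * contract (b.coord q) x = (p : R) • x := by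
  refine exteriorPower_induction (P := fun p x =>
    ∑ q, ExteriorAlgebra.ι R (b q) * contract (b.coord q) x = (p : R) • x) ?_ ?_ ?_ ?_ hx
  · simp
  · intro p x y h1 h2
    simp only [map_add, mul_add, Finset.sum_add_distrib, h1, h2, smul_add]
  · intro p r x h
    simp only [map_smul, mul_smul_comm, ← Finset.smul_sum, h]
    rw [smul_comm]
  · intro p v x _ h
    have key : ∀ q, ExteriorAlgebra.ι R (b q) * contract (b.coord q) (ExteriorAlgebra.ι R v * x) =
        ExteriorAlgebra.ι R (b.coord q v • b q) * x +
          ExteriorAlgebra.ι R v * (ExteriorAlgebra.ι R (b q) * contract (b.coord q) x) := by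
      intro q
      rw [contract_ι_mul, mul_sub, map_smul, mul_smul_comm, smul_mul_assoc, ← mul_assoc,
        ← mul_assoc, eq_neg_of_add_eq_zero_left (ExteriorAlgebra.ι_add_mul_swap (b q) v)]
      rw [neg_mul, sub_neg_eq_add]
    simp only [key, Finset.sum_add_distrib, ← Finset.sum_mul, ← map_sum, ← Finset.mul_sum, h]
    have : ∑ q, b.coord q v • b q = v := b.sum_repr v
    rw [this, mul_smul_comm, Nat.cast_succ, add_smul, one_smul, add_comm]

variable {n : ℕ} (b : Module.Basis (Fin n) R V)

/-- The volume form `e_1 ∧ … ∧ e_n` of a basis. -/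
def volForm : ExteriorAlgebra R V := (List.ofFn fun i => ExteriorAlgebra.ι R (b i)).prod

/-- The coefficient of an `n`-form with respect to `volForm`. -/
def volCoeff : ExteriorAlgebra R V →ₗ[R] R :=
  ExteriorAlgebra.liftAlternating fun i => if h : i = n then h ▸ b.det else 0

theorem volForm_eq : volForm b = ExteriorAlgebra.ιMulti R n b := by
  rw [ExteriorAlgebra.ιMulti_apply]; rfl

theorem volCoeff_volForm : volCoeff b (volForm b) = 1 := by
  rw [volForm_eq, volCoeff, ExteriorAlgebra.liftAlternating_apply_ιMulti, dif_pos rfl]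
  exact b.det_self

theorem volForm_mem : volForm b ∈ ⋀[R]^n V := by
  rw [volForm_eq]
  exact ExteriorAlgebra.ιMulti_range R n ⟨_, rfl⟩

theorem exteriorPower_eq_zero_of_lt (b : Module.Basis (Fin n) R V) {p : ℕ} (hp : n < p) {x : ExteriorAlgebra R V}
    (hx : x ∈ ⋀[R]^p V) : x = 0 := by
  have hp' : IsEmpty (Set.powersetCard (Fin n) p) := by
    constructor
    rintro ⟨s, hs⟩
    have h1 : s.card = p := hs
    have h2 := s.card_le_univ
    rw [Fintype.card_fin] at h2
    omega
  have h := (Module.Basis.exteriorPower p b).repr.injective (a₁ := ⟨x, hx⟩) (a₂ := 0) (Subsingleton.elim _ _)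
  exact congrArg Subtype.val h

/-- The top exterior power is free of rank one. -/
theorem eq_volCoeff_smul_volForm {x : ExteriorAlgebra R V} (hx : x ∈ ⋀[R]^n V) :
    x = volCoeff b x • volForm b := by
  suffices h : ∃ r : R, x = r • volForm b by
    obtain ⟨r, rfl⟩ := h
    rw [map_smul, volCoeff_volForm, smul_eq_mul, mul_one]
  have key : ExteriorAlgebra.ιMulti R n (M := V) =
      (LinearMap.toSpanSingleton R _ (volForm b)).compAlternatingMap b.det := by
    refine Module.Basis.ext_alternating b fun i hi => ?_
    let σ : Equiv.Perm (Fin n) := Equiv.ofBijective i (Finite.injective_iff_bijective.1 hi)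
    change ExteriorAlgebra.ιMulti R n (b ∘ σ) = b.det (b ∘ σ) • volForm b
    rw [AlternatingMap.map_perm, AlternatingMap.map_perm, b.det_self, ← volForm_eq, smul_assoc,
      one_smul]
  rw [← ExteriorAlgebra.ιMulti_span_fixedDegree] at hx
  induction hx using Submodule.span_induction with
  | mem x hx =>
    obtain ⟨v, rfl⟩ := hx
    exact ⟨b.det v, congrArg (fun f => f v) key⟩
  | zero => exact ⟨0, (zero_smul _ _).symm⟩
  | add x y _ _ hx hy =>
    obtain ⟨r, rfl⟩ := hx
    obtain ⟨s, rfl⟩ := hy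
    exact ⟨r + s, (add_smul _ _ _).symm⟩
  | smul a x _ hx =>
    obtain ⟨r, rfl⟩ := hx
    exact ⟨a * r, (mul_smul _ _ _).symm⟩

/-- Contraction with the dual basis inverts `e_q ∧`: an `(n-1)`-form `x` is
`∑ ι_q (e_q ∧ x)`. -/
theorem eq_sum_contract {p : ℕ} (hp : p + 1 = n) {x : ExteriorAlgebra R V} (hx : x ∈ ⋀[R]^p V) :
    x = ∑ q, contract (b.coord q) (ExteriorAlgebra.ι R (b q) * x) := by
  have h := sum_ι_mul_contract b hx
  simp only [contract_ι_mul, Finset.sum_sub_distrib, h]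
  subst hp
  simp [add_smul, Nat.cast_smul_eq_nsmul]

theorem ι_mul_contract (b : Module.Basis (Fin n) R V) (d : Module.Dual R V) (v : V) {x : ExteriorAlgebra R V}
    (hx : x ∈ ⋀[R]^n V) : ExteriorAlgebra.ι R v * contract d x = d v • x := by
  have h := contract_ι_mul d v x
  rw [exteriorPower_eq_zero_of_lt b (Nat.lt_succ_self n) (ι_mul_mem v hx), map_zero] at h
  exact (sub_eq_zero.mp h.symm).symm

end Exterior

/-! ### The exterior derivative and the degree of forms -/

section ExtD
variable {R A : Type*} [CommRing R] [CommRing A] [Algebra R A]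

theorem extD_smul (f : A) (x : Forms R A) :
    extD R A (f • x) = form1 R A (KaehlerDifferential.D R A f) * x + f • extD R A x := by
  rw [Algebra.smul_def, extD_mul, extD_algebraMap, AlgHom.commutes, Algebra.smul_def]

theorem extD_form1_mul (w : Ω[A⁄R]) (x : Forms R A) :
    extD R A (form1 R A w * x) = extD R A (form1 R A w) * x - form1 R A w * extD R A x := by
  rw [extD_mul, CliffordAlgebra.involute_ι, neg_mul, sub_eq_add_neg]

theorem kaehler_induction {P : Ω[A⁄R] → Prop} (h0 : P 0)
    (hadd : ∀ x y, P x → P y → P (x + y))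
    (hD : ∀ f g : A, P (f • KaehlerDifferential.D R A g)) (w : Ω[A⁄R]) : P w := by
  have hw : w ∈ Submodule.span A (Set.range (KaehlerDifferential.D R A)) := by
    rw [KaehlerDifferential.span_range_derivation]; trivial
  obtain ⟨c, rfl⟩ := (Finsupp.mem_span_range_iff_exists_finsupp).mp hw
  exact Finset.sum_induction _ P hadd h0 fun g _ => hD _ _

theorem extD_form1_mem (w : Ω[A⁄R]) : extD R A (form1 R A w) ∈ ⋀[A]^2 (Ω[A⁄R]) := by
  induction w using kaehler_induction with
  | h0 => rw [map_zero, map_zero]; exact zero_mem _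
  | hadd x y hx hy => rw [map_add, map_add]; exact add_mem hx hy
  | hD f g =>
    rw [map_smul, extD_smul, extD_form1_D, smul_zero, add_zero]
    refine ι_mul_mem (p := 1) _ ?_
    rw [← mul_one (form1 R A _)]
    exact ι_mul_mem (p := 0) _ one_mem_exteriorPower

theorem mul_mem_exteriorPower {p q : ℕ} {x y : Forms R A} (hx : x ∈ ⋀[A]^p (Ω[A⁄R]))
    (hy : y ∈ ⋀[A]^q (Ω[A⁄R])) : x * y ∈ ⋀[A]^(p + q) (Ω[A⁄R]) := by
  rw [ExteriorAlgebra.exteriorPower, pow_add]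
  exact Submodule.mul_mem_mul hx hy

theorem extD_mem {p : ℕ} {x : Forms R A} (hx : x ∈ ⋀[A]^p (Ω[A⁄R])) :
    extD R A x ∈ ⋀[A]^(p + 1) (Ω[A⁄R]) := by
  refine exteriorPower_induction
    (P := fun p x => x ∈ ⋀[A]^p (Ω[A⁄R]) ∧ extD R A x ∈ ⋀[A]^(p + 1) (Ω[A⁄R])) ?_ ?_ ?_ ?_ hx |>.2
  · refine ⟨one_mem_exteriorPower, ?_⟩
    have h : extD R A (1 : Forms R A) = 0 := by
      rw [← map_one (algebraMap A (Forms R A)), extD_algebraMap, Derivation.map_one_eq_zero,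
        map_zero]
    rw [h]
    exact zero_mem _
  · rintro p x y ⟨h1, h2⟩ ⟨h3, h4⟩
    refine ⟨add_mem h1 h3, ?_⟩
    rw [map_add]
    exact add_mem h2 h4
  · rintro p f x ⟨h1, h2⟩
    refine ⟨Submodule.smul_mem _ _ h1, ?_⟩
    rw [extD_smul]
    exact add_mem (ι_mul_mem _ h1) (Submodule.smul_mem _ _ h2)
  · rintro p v x hx ⟨h1, h2⟩
    refine ⟨ι_mul_mem _ h1, ?_⟩
    rw [extD_form1_mul]
    refine sub_mem ?_ (ι_mul_mem _ h2)
    have h := mul_mem_exteriorPower (extD_form1_mem v) h1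
    rwa [show 2 + p = p + 1 + 1 by omega] at h

end ExtD

/-! ### Cohomology in the top degree -/

section Top
variable {K A : Type*} [Field K] [CommRing A] [Algebra K A]

theorem twistedD_apply (ξ : Ω[A⁄K]) (x : Forms K A) :
    twistedD ξ x = extD K A x + form1 K A ξ * x := rfl

theorem twistedD_mem (ξ : Ω[A⁄K]) {p : ℕ} {x : Forms K A} (hx : x ∈ ⋀[A]^p (Ω[A⁄K])) :
    twistedD ξ x ∈ ⋀[A]^(p + 1) (Ω[A⁄K]) :=
  add_mem (extD_mem hx) (ι_mul_mem _ hx)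

/-- The twisted divergence `g ↦ ∑ (∂_q + a_q) g_q`. -/
def twistedDiv {ι : Type*} [Fintype ι] (pd : ι → Derivation K A A) (a : ι → A) :
    (ι → A) →ₗ[K] A :=
  ∑ q, ((pd q).toLinearMap + LinearMap.mulLeft K (a q)) ∘ₗ LinearMap.proj q

theorem twistedDiv_apply {ι : Type*} [Fintype ι] (pd : ι → Derivation K A A) (a : ι → A)
    (g : ι → A) : twistedDiv pd a g = ∑ q, (pd q (g q) + a q * g q) := by
  simp [twistedDiv]

variable {n : ℕ} (bs : Module.Basis (Fin n) A (Ω[A⁄K])) (z : Fin n → A)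
  (hbs : ∀ q, bs q = KaehlerDifferential.D K A (z q))

/-- The derivations dual to a basis of the differentials. -/
def dualDer {ι : Type*} (bs : Module.Basis ι A (Ω[A⁄K])) (q : ι) : Derivation K A A :=
  (bs.coord q).compDer (KaehlerDifferential.D K A)

theorem dualDer_apply {ι : Type*} (bs : Module.Basis ι A (Ω[A⁄K])) (q : ι) (f : A) :
    dualDer bs q f = bs.coord q (KaehlerDifferential.D K A f) := rfl

include hbs in
theorem extD_list_prod (l : List (Fin n)) (q : Fin n) :
    extD K A (l.map fun i => ExteriorAlgebra.ι A (bs i)).prod = 0 ∧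
      extD K A (contract (bs.coord q) (l.map fun i => ExteriorAlgebra.ι A (bs i)).prod) = 0 := by
  induction l with
  | nil =>
    rw [List.map_nil, List.prod_nil, CliffordAlgebra.contractLeft_one, map_zero,
      ← map_one (algebraMap A (Forms K A)), extD_algebraMap, Derivation.map_one_eq_zero, map_zero]
    exact ⟨rfl, rfl⟩
  | cons i l ih =>
    have hi : extD K A (form1 K A (bs i)) = 0 := by rw [hbs, extD_form1_D]
    rw [List.map_cons, List.prod_cons, contract_ι_mul, map_sub, extD_smul, extD_form1_mul,
      extD_form1_mul, hi, ih.1, ih.2]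
    simp [Finsupp.single_apply, apply_ite]

theorem volForm_eq_list :
    volForm bs = ((List.finRange n).map fun i => ExteriorAlgebra.ι A (bs i)).prod := by
  rw [volForm, List.ofFn_eq_map]

include hbs in
theorem twistedD_contract (ξ : Ω[A⁄K]) (q : Fin n) (f : A) :
    twistedD ξ (contract (bs.coord q) (f • volForm bs)) =
      (dualDer bs q f + bs.coord q ξ * f) • volForm bs := by
  have h := (extD_list_prod bs z hbs (List.finRange n) q).2
  rw [← volForm_eq_list] at h
  rw [twistedD_apply, map_smul, extD_smul, h, smul_zero, add_zero, mul_smul_comm,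
    ι_mul_contract bs _ _ (volForm_mem bs), ι_mul_contract bs _ _ (volForm_mem bs), smul_smul,
    ← add_smul, mul_comm f]
  rfl

include hbs in
/-- The exact forms of top degree are the twisted divergences. -/
theorem exactForms_eq (ξ : Ω[A⁄K]) (x : Forms K A) :
    x ∈ exactForms ξ n ↔
      ∃ g, x = twistedDiv (dualDer bs) (fun q => bs.coord q ξ) g • volForm bs := by
  constructor
  · intro hx
    let f : A →ₗ[K] Forms K A := (LinearMap.toSpanSingleton A (Forms K A) (volForm bs)).restrictScalars K
    suffices h : exactForms ξ n ≤
        (LinearMap.range (twistedDiv (dualDer bs) fun q => bs.coord q ξ)).map f by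
      obtain ⟨_, ⟨g, rfl⟩, rfl⟩ := h hx
      exact ⟨g, rfl⟩
    refine iSup₂_le fun p hp => ?_
    rintro _ ⟨y, hy, rfl⟩
    refine ⟨_, ⟨fun q => volCoeff bs (ExteriorAlgebra.ι A (bs q) * y), rfl⟩, ?_⟩
    have hy1 : y ∈ ⋀[A]^p (Ω[A⁄K]) := hy
    change twistedDiv (dualDer bs) (fun q => bs.coord q ξ) _ • volForm bs = _
    conv_rhs => rw [eq_sum_contract bs hp hy1, map_sum]
    rw [twistedDiv_apply, Finset.sum_smul]
    refine Finset.sum_congr rfl fun q _ => ?_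
    have hq : ExteriorAlgebra.ι A (bs q) * y ∈ ⋀[A]^n (Ω[A⁄K]) := by
      have h := ι_mul_mem (bs q) hy1
      rwa [show ⋀[A]^(p + 1) (Ω[A⁄K]) = ⋀[A]^n (Ω[A⁄K]) from congrArg _ hp] at h
    rw [← twistedD_contract bs z hbs, ← eq_volCoeff_smul_volForm bs hq]
  · rintro ⟨g, rfl⟩
    rw [twistedDiv_apply, Finset.sum_smul]
    refine sum_mem fun q _ => ?_
    rw [← twistedD_contract bs z hbs]
    have hp : n - 1 + 1 = n := by have := q.2; omega
    have hmem : ∀ {m p : ℕ} {x : Forms K A}, p + 1 = m → x ∈ ⋀[A]^m (Ω[A⁄K]) →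
        contract (bs.coord q) x ∈ ⋀[A]^p (Ω[A⁄K]) := by
      rintro _ p x rfl hx
      exact contract_mem_succ _ hx
    exact Submodule.mem_iSup_of_mem (n - 1) (Submodule.mem_iSup_of_mem hp
      ⟨_, hmem hp (Submodule.smul_mem _ _ (volForm_mem bs)), rfl⟩)

theorem mem_closedForms_top (bs : Module.Basis (Fin n) A (Ω[A⁄K])) (ξ : Ω[A⁄K]) {x : Forms K A} :
    x ∈ closedForms ξ n ↔ x ∈ ⋀[A]^n (Ω[A⁄K]) :=
  ⟨fun h => h.1, fun h =>
    ⟨h, exteriorPower_eq_zero_of_lt bs (Nat.lt_succ_self n) (twistedD_mem ξ h)⟩⟩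

/-- The class of the top form with the coefficient `f`. -/
def topClass (ξ : Ω[A⁄K]) : A →ₗ[K] DeRhamH ξ n :=
  (Submodule.mkQ _).comp
    (LinearMap.codRestrict (closedForms ξ n)
      ((LinearMap.toSpanSingleton A (Forms K A) (volForm bs)).restrictScalars K)
      (fun _ => (mem_closedForms_top bs ξ).mpr (Submodule.smul_mem _ _ (volForm_mem bs))))

theorem mk_eq_topClass (ξ : Ω[A⁄K]) (x : closedForms ξ n) :
    Submodule.Quotient.mk x = topClass bs ξ (volCoeff bs x.1) := by
  refine congrArg _ (Subtype.ext ?_)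
  exact eq_volCoeff_smul_volForm bs ((mem_closedForms_top bs ξ).mp x.2)

theorem topClass_surjective (ξ : Ω[A⁄K]) : Function.Surjective (topClass bs ξ) := by
  intro y
  obtain ⟨x, rfl⟩ := Submodule.Quotient.mk_surjective _ y
  exact ⟨_, (mk_eq_topClass bs ξ x).symm⟩

include hbs in
theorem topClass_eq_zero_iff (ξ : Ω[A⁄K]) (f : A) :
    topClass bs ξ f = 0 ↔
      f ∈ LinearMap.range (twistedDiv (dualDer bs) fun q => bs.coord q ξ) := by
  have h : topClass bs ξ f = 0 ↔ f • volForm bs ∈ exactForms ξ n := by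
    rw [topClass, LinearMap.comp_apply, Submodule.mkQ_apply, Submodule.Quotient.mk_eq_zero]
    rfl
  rw [h, exactForms_eq bs z hbs]
  constructor
  · rintro ⟨g, hg⟩
    refine ⟨g, ?_⟩
    have := congrArg (volCoeff bs) hg
    rw [map_smul, map_smul, volCoeff_volForm, smul_eq_mul, smul_eq_mul, mul_one, mul_one] at this
    exact this.symm
  · rintro ⟨g, rfl⟩
    exact ⟨g, rfl⟩

end Top

/-! ### Absolute and relative forms -/

section Absolute
variable {k K A : Type*} [Field k] [Field K] [Algebra k K] [CommRing A] [Algebra K A]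
  [Algebra k A] [IsScalarTower k K A]

theorem relForms_form1 (w : Ω[A⁄k]) :
    relForms k K A (form1 k A w) = form1 K A (KaehlerDifferential.map k K A A w) :=
  ExteriorAlgebra.map_apply_ι _ _

theorem map_baseForm (η : Ω[K⁄k]) :
    KaehlerDifferential.map k K A A (baseForm k K A η) = 0 := by
  induction η using kaehler_induction with
  | h0 => simp
  | hadd x y hx hy => rw [map_add, map_add, hx, hy, add_zero]
  | hD f g =>
    rw [map_smul, baseForm, KaehlerDifferential.map_D, ← algebraMap_smul A f, map_smul,
      KaehlerDifferential.map_D, Algebra.algebraMap_self_apply, Derivation.map_algebraMap,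
      smul_zero]

theorem relForms_baseForm (η : Ω[K⁄k]) : relForms k K A (form1 k A (baseForm k K A η)) = 0 := by
  rw [relForms_form1, map_baseForm, map_zero]

theorem relForms_signInv (x : Forms k A) :
    relForms k K A (signInv k A x) = signInv K A (relForms k K A x) := by
  induction x using ExteriorAlgebra.induction with
  | algebraMap r => simp
  | ι v =>
    have h : relForms k K A (CliffordAlgebra.ι 0 v) = form1 K A _ := relForms_form1 v
    rw [CliffordAlgebra.involute_ι, map_neg, h, CliffordAlgebra.involute_ι]
  | mul a b ha hb => simp only [map_mul, ha, hb]
  | add a b ha hb => simp only [map_add, ha, hb]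

theorem relForms_extD (x : Forms k A) :
    relForms k K A (extD k A x) = extD K A (relForms k K A x) := by
  induction x using ExteriorAlgebra.induction with
  | algebraMap r =>
    rw [extD_algebraMap, relForms_form1, KaehlerDifferential.map_D, AlgHom.commutes,
      extD_algebraMap]; rfl
  | ι v =>
    induction v using kaehler_induction with
    | h0 => simp
    | hadd x y hx hy => simp only [map_add, hx, hy]
    | hD f g =>
      rw [map_smul, extD_smul, extD_form1_D, smul_zero, add_zero, map_smul, extD_smul, map_mul,
        relForms_form1, relForms_form1, KaehlerDifferential.map_D, KaehlerDifferential.map_D,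
        extD_form1_D, smul_zero, add_zero]
      rfl
  | mul a b ha hb => simp only [extD_mul, map_add, map_mul, ha, hb, relForms_signInv]
  | add a b ha hb => simp only [map_add, ha, hb]

theorem relForms_mem_exteriorPower {p : ℕ} {x : Forms k A} (hx : x ∈ ⋀[A]^p (Ω[A⁄k])) :
    relForms k K A x ∈ ⋀[A]^p (Ω[A⁄K]) := by
  refine exteriorPower_induction (P := fun p x => relForms k K A x ∈ ⋀[A]^p (Ω[A⁄K]))
    ?_ ?_ ?_ ?_ hx
  · rw [map_one]; exact one_mem_exteriorPower
  · intro p x y h1 h2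
    rw [map_add]; exact add_mem h1 h2
  · intro p r x h
    rw [map_smul]; exact Submodule.smul_mem _ _ h
  · intro p v x _ h
    have h1 : relForms k K A (ExteriorAlgebra.ι A v) = form1 K A _ := relForms_form1 v
    rw [map_mul, h1]
    exact ι_mul_mem _ h

theorem relForms_twistedD (Ψ : Ω[A⁄k]) (x : Forms k A) :
    relForms k K A (twistedD Ψ x) =
      twistedD (KaehlerDifferential.map k K A A Ψ) (relForms k K A x) := by
  rw [twistedD_apply, twistedD_apply, map_add, map_mul, relForms_extD, relForms_form1]

variable {n : ℕ} (bs : Module.Basis (Fin n) A (Ω[A⁄K])) (z : Fin n → A)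
  (hbs : ∀ q, bs q = KaehlerDifferential.D K A (z q))

/-- The kernel of the projection to the relative forms is generated by the differentials of constants. -/
theorem ker_map_induction {P : Ω[A⁄k] → Prop} (h0 : P 0)
    (hadd : ∀ x y, P x → P y → P (x + y))
    (hc : ∀ (f : A) (c : K), P (f • KaehlerDifferential.D k A (algebraMap K A c)))
    {w : Ω[A⁄k]} (hw : KaehlerDifferential.map k K A A w = 0) : P w := by
  have h : w ∈ LinearMap.range (KaehlerDifferential.mapBaseChange k K A) := by
    rw [KaehlerDifferential.range_mapBaseChange]; exact hw
  obtain ⟨t, rfl⟩ := h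
  clear hw
  induction t using TensorProduct.induction_on with
  | zero => rw [map_zero]; exact h0
  | add x y hx hy =>
    rw [map_add]
    exact hadd _ _ hx hy
  | tmul f η =>
    rw [KaehlerDifferential.mapBaseChange_tmul]
    induction η using kaehler_induction generalizing f with
    | h0 => rw [map_zero, smul_zero]; exact h0
    | hadd x y hx hy => rw [map_add, smul_add]; exact hadd _ _ (hx f) (hy f)
    | hD c c' =>
      rw [map_smul, KaehlerDifferential.map_D, ← algebraMap_smul A c, smul_smul]
      exact hc _ _

/-- The lift of the relative forms to absolute forms that is given by the coordinates `z`. -/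
def coordSection : Ω[A⁄K] →ₗ[A] Ω[A⁄k] :=
  bs.constr A fun q => KaehlerDifferential.D k A (z q)

include hbs in
theorem map_coordSection (w : Ω[A⁄K]) :
    KaehlerDifferential.map k K A A (coordSection (k := k) bs z w) = w := by
  have h : (KaehlerDifferential.map k K A A) ∘ₗ coordSection (k := k) bs z = LinearMap.id := by
    refine bs.ext fun q => ?_
    rw [LinearMap.comp_apply, coordSection, Module.Basis.constr_basis, KaehlerDifferential.map_D,
      LinearMap.id_apply, hbs]
    rfl
  exact congrArg (fun f => f w) h

omit [Algebra k K] [IsScalarTower k K A] in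
theorem coordSection_apply (w : Ω[A⁄K]) : coordSection (k := k) bs z w =
    ∑ q, bs.coord q w • KaehlerDifferential.D k A (z q) := by
  rw [coordSection, Module.Basis.constr_apply_fintype]
  rfl

include hbs in
/-- The absolute differentials are generated by the differentials of the coordinates and of the
constants. -/
theorem absolute_induction {P : Ω[A⁄k] → Prop} (h0 : P 0)
    (hadd : ∀ x y, P x → P y → P (x + y))
    (hc : ∀ (f : A) (c : K), P (f • KaehlerDifferential.D k A (algebraMap K A c)))
    (hz : ∀ (f : A) (q : Fin n), P (f • KaehlerDifferential.D k A (z q))) (w : Ω[A⁄k]) : P w := by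
  rw [← sub_add_cancel w (coordSection bs z (KaehlerDifferential.map k K A A w))]
  refine hadd _ _ (ker_map_induction h0 hadd hc ?_) ?_
  · rw [map_sub, map_coordSection bs z hbs, sub_self]
  · rw [coordSection_apply]
    exact Finset.sum_induction _ P hadd h0 fun q _ => hz _ _

include hbs in
theorem derivation_eq_zero (X : Derivation k A A) (hc : ∀ c : K, X (algebraMap K A c) = 0)
    (hz : ∀ q, X (z q) = 0) : X = 0 := by
  ext f
  rw [← Derivation.liftKaehlerDifferential_comp_D X f]
  refine absolute_induction bs z hbs (P := fun w => X.liftKaehlerDifferential w = 0)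
    (map_zero _) (fun x y hx hy => by rw [map_add, hx, hy, add_zero]) (fun f c => ?_)
    (fun f q => ?_) _
  · rw [map_smul, Derivation.liftKaehlerDifferential_comp_D, hc, smul_zero]
  · rw [map_smul, Derivation.liftKaehlerDifferential_comp_D, hz, smul_zero]

/-- The absolute `p`-forms that are divisible by 1-forms of `K`. -/
def fil1 (k K A : Type*) [Field k] [Field K] [Algebra k K] [CommRing A] [Algebra K A]
    [Algebra k A] [IsScalarTower k K A] (p : ℕ) : Submodule A (Forms k A) :=
  Submodule.span A {x | ∃ (q : ℕ) (c : K), ∃ y ∈ ⋀[A]^q (Ω[A⁄k]), q + 1 = p ∧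
    x = form1 k A (KaehlerDifferential.D k A (algebraMap K A c)) * y}

theorem form1_mul_mem_fil1 {p : ℕ} (w : Ω[A⁄k]) (hw : KaehlerDifferential.map k K A A w = 0)
    {x : Forms k A} (hx : x ∈ ⋀[A]^p (Ω[A⁄k])) : form1 k A w * x ∈ fil1 k K A (p + 1) := by
  refine ker_map_induction (P := fun w => form1 k A w * x ∈ fil1 k K A (p + 1)) ?_ ?_ ?_ hw
  · rw [map_zero, zero_mul]; exact zero_mem _
  · intro v w h1 h2
    rw [map_add, add_mul]; exact add_mem h1 h2
  · intro f c
    rw [map_smul, smul_mul_assoc]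
    exact Submodule.smul_mem _ _ (Submodule.subset_span ⟨p, c, x, hx, rfl, rfl⟩)

theorem mul_mem_fil1 {p : ℕ} (w : Ω[A⁄k]) {x : Forms k A} (hx : x ∈ fil1 k K A p) :
    form1 k A w * x ∈ fil1 k K A (p + 1) := by
  induction hx using Submodule.span_induction with
  | zero => rw [mul_zero]; exact zero_mem _
  | add x y _ _ hx hy => rw [mul_add]; exact add_mem hx hy
  | smul a x _ hx => rw [mul_smul_comm]; exact Submodule.smul_mem _ _ hx
  | mem x hx =>
    obtain ⟨q, c, y, hy, rfl, rfl⟩ := hx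
    rw [← mul_assoc, form1_mul_swap, CliffordAlgebra.involute_ι, neg_mul, neg_mul, mul_assoc]
    exact neg_mem (Submodule.subset_span ⟨q + 1, c, _, ι_mul_mem _ hy, rfl, rfl⟩)

include hbs in
theorem sub_section_mem_fil1 {p : ℕ} {x : Forms k A} (hx : x ∈ ⋀[A]^p (Ω[A⁄k])) :
    x - ExteriorAlgebra.map (coordSection (k := k) bs z) (relForms k K A x) ∈ fil1 k K A p := by
  refine exteriorPower_induction (P := fun p x => x -
    ExteriorAlgebra.map (coordSection (k := k) bs z) (relForms k K A x) ∈ fil1 k K A p)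
    ?_ ?_ ?_ ?_ hx
  · simp
  · intro p x y h1 h2
    rw [map_add, map_add, add_sub_add_comm]
    exact add_mem h1 h2
  · intro p r x h
    rw [map_smul, map_smul, ← smul_sub]
    exact Submodule.smul_mem _ _ h
  · intro p v x hx h
    have h1 : relForms k K A (ExteriorAlgebra.ι A v) = form1 K A _ := relForms_form1 v
    rw [map_mul, h1, map_mul, ExteriorAlgebra.map_apply_ι]
    generalize hs : coordSection (k := k) bs z (KaehlerDifferential.map k K A A v) = s
    generalize hy : ExteriorAlgebra.map (coordSection (k := k) bs z) (relForms k K A x) = y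
    rw [hy] at h
    have e : ExteriorAlgebra.ι A v * x - ExteriorAlgebra.ι A s * y =
        form1 k A (v - s) * x + form1 k A s * (x - y) := by
      rw [map_sub, sub_mul, mul_sub]; abel
    rw [e]
    refine add_mem (form1_mul_mem_fil1 _ ?_ hx) (mul_mem_fil1 _ h)
    rw [map_sub, ← hs, map_coordSection bs z hbs, sub_self]

theorem mem_liftedForms_top (bs : Module.Basis (Fin n) A (Ω[A⁄K])) (ξ : Ω[A⁄K]) {x : Forms k A} :
    x ∈ liftedForms k ξ n ↔ x ∈ ⋀[A]^n (Ω[A⁄k]) :=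
  ⟨fun h => h.1, fun h => ⟨h, exteriorPower_eq_zero_of_lt bs (Nat.lt_succ_self n)
    (twistedD_mem ξ (relForms_mem_exteriorPower h))⟩⟩

include hbs in
/-- In the degree above the relative dimension, every absolute form is divisible by 1-forms of
the base field. -/
theorem exists_wedgeBase (ξ : Ω[A⁄K]) {x : Forms k A} (hx : x ∈ ⋀[A]^(n + 1) (Ω[A⁄k])) :
    ∃ y, x = wedgeBase k ξ n y := by
  have h := sub_section_mem_fil1 bs z hbs hx
  rw [exteriorPower_eq_zero_of_lt bs (Nat.lt_succ_self n) (relForms_mem_exteriorPower hx), map_zero,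
    sub_zero] at h
  clear hx
  induction h using Submodule.closure_induction with
  | zero => exact ⟨0, by rw [map_zero]⟩
  | add x y _ _ hx hy =>
    obtain ⟨a, rfl⟩ := hx
    obtain ⟨b, rfl⟩ := hy
    exact ⟨a + b, by rw [map_add]⟩
  | smul_mem r x hx =>
    obtain ⟨q, c, y, hy, hq, rfl⟩ := hx
    obtain rfl : q = n := by omega
    refine ⟨KaehlerDifferential.D k K c ⊗ₜ
      ⟨r • y, (mem_liftedForms_top bs ξ).mpr (Submodule.smul_mem _ _ hy)⟩, ?_⟩
    rw [wedgeBase, TensorProduct.lift.tmul]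
    change _ = form1 k A (baseForm k K A _) * (r • y)
    rw [baseForm, KaehlerDifferential.map_D, mul_smul_comm]

end Absolute

/-! ### The Gauß–Manin connection along a derivation of the base field -/

section Lie
variable {R A : Type*} [CommRing R] [CommRing A] [Algebra R A] (θ : Derivation R A A)

/-- The interior product with a vector field. -/
abbrev inner (θ : Derivation R A A) : Forms R A →ₗ[A] Forms R A :=
  contract θ.liftKaehlerDifferential

/-- The Lie derivative, defined by Cartan's formula. -/
def lieD (θ : Derivation R A A) (x : Forms R A) : Forms R A :=
  inner θ (extD R A x) + extD R A (inner θ x)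

theorem lieD_add (x y : Forms R A) : lieD θ (x + y) = lieD θ x + lieD θ y := by
  simp only [lieD, map_add]; abel

theorem lieD_one : lieD θ 1 = 0 := by
  have h : extD R A (1 : Forms R A) = 0 := by
    rw [← map_one (algebraMap A (Forms R A)), extD_algebraMap, Derivation.map_one_eq_zero, map_zero]
  rw [lieD, h, CliffordAlgebra.contractLeft_one, map_zero, map_zero, add_zero]

theorem lieD_smul (f : A) (x : Forms R A) : lieD θ (f • x) = θ f • x + f • lieD θ x := by
  simp only [lieD, extD_smul, map_add, map_smul, contract_ι_mul,
    Derivation.liftKaehlerDifferential_comp_D, smul_add]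
  abel

theorem inner_form1_mul (w : Ω[A⁄R]) (x : Forms R A) : inner θ (form1 R A w * x) =
    θ.liftKaehlerDifferential w • x - form1 R A w * inner θ x :=
  contract_ι_mul _ _ _

theorem lieD_D_mul (f : A) (x : Forms R A) :
    lieD θ (form1 R A (KaehlerDifferential.D R A f) * x) =
      form1 R A (KaehlerDifferential.D R A (θ f)) * x +
        form1 R A (KaehlerDifferential.D R A f) * lieD θ x := by
  simp only [lieD, extD_form1_mul, extD_form1_D, zero_mul, zero_sub, map_neg, inner_form1_mul,
    Derivation.liftKaehlerDifferential_comp_D, map_sub, extD_smul, mul_add]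
  abel

theorem lieD_smul_D (f g : A) : lieD θ (form1 R A (f • KaehlerDifferential.D R A g)) =
    form1 R A (θ f • KaehlerDifferential.D R A g + f • KaehlerDifferential.D R A (θ g)) := by
  rw [map_smul, lieD_smul, ← mul_one (form1 R A (KaehlerDifferential.D R A g)), lieD_D_mul,
    lieD_one, mul_zero, add_zero, mul_one, mul_one, map_add, map_smul, map_smul]

end Lie

section Absolute
variable {k K A : Type*} [Field k] [Field K] [Algebra k K] [CommRing A] [Algebra K A]
  [Algebra k A] [IsScalarTower k K A]

variable {n : ℕ} (bs : Module.Basis (Fin n) A (Ω[A⁄K])) (z : Fin n → A)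
  (hbs : ∀ q, bs q = KaehlerDifferential.D K A (z q))
  (l : Ω[K⁄k] →ₗ[K] K) (θ : Derivation k A A)
  (hc : ∀ c : K, θ (algebraMap K A c) = algebraMap K A (l (KaehlerDifferential.D k K c)))
  (hz : ∀ q, θ (z q) = 0)

include hc in
theorem lift_baseForm (η : Ω[K⁄k]) :
    θ.liftKaehlerDifferential (baseForm k K A η) = algebraMap K A (l η) := by
  induction η using kaehler_induction with
  | h0 => simp
  | hadd x y hx hy => simp only [map_add, hx, hy]
  | hD f g =>
    rw [map_smul, l.map_smul, baseForm, KaehlerDifferential.map_D, ← algebraMap_smul A f, map_smul,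
      Derivation.liftKaehlerDifferential_comp_D, hc, smul_eq_mul, smul_eq_mul, map_mul]

/-- Contraction with one derivation cannot remove two differentials of constants. -/
theorem relForms_inner_fil2 {x : Forms k A} (hx : x ∈ fil2 k K A) :
    relForms k K A (inner θ x) = 0 := by
  induction hx using Submodule.span_induction with
  | zero => simp
  | add x y _ _ hx hy => rw [map_add, map_add, hx, hy, add_zero]
  | smul a x _ hx => rw [map_smul, map_smul, hx, smul_zero]
  | mem x hx =>
    obtain ⟨η, η', y, rfl⟩ := hx
    rw [mul_assoc, inner_form1_mul, map_sub, map_smul, map_mul, map_mul, relForms_baseForm,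
      relForms_baseForm, zero_mul, zero_mul, smul_zero, sub_zero]

theorem relClass_eq (ξ : Ω[A⁄K]) (x : liftedForms k ξ n) :
    relClass k ξ n x = topClass bs ξ (volCoeff bs (relForms k K A x.1)) :=
  mk_eq_topClass bs ξ ⟨_, relForms_mem k ξ n x.1 x.2⟩

include hc in
theorem topClass_inner_wedgeBase (ξ : Ω[A⁄K]) (y : Ω[K⁄k] ⊗[K] liftedForms k ξ n) :
    topClass bs ξ (volCoeff bs (relForms k K A (inner θ (wedgeBase k ξ n y)))) =
      TensorProduct.lid K _ (l.rTensor _ ((relClass k ξ n).lTensor (Ω[K⁄k]) y)) := by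
  induction y using TensorProduct.induction_on with
  | zero => simp
  | add x y hx hy => simp only [map_add, hx, hy]
  | tmul η x =>
    rw [wedgeBase, TensorProduct.lift.tmul]
    change topClass bs ξ (volCoeff bs (relForms k K A (inner θ (form1 k A (baseForm k K A η) * x.1)))) = _
    rw [inner_form1_mul, map_sub, map_mul, relForms_baseForm, zero_mul, sub_zero,
      lift_baseForm l θ hc, LinearMap.lTensor_tmul, LinearMap.rTensor_tmul, TensorProduct.lid_tmul,
      relClass_eq bs, map_smul, map_smul, algebraMap_smul, map_smul]

include hz in
theorem lieD_list_prod (l : List (Fin n)) :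
    lieD θ (l.map fun q => form1 k A (KaehlerDifferential.D k A (z q))).prod = 0 := by
  induction l with
  | nil => exact lieD_one θ
  | cons q l ih =>
    rw [List.map_cons, List.prod_cons, lieD_D_mul, hz, map_zero, map_zero, zero_mul, ih, mul_zero,
      add_zero]

include hc in
theorem relForms_lieD_fil1 {p : ℕ} {x : Forms k A} (hx : x ∈ fil1 k K A p) :
    relForms k K A x = 0 ∧ relForms k K A (lieD θ x) = 0 := by
  induction hx using Submodule.closure_induction with
  | zero => simp [lieD]
  | add x y _ _ hx hy => simp [lieD_add, hx, hy]
  | smul_mem r x hx =>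
    obtain ⟨q, c, y, hy, hq, rfl⟩ := hx
    have h : ∀ c : K, relForms k K A (form1 k A (KaehlerDifferential.D k A (algebraMap K A c))) = 0 := by
      intro c
      rw [relForms_form1, KaehlerDifferential.map_D]
      simp
    rw [lieD_smul, lieD_D_mul, hc]
    simp [h]

include hbs hc hz in
/-- The Lie derivative of the volume form vanishes, since `θ` kills the coordinates. -/
theorem volCoeff_lieD {x : Forms k A} (hx : x ∈ ⋀[A]^n (Ω[A⁄k])) :
    volCoeff bs (relForms k K A (lieD θ x)) = θ (volCoeff bs (relForms k K A x)) := by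
  set y := relForms k K A x with hy
  have hy1 := eq_volCoeff_smul_volForm bs (relForms_mem_exteriorPower (K := K) hx)
  rw [← hy] at hy1
  have h := relForms_lieD_fil1 l θ hc (sub_section_mem_fil1 bs z hbs hx)
  rw [← hy] at h
  set v := ((List.finRange n).map fun q => form1 k A (KaehlerDifferential.D k A (z q))).prod with hv
  have hsec : ExteriorAlgebra.map (coordSection (k := k) bs z) (volForm bs) = v := by
    rw [volForm_eq_list, map_list_prod, List.map_map, hv]
    congr 1
    refine List.map_congr_left fun q _ => ?_
    rw [Function.comp_apply, ExteriorAlgebra.map_apply_ι, coordSection, Module.Basis.constr_basis]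
  have hrel : relForms k K A v = volForm bs := by
    rw [volForm_eq_list, hv, map_list_prod, List.map_map]
    congr 1
    refine List.map_congr_left fun q _ => ?_
    rw [Function.comp_apply, relForms_form1, KaehlerDifferential.map_D, hbs]
    rfl
  have hx2 : x = (x - ExteriorAlgebra.map (coordSection (k := k) bs z) y) + volCoeff bs y • v := by
    rw [← hsec, ← map_smul, ← hy1, sub_add_cancel]
  rw [hx2, lieD_add, map_add, h.2, zero_add, lieD_smul, lieD_list_prod z θ hz, smul_zero, add_zero,
    map_smul, hrel, map_smul, volCoeff_volForm, smul_eq_mul, mul_one]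

include hbs hc hz in
/-- Contracted with a vector field that lifts a derivation of `K`, the operator `d + Ψ` becomes
the operator `θ + Ψ(θ)` on the coefficients of the top forms. -/
theorem topClass_inner_twistedD (ξ : Ω[A⁄K]) (Ψ : Ω[A⁄k])
    (hΨ : KaehlerDifferential.map k K A A Ψ = ξ) {x : Forms k A} (hx : x ∈ ⋀[A]^n (Ω[A⁄k])) :
    topClass bs ξ (volCoeff bs (relForms k K A (inner θ (twistedD Ψ x)))) =
      topClass bs ξ (θ (volCoeff bs (relForms k K A x)) +
        θ.liftKaehlerDifferential Ψ * volCoeff bs (relForms k K A x)) := by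
  have e : relForms k K A (inner θ (twistedD Ψ x)) = relForms k K A (lieD θ x) +
      θ.liftKaehlerDifferential Ψ • relForms k K A x -
      twistedD ξ (relForms k K A (inner θ x)) := by
    rw [twistedD_apply, map_add, inner_form1_mul, lieD, ← hΨ, ← relForms_twistedD, twistedD_apply]
    simp only [map_add, map_sub, map_smul]
    abel
  have hex : twistedD ξ (relForms k K A (inner θ x)) ∈ exactForms ξ n := by
    obtain ⟨_, h⟩ | ⟨p, hp, h⟩ := contract_mem θ.liftKaehlerDifferential hx
    · rw [show inner θ x = 0 from h, map_zero, map_zero]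
      exact zero_mem _
    · exact Submodule.mem_iSup_of_mem p (Submodule.mem_iSup_of_mem hp.symm
        ⟨_, relForms_mem_exteriorPower h, rfl⟩)
  obtain ⟨g, hg⟩ := (exactForms_eq bs z hbs ξ _).mp hex
  rw [e, map_sub, map_add, volCoeff_lieD bs z hbs l θ hc hz hx, map_smul, hg, map_smul,
    volCoeff_volForm, smul_eq_mul, smul_eq_mul, mul_one, map_sub,
    (topClass_eq_zero_iff bs z hbs ξ _).mpr ⟨g, rfl⟩, sub_zero]

include hbs hc hz in
/-- The lift of a derivation of `K` that kills the coordinates commutes with the partial derivatives. -/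
theorem dualDer_comm (q : Fin n) (f : A) : dualDer bs q (θ f) = θ (dualDer bs q f) := by
  have h : ⁅(dualDer bs q).restrictScalars k, θ⁆ = 0 := by
    refine derivation_eq_zero bs z hbs _ (fun c => ?_) (fun p => ?_)
    · rw [Derivation.commutator_apply, hc]
      simp
    · rw [Derivation.commutator_apply, hz]
      simp only [map_zero, zero_sub, neg_eq_zero]
      change θ (bs.coord q (KaehlerDifferential.D K A (z p))) = 0
      rw [← hbs, Module.Basis.coord_apply, Module.Basis.repr_self, Finsupp.single_apply]
      split_ifs <;> simp
  have h2 := congrArg (fun X => X f) h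
  exact sub_eq_zero.mp h2

include hbs hc hz in
/-- The curvature condition on `Ψ`, in coordinates. -/
theorem dualDer_lift_eq (Ψ : Ω[A⁄k]) (hcurv : extD k A (form1 k A Ψ) ∈ fil2 k K A) (q : Fin n) :
    dualDer bs q (θ.liftKaehlerDifferential Ψ) =
      θ (bs.coord q (KaehlerDifferential.map k K A A Ψ)) := by
  have key : ∀ w : Ω[A⁄k], ∃ w' : Ω[A⁄K], relForms k K A (lieD θ (form1 k A w)) = form1 K A w' ∧
      bs.coord q w' = θ (bs.coord q (KaehlerDifferential.map k K A A w)) := by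
    intro w
    induction w using kaehler_induction with
    | h0 => exact ⟨0, by simp [lieD], by simp⟩
    | hadd x y hx hy =>
      obtain ⟨x', h1, h2⟩ := hx
      obtain ⟨y', h3, h4⟩ := hy
      exact ⟨x' + y', by rw [map_add, lieD_add, map_add, h1, h3, map_add],
        by rw [map_add, h2, h4, map_add, map_add, map_add]⟩
    | hD f g =>
      refine ⟨_, by rw [lieD_smul_D, relForms_form1], ?_⟩
      simp only [map_add, map_smul, KaehlerDifferential.map_D, Algebra.algebraMap_self_apply,
        smul_eq_mul, Derivation.leibniz]
      have h := dualDer_comm bs z hbs l θ hc hz q g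
      rw [dualDer_apply, dualDer_apply] at h
      rw [h]
      ring
  obtain ⟨w', h1, h2⟩ := key Ψ
  have h := relForms_inner_fil2 (K := K) θ hcurv
  rw [← h2, dualDer_apply]
  have h3 : inner θ (extD k A (form1 k A Ψ)) = lieD θ (form1 k A Ψ) -
      form1 k A (KaehlerDifferential.D k A (θ.liftKaehlerDifferential Ψ)) := by
    rw [lieD, ← extD_algebraMap]
    have : inner θ (form1 k A Ψ) = algebraMap A _ (θ.liftKaehlerDifferential Ψ) :=
      CliffordAlgebra.contractLeft_ι 0 _ Ψ
    rw [this, add_sub_cancel_right]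
  rw [h3, map_sub, h1, relForms_form1, KaehlerDifferential.map_D, ← map_sub] at h
  have h4 := (ExteriorAlgebra.ι_eq_zero_iff _).mp h
  rw [sub_eq_zero.mp h4]
  rfl

include hbs hc hz in
/-- The restriction of an absolute form to a point, contracted with a derivation of `K`. -/
theorem apply_restrictPoint (b : A →ₐ[K] K) (w : Ω[A⁄k]) :
    l (restrictPoint b w) = b (θ.liftKaehlerDifferential w) +
      ∑ q, b (bs.coord q (KaehlerDifferential.map k K A A w)) *
        l (KaehlerDifferential.D k K (b (z q))) := by
  refine absolute_induction bs z hbs (P := fun w => l (restrictPoint b w) =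
    b (θ.liftKaehlerDifferential w) +
      ∑ q, b (bs.coord q (KaehlerDifferential.map k K A A w)) *
        l (KaehlerDifferential.D k K (b (z q)))) ?_ (fun x y hx hy => ?_) (fun f c => ?_)
    (fun f p => ?_) w
  · simp
  · simp only [map_add, hx, hy, add_mul, Finset.sum_add_distrib]
    ring
  · rw [restrictPoint_smul_D]
    simp [hc]
  · rw [restrictPoint_smul_D, map_smul, θ.liftKaehlerDifferential.map_smul,
      (KaehlerDifferential.map k K A A).map_smul, KaehlerDifferential.map_D,
      Derivation.liftKaehlerDifferential_comp_D, hz, Algebra.algebraMap_self_apply, ← hbs]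
    simp [Finsupp.single_apply, apply_ite b, ite_mul]

end Absolute

/-! ### Existence and uniqueness of the Gauß–Manin connection -/

section Conn
variable {k K : Type*} [Field k] [Field K] [Algebra k K]

theorem Conn.ext_toFun {V : Type*} [AddCommGroup V] [Module K V] {s t : Conn k K V}
    (h : ∀ v, s.toFun v = t.toFun v) : s = t := by
  cases s; cases t
  congr
  exact AddMonoidHom.ext h

theorem Conn.Iso.trans {U V W : Type*} [AddCommGroup U] [Module K U] [AddCommGroup V] [Module K V]
    [AddCommGroup W] [Module K W] {r : Conn k K U} {s : Conn k K V} {t : Conn k K W}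
    (h1 : Conn.Iso r s) (h2 : Conn.Iso s t) : Conn.Iso r t := by
  obtain ⟨e, he⟩ := h1
  obtain ⟨f, hf⟩ := h2
  refine ⟨e.trans f, fun v => ?_⟩
  rw [LinearEquiv.trans_apply, hf, he]
  exact (LinearMap.lTensor_comp_apply _ _ _ _).symm

theorem Conn.ofForm_apply (α : Ω[K⁄k]) (c : K) : (Conn.ofForm k α).toFun c =
    (KaehlerDifferential.D k K c + c • α) ⊗ₜ[K] (1 : K) := rfl

/-- Rescaling by `u` adds a logarithmic differential to the connection form. -/
theorem Conn.ofForm_iso {α β : Ω[K⁄k]} {u : K} (hu : u ≠ 0)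
    (h : u • β + KaehlerDifferential.D k K u = u • α) :
    Conn.Iso (Conn.ofForm k α) (Conn.ofForm k β) := by
  refine ⟨LinearEquiv.smulOfNeZero K K u hu, fun v => ?_⟩
  rw [Conn.ofForm_apply, Conn.ofForm_apply, LinearMap.lTensor_tmul]
  change (KaehlerDifferential.D k K (u • v) + (u • v) • β) ⊗ₜ[K] (1 : K) = _ ⊗ₜ[K] (u • (1 : K))
  rw [TensorProduct.tmul_smul, TensorProduct.smul_tmul']
  congr 1
  rw [smul_add, smul_comm u v α, ← h, smul_eq_mul, Derivation.leibniz, smul_add, smul_smul,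
    mul_comm v u]
  abel

/-- The connection on `V` that corresponds to `d + α` under `e : V ≃ K`. -/
def Conn.transport {V : Type*} [AddCommGroup V] [Module K V] (e : V ≃ₗ[K] K) (α : Ω[K⁄k]) :
    Conn k K V where
  toFun := (e.symm.toLinearMap.lTensor (Ω[K⁄k])).toAddMonoidHom.comp
    ((Conn.ofForm k α).toFun.comp e.toLinearMap.toAddMonoidHom)
  leibniz c v := by
    change e.symm.toLinearMap.lTensor _ ((Conn.ofForm k α).toFun (e (c • v))) = _ +
      c • e.symm.toLinearMap.lTensor _ ((Conn.ofForm k α).toFun (e v))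
    rw [map_smul, Conn.leibniz, map_add, map_smul, LinearMap.lTensor_tmul]
    simp

theorem Conn.transport_apply {V : Type*} [AddCommGroup V] [Module K V] (e : V ≃ₗ[K] K)
    (α : Ω[K⁄k]) (v : V) : (Conn.transport e α).toFun v =
      (KaehlerDifferential.D k K (e v) + e v • α) ⊗ₜ[K] e.symm 1 := by
  change e.symm.toLinearMap.lTensor _ ((Conn.ofForm k α).toFun (e v)) = _
  rw [Conn.ofForm_apply, LinearMap.lTensor_tmul]
  rfl

theorem Conn.transport_iso {V : Type*} [AddCommGroup V] [Module K V] (e : V ≃ₗ[K] K)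
    (α : Ω[K⁄k]) : Conn.Iso (Conn.transport e α) (Conn.ofForm k α) := by
  refine ⟨e, fun v => ?_⟩
  rw [Conn.transport_apply, LinearMap.lTensor_tmul, Conn.ofForm_apply]
  simp

/-- Elements of `Ω ⊗ V`, with `V` a line, are separated by the functionals on `Ω`. -/
theorem eq_of_rTensor_eq {V : Type*} [AddCommGroup V] [Module K V] (e : V ≃ₗ[K] K)
    {x y : Ω[K⁄k] ⊗[K] V}
    (h : ∀ l : Ω[K⁄k] →ₗ[K] K, TensorProduct.lid K V (l.rTensor V x) =
      TensorProduct.lid K V (l.rTensor V y)) : x = y := by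
  suffices hex : ∀ x : Ω[K⁄k] ⊗[K] V, ∃ η, x = η ⊗ₜ[K] e.symm 1 by
    obtain ⟨η, rfl⟩ := hex x
    obtain ⟨η', rfl⟩ := hex y
    congr 1
    refine (Module.forall_dual_apply_eq_zero_iff K (η - η')).mp ?_ |> sub_eq_zero.mp
    intro l
    have hl := congrArg e (h l)
    simpa [sub_eq_zero] using hl
  intro x
  induction x using TensorProduct.induction_on with
  | zero => exact ⟨0, by simp⟩
  | add x y hx hy =>
    obtain ⟨a, rfl⟩ := hx
    obtain ⟨b, rfl⟩ := hy
    exact ⟨a + b, (TensorProduct.add_tmul _ _ _).symm⟩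
  | tmul η v =>
    refine ⟨e v • η, ?_⟩
    rw [TensorProduct.smul_tmul, ← map_smul, smul_eq_mul, mul_one, LinearEquiv.symm_apply_apply]

end Conn

section Absolute
variable {k K A : Type*} [Field k] [Field K] [Algebra k K] [CommRing A] [Algebra K A]
  [Algebra k A] [IsScalarTower k K A]

variable {n : ℕ} (bs : Module.Basis (Fin n) A (Ω[A⁄K])) (z : Fin n → A)
  (hbs : ∀ q, bs q = KaehlerDifferential.D K A (z q))

include hbs in
/-- The operator `f ↦ θ f + Ψ(θ) f` is well defined on cohomology: by the curvature condition it commutes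
with the operators `∂_q + a_q`. -/
theorem topClass_covariant_congr {l : Ω[K⁄k] →ₗ[K] K} {θ : Derivation k A A}
    (hc : ∀ c : K, θ (algebraMap K A c) = algebraMap K A (l (KaehlerDifferential.D k K c)))
    (hz : ∀ q, θ (z q) = 0) {ξ : Ω[A⁄K]} {Ψ : Ω[A⁄k]}
    (hΨ : KaehlerDifferential.map k K A A Ψ = ξ)
    (hcurv : extD k A (form1 k A Ψ) ∈ fil2 k K A) {f : A} (hf : topClass bs ξ f = 0) :
    topClass bs ξ (θ f + θ.liftKaehlerDifferential Ψ * f) = 0 := by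
  rw [topClass_eq_zero_iff bs z hbs] at hf ⊢
  obtain ⟨g, rfl⟩ := hf
  refine ⟨fun q => θ (g q) + θ.liftKaehlerDifferential Ψ * g q, ?_⟩
  rw [twistedDiv_apply, twistedDiv_apply, map_sum, Finset.mul_sum, ← Finset.sum_add_distrib]
  refine Finset.sum_congr rfl fun q _ => ?_
  simp only [map_add, Derivation.leibniz, smul_eq_mul, dualDer_comm bs z hbs l θ hc hz,
    dualDer_lift_eq bs z hbs l θ hc hz Ψ hcurv, hΨ]
  ring

include hbs in
/-- If the top cohomology is spanned by the class of `g`, the Gauß–Manin connection is determined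
by its effect on `g`, along the derivations of `K`. -/
theorem exists_gaussManin
    (hext : ∀ l : Ω[K⁄k] →ₗ[K] K, ∃ θ : Derivation k A A,
      (∀ c : K, θ (algebraMap K A c) = algebraMap K A (l (KaehlerDifferential.D k K c))) ∧
      ∀ q, θ (z q) = 0)
    {ξ : Ω[A⁄K]} {Ψ : Ω[A⁄k]} (hΨ : KaehlerDifferential.map k K A A Ψ = ξ)
    (hcurv : extD k A (form1 k A Ψ) ∈ fil2 k K A) (g : A)
    (hspan : ∀ f : A, ∃ c : K, topClass bs ξ f = c • topClass bs ξ g)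
    (hg : topClass bs ξ g ≠ 0) (β : Ω[K⁄k])
    (hβ : ∀ (l : Ω[K⁄k] →ₗ[K] K) (θ : Derivation k A A),
      (∀ c : K, θ (algebraMap K A c) = algebraMap K A (l (KaehlerDifferential.D k K c))) →
      (∀ q, θ (z q) = 0) →
      topClass bs ξ (θ g + θ.liftKaehlerDifferential Ψ * g) = l β • topClass bs ξ g) :
    Module.finrank K (DeRhamH ξ n) = 1 ∧
      ∃ nabla : Conn k K (DeRhamH ξ n), IsGaussManin Ψ ξ n nabla ∧
        (∀ nabla' : Conn k K (DeRhamH ξ n), IsGaussManin Ψ ξ n nabla' → nabla' = nabla) ∧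
        Conn.Iso nabla (Conn.ofForm k β) := by
  have hfin : Module.finrank K (DeRhamH ξ n) = 1 := by
    refine finrank_eq_one (topClass bs ξ g) hg fun w => ?_
    obtain ⟨f, rfl⟩ := topClass_surjective bs ξ w
    obtain ⟨c, hc⟩ := hspan f
    exact ⟨c, hc.symm⟩
  let e : DeRhamH ξ n ≃ₗ[K] K := (LinearEquiv.toSpanNonzeroSingleton K _ _ hg ≪≫ₗ
    LinearEquiv.ofTop _ (by
      rw [eq_top_iff]
      rintro w -
      obtain ⟨f, rfl⟩ := topClass_surjective bs ξ w
      obtain ⟨c, hc⟩ := hspan f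
      exact Submodule.mem_span_singleton.mpr ⟨c, hc.symm⟩)).symm
  have he1 : e.symm 1 = topClass bs ξ g := by
    change (1 : K) • topClass bs ξ g = _
    rw [one_smul]
  have heg : e (topClass bs ξ g) = 1 := by rw [← he1, LinearEquiv.apply_symm_apply]
  -- along a derivation of `K`, both sides of the defining equation are `θ + Ψ(θ)`
  have key : ∀ (x : liftedForms k ξ n) (y : Ω[K⁄k] ⊗[K] liftedForms k ξ n),
      twistedD Ψ x.1 - wedgeBase k ξ n y ∈ fil2 k K A →
      (Conn.transport e β).toFun (relClass k ξ n x) = (relClass k ξ n).lTensor (Ω[K⁄k]) y := by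
    intro x y hxy
    refine eq_of_rTensor_eq e fun l => ?_
    obtain ⟨θ, hc, hz⟩ := hext l
    rw [← topClass_inner_wedgeBase bs l θ hc]
    have h1 := relForms_inner_fil2 (K := K) θ hxy
    rw [map_sub, map_sub, sub_eq_zero] at h1
    rw [← h1, topClass_inner_twistedD bs z hbs l θ hc hz ξ Ψ hΨ
      ((mem_liftedForms_top bs ξ).mp x.2), relClass_eq bs]
    set F := volCoeff bs (relForms k K A x.1)
    obtain ⟨c, hcF⟩ := hspan F
    have h2 : topClass bs ξ (F - c • g) = 0 := by rw [map_sub, map_smul, hcF, sub_self]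
    have h3 := topClass_covariant_congr bs z hbs hc hz hΨ hcurv h2
    have h4 : θ F + θ.liftKaehlerDifferential Ψ * F =
        (θ (F - c • g) + θ.liftKaehlerDifferential Ψ * (F - c • g)) +
          (l (KaehlerDifferential.D k K c) • g + c • (θ g + θ.liftKaehlerDifferential Ψ * g)) := by
      simp only [Algebra.smul_def, map_sub, Derivation.leibniz, hc, Algebra.algebraMap_self_apply]
      ring
    rw [h4, map_add, h3, zero_add, map_add, map_smul, map_smul, hβ l θ hc hz, hcF,
      Conn.transport_apply, map_smul, heg, he1, LinearMap.rTensor_tmul, TensorProduct.lid_tmul,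
      smul_eq_mul, mul_one, map_add, add_smul, map_smul, smul_eq_mul, mul_smul]
  have hex : ∀ x : liftedForms k ξ n, ∃ y : Ω[K⁄k] ⊗[K] liftedForms k ξ n,
      twistedD Ψ x.1 - wedgeBase k ξ n y ∈ fil2 k K A := by
    intro x
    have hx := (mem_liftedForms_top bs ξ).mp x.2
    obtain ⟨y, hy⟩ := exists_wedgeBase bs z hbs ξ (add_mem (extD_mem hx) (ι_mul_mem Ψ hx))
    refine ⟨y, ?_⟩
    rw [← hy]
    change twistedD Ψ x.1 - twistedD Ψ x.1 ∈ _
    rw [sub_self]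
    exact zero_mem _
  refine ⟨hfin, Conn.transport e β, fun x => ?_, fun nabla' h' => ?_, Conn.transport_iso e β⟩
  · obtain ⟨y, hy⟩ := hex x
    exact ⟨y, hy, key x y hy⟩
  · refine Conn.ext_toFun fun v => ?_
    obtain ⟨x, rfl⟩ : ∃ x : liftedForms k ξ n, relClass k ξ n x = v := by
      obtain ⟨f, rfl⟩ := topClass_surjective bs ξ v
      have hm : ExteriorAlgebra.map (coordSection (k := k) bs z) (f • volForm bs) ∈
          ⋀[A]^n (Ω[A⁄k]) := by
        rw [volForm_eq, map_smul, ExteriorAlgebra.map_apply_ιMulti]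
        exact Submodule.smul_mem _ _ (ExteriorAlgebra.ιMulti_range A n ⟨_, rfl⟩)
      refine ⟨⟨_, (mem_liftedForms_top bs ξ).mpr hm⟩, ?_⟩
      have hid : (relForms k K A).comp (ExteriorAlgebra.map (coordSection (k := k) bs z)) =
          AlgHom.id A _ := by
        refine ExteriorAlgebra.hom_ext ?_
        refine LinearMap.ext fun w => ?_
        simp only [LinearMap.comp_apply, AlgHom.toLinearMap_apply, AlgHom.comp_apply,
          ExteriorAlgebra.map_apply_ι, AlgHom.id_apply]
        exact (relForms_form1 _).trans (by rw [map_coordSection bs z hbs])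
      rw [relClass_eq bs]
      have h := congrArg (fun F => F (f • volForm bs)) hid
      simp only [AlgHom.comp_apply, AlgHom.id_apply] at h
      rw [h, map_smul, volCoeff_volForm, smul_eq_mul, mul_one]
    obtain ⟨y, hy, h⟩ := h' x
    rw [h, key x y hy]

end Absolute

/-! ### Formal power series: the Poincaré lemma and adic approximation -/

section Formal
variable {K : Type*} [Field K] {n : ℕ}

open MvPowerSeries in
/-- Closedness of a form, in terms of coefficients. -/
theorem coeff_of_closed {g : Fin n → MvPowerSeries (Fin n) K}
    (hg : ∀ i j, pderiv K i (g j) = pderiv K j (g i)) (d : Fin n →₀ ℕ) (i j : Fin n) :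
    ((d j : K) + 1) * (if (d + Finsupp.single j 1 : Fin n →₀ ℕ) i = 0 then 0 else
      coeff (d + Finsupp.single j 1 - Finsupp.single i 1) (g i)) =
      (((d + Finsupp.single j 1 : Fin n →₀ ℕ) i : ℕ) : K) * coeff d (g j) := by
  by_cases hij : i = j
  · subst hij
    simp
  have h1 : (d + Finsupp.single j 1 : Fin n →₀ ℕ) i = d i := by simp [Ne.symm hij]
  rw [h1]
  split_ifs with h0
  · simp [h0]
  obtain ⟨c, rfl⟩ : ∃ c, d = c + Finsupp.single i 1 :=
    ⟨d - Finsupp.single i 1, (tsub_add_cancel_of_le (by simpa using Nat.one_le_iff_ne_zero.mpr h0)).symm⟩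
  have h2 := congrArg (coeff c) (hg j i)
  rw [coeff_pderiv, coeff_pderiv] at h2
  rw [add_right_comm, add_tsub_cancel_right]
  simp only [Finsupp.add_apply, Finsupp.single_eq_same, Finsupp.single_apply, if_neg hij, add_zero]
  push_cast
  linear_combination h2

open MvPowerSeries in
/-- The formal Poincaré lemma for 1-forms. -/
theorem exists_primitive [CharZero K] (g : Fin n → MvPowerSeries (Fin n) K)
    (hg : ∀ i j, pderiv K i (g j) = pderiv K j (g i)) :
    ∃ h : MvPowerSeries (Fin n) K, constantCoeff h = 0 ∧ ∀ i, pderiv K i h = g i := by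
  let h : MvPowerSeries (Fin n) K := fun d => (d.degree : K)⁻¹ *
    ∑ i, if d i = 0 then 0 else coeff (d - Finsupp.single i 1) (g i)
  have hcoeff : ∀ d, coeff d h = (d.degree : K)⁻¹ *
      ∑ i, if d i = 0 then 0 else coeff (d - Finsupp.single i 1) (g i) := fun d => rfl
  refine ⟨h, ?_, fun j => ?_⟩
  · rw [← coeff_zero_eq_constantCoeff_apply, hcoeff]
    simp
  · ext d
    rw [coeff_pderiv, hcoeff, mul_comm, mul_left_comm, Finset.mul_sum]
    simp only [coeff_of_closed hg]
    rw [← Finset.sum_mul, ← mul_assoc, ← Nat.cast_sum]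
    have hdeg : ∑ i, (d + Finsupp.single j 1 : Fin n →₀ ℕ) i = (d + Finsupp.single j 1).degree :=
      (Finsupp.degree_eq_sum _).symm
    rw [hdeg, inv_mul_cancel₀, one_mul]
    rw [Nat.cast_ne_zero]
    simp [map_add]

/-- An algebra `R = K + I`, with `I` generated by `t`, is approximated by the polynomials in `t`. -/
theorem exists_aeval_sub_mem_pow {R : Type*} [CommRing R] [Algebra K R] (t : Fin n → R)
    (h : ∀ f : R, ∃ (c : K) (g : Fin n → R), f = algebraMap K R c + ∑ i, t i * g i) (N : ℕ) (f : R) :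
    ∃ P : MvPolynomial (Fin n) K, P.totalDegree ≤ N ∧
      f - MvPolynomial.aeval t P ∈ (Ideal.span (Set.range t)) ^ (N + 1) := by
  have ht : ∀ i, t i ∈ Ideal.span (Set.range t) := fun i => Ideal.subset_span ⟨i, rfl⟩
  induction N generalizing f with
  | zero =>
    obtain ⟨c, g, rfl⟩ := h f
    refine ⟨MvPolynomial.C c, by simp, ?_⟩
    rw [MvPolynomial.aeval_C, add_sub_cancel_left, zero_add, pow_one]
    exact sum_mem fun i _ => Ideal.mul_mem_right _ _ (ht i)
  | succ N ih =>
    obtain ⟨c, g, rfl⟩ := h f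
    choose P hP1 hP2 using fun i => ih (g i)
    refine ⟨MvPolynomial.C c + ∑ i, MvPolynomial.X i * P i, ?_, ?_⟩
    · refine (MvPolynomial.totalDegree_add _ _).trans (max_le (by simp) ?_)
      refine (MvPolynomial.totalDegree_finsetSum _ _).trans (Finset.sup_le fun i _ => ?_)
      refine (MvPolynomial.totalDegree_mul _ _).trans ?_
      rw [MvPolynomial.totalDegree_X, add_comm]
      exact Nat.add_le_add_right (hP1 i) 1
    · have e : algebraMap K R c + ∑ i, t i * g i -
          MvPolynomial.aeval t (MvPolynomial.C c + ∑ i, MvPolynomial.X i * P i) =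
          ∑ i, t i * (g i - MvPolynomial.aeval t (P i)) := by
        simp only [map_add, map_sum, map_mul, MvPolynomial.aeval_C, MvPolynomial.aeval_X, mul_sub,
          Finset.sum_sub_distrib]
        ring
      rw [e, pow_succ']
      exact sum_mem fun i _ => Ideal.mul_mem_mul (ht i) (hP2 i)

theorem ker_eq_span {R : Type*} [CommRing R] [Algebra K R] (t : Fin n → R) (b : R →ₐ[K] K)
    (hb : ∀ i, b (t i) = 0)
    (h : ∀ f : R, ∃ (c : K) (g : Fin n → R), f = algebraMap K R c + ∑ i, t i * g i) :
    RingHom.ker b = Ideal.span (Set.range t) := by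
  apply le_antisymm
  · intro f hf
    obtain ⟨c, g, rfl⟩ := h f
    have hc : c = 0 := by
      have h1 : b (algebraMap K R c + ∑ i, t i * g i) = 0 := hf
      simpa [hb] using h1
    rw [hc, map_zero, zero_add]
    exact sum_mem fun i _ => Ideal.mul_mem_right _ _ (Ideal.subset_span ⟨i, rfl⟩)
  · rw [Ideal.span_le]
    rintro _ ⟨i, rfl⟩
    exact hb i

open MvPowerSeries in
/-- A power series without constant term lies in the ideal generated by the variables. -/
theorem powerSeries_decomp (f : MvPowerSeries (Fin n) K) :
    ∃ (c : K) (g : Fin n → MvPowerSeries (Fin n) K),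
      f = algebraMap K _ c + ∑ i, X i * g i := by
  -- a monomial is attributed to its first variable
  let G : Fin n → MvPowerSeries (Fin n) K := fun i d =>
    if ∀ j < i, d j = 0 then coeff (d + Finsupp.single i 1) f else 0
  have hG : ∀ i d, coeff d (G i) =
      if ∀ j < i, d j = 0 then coeff (d + Finsupp.single i 1) f else 0 := fun i d => rfl
  refine ⟨constantCoeff f, G, ?_⟩
  clear_value G
  ext d
  rw [map_add, map_sum, ← c_eq_algebraMap, coeff_C]
  have hX : ∀ i (g : MvPowerSeries (Fin n) K), coeff d (X i * g) =
      if Finsupp.single i 1 ≤ d then coeff (d - Finsupp.single i 1) g else 0 := by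
    intro i g
    rw [X, coeff_monomial_mul]
    simp
  have hle : ∀ i, Finsupp.single i 1 ≤ d ↔ d i ≠ 0 := by
    intro i
    rw [Finsupp.single_le_iff]
    exact Nat.one_le_iff_ne_zero
  simp only [hX, hle]
  by_cases hd : d = 0
  · subst hd
    simp
  rw [if_neg hd, zero_add]
  have hex : ∃ i, d i ≠ 0 := by
    by_contra! h
    exact hd (Finsupp.ext h)
  obtain ⟨i, hi, hmin⟩ : ∃ i, d i ≠ 0 ∧ ∀ j < i, d j = 0 := by
    have hne : (Finset.univ.filter fun i => d i ≠ 0).Nonempty := by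
      obtain ⟨i, hi⟩ := hex
      exact ⟨i, by simp [hi]⟩
    refine ⟨Finset.min' _ hne, (Finset.mem_filter.mp (Finset.min'_mem _ hne)).2, fun j hj => ?_⟩
    by_contra h
    exact absurd (Finset.min'_le _ j (by simp [h])) (not_le.mpr hj)
  rw [Finset.sum_eq_single i]
  · rw [if_pos hi, hG, if_pos, tsub_add_cancel_of_le ((hle i).mpr hi)]
    intro j hj
    simp [hmin j hj]
  · intro j _ hji
    split_ifs with hj
    · rw [hG, if_neg]
      intro h
      rcases lt_or_gt_of_ne hji with hlt | hlt
      · exact hj (hmin j hlt)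
      · have := h i hlt
        simp [hji] at this
        exact hi this
    · rfl
  · simp

open MvPowerSeries in
theorem le_order_of_mem_pow {N : ℕ} {f : MvPowerSeries (Fin n) K}
    (hf : f ∈ (RingHom.ker (constantCoeff (σ := Fin n) (R := K))) ^ N) : (N : ℕ∞) ≤ f.order := by
  induction N generalizing f with
  | zero => simp
  | succ N ih =>
    rw [pow_succ] at hf
    refine Submodule.mul_induction_on hf (fun a ha c hc => ?_) (fun a c ha hc => ?_)
    · refine le_trans ?_ le_order_mul
      rw [Nat.cast_succ]
      exact add_le_add (ih ha) (one_le_order_iff_constCoeff_eq_zero.mpr hc)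
    · exact le_trans (le_min ha hc) min_order_le_add

variable {A : Type*} [CommRing A] [Algebra K A]

/-- If the functions `t i` generate the ideal of the point `b`, a homomorphism that sends them to
the variables is a formal chart. -/
theorem isFormalParameters_of_chart (t : Fin n → A) (b : A →ₐ[K] K) (hb : ∀ i, b (t i) = 0)
    (h : ∀ f : A, ∃ (c : K) (g : Fin n → A), f = algebraMap K A c + ∑ i, t i * g i)
    (φ : A →ₐ[K] MvPowerSeries (Fin n) K) (hφ : ∀ i, φ (t i) = MvPowerSeries.X i) :
    IsFormalParameters b φ := by
  have hA := ker_eq_span t b hb h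
  have hS : RingHom.ker (MvPowerSeries.constantCoeff (σ := Fin n) (R := K)) =
      Ideal.span (Set.range (MvPowerSeries.X : Fin n → MvPowerSeries (Fin n) K)) :=
    ker_eq_span (K := K) MvPowerSeries.X
      ({ MvPowerSeries.constantCoeff (σ := Fin n) (R := K) with
        commutes' := fun c => by simp [MvPowerSeries.algebraMap_apply] } :
        MvPowerSeries (Fin n) K →ₐ[K] K)
      (fun i => MvPowerSeries.constantCoeff_X i) powerSeries_decomp
  have haev : ∀ P : MvPolynomial (Fin n) K, φ (MvPolynomial.aeval t P) = MvPolynomial.aeval MvPowerSeries.X P := by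
    intro P
    rw [← AlgHom.comp_apply, MvPolynomial.comp_aeval]
    congr 2
    exact funext hφ
  have hcoe : ∀ P : MvPolynomial (Fin n) K,
      MvPolynomial.aeval (MvPowerSeries.X : Fin n → MvPowerSeries (Fin n) K) P = P := by
    intro P
    induction P using MvPolynomial.induction_on with
    | C a => rw [MvPolynomial.aeval_C, MvPolynomial.coe_C]; rfl
    | add p q hp hq => rw [map_add, hp, hq, MvPolynomial.coe_add]
    | mul_X p i hp => rw [map_mul, hp, MvPolynomial.aeval_X, MvPolynomial.coe_mul, MvPolynomial.coe_X]
  have hmap : ∀ (N : ℕ) (f : A), f ∈ (RingHom.ker b) ^ N →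
      φ f ∈ (RingHom.ker (MvPowerSeries.constantCoeff (σ := Fin n) (R := K))) ^ N := by
    intro N f hf
    have h1 : Ideal.map φ (RingHom.ker b) ≤
        RingHom.ker (MvPowerSeries.constantCoeff (σ := Fin n) (R := K)) := by
      rw [hA, hS, Ideal.map_span]
      refine Ideal.span_mono ?_
      rintro _ ⟨_, ⟨i, rfl⟩, rfl⟩
      exact ⟨i, (hφ i).symm⟩
    exact Ideal.pow_right_mono h1 N (by rw [← Ideal.map_pow]; exact Ideal.mem_map_of_mem _ hf)
  intro N
  refine ⟨fun f => ⟨fun hf => ?_, hmap N f⟩, fun g => ?_⟩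
  · cases N with
    | zero => simp
    | succ N =>
      obtain ⟨P, hP1, hP2⟩ := exists_aeval_sub_mem_pow t h N f
      rw [← hA] at hP2
      have h2 := sub_mem hf (hmap _ _ hP2)
      rw [map_sub, sub_sub_cancel, haev, hcoe] at h2
      have hP : P = 0 := by
        ext d
        rw [MvPolynomial.coeff_zero]
        by_cases hd : d.degree < N + 1
        · rw [← MvPolynomial.coeff_coe]
          refine MvPowerSeries.coeff_of_lt_order (lt_of_lt_of_le ?_ (le_order_of_mem_pow h2))
          exact_mod_cast hd
        · refine MvPolynomial.coeff_eq_zero_of_totalDegree_lt (lt_of_le_of_lt hP1 ?_)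
          exact not_lt.mp hd
      rw [hP, map_zero, sub_zero] at hP2
      exact hP2
  · cases N with
    | zero => exact ⟨0, by simp⟩
    | succ N =>
      obtain ⟨P, _, hP2⟩ := exists_aeval_sub_mem_pow MvPowerSeries.X powerSeries_decomp N g
      refine ⟨MvPolynomial.aeval t P, ?_⟩
      rw [haev, hS]
      exact hP2

end Formal

/-! ### The discriminant in formal parameters -/

section Disc
variable {K A : Type*} [Field K] [CommRing A] [Algebra K A] {n : ℕ}

theorem formalCoeff_add (φ : A →ₐ[K] MvPowerSeries (Fin n) K) (i : Fin n) (v w : Ω[A⁄K]) :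
    formalCoeff φ i (v + w) = formalCoeff φ i v + formalCoeff φ i w := by
  unfold formalCoeff
  exact map_add _ _ _

theorem formalCoeff_zero (φ : A →ₐ[K] MvPowerSeries (Fin n) K) (i : Fin n) :
    formalCoeff φ i (0 : Ω[A⁄K]) = 0 := by
  unfold formalCoeff
  exact map_zero _

variable (bs : Module.Basis (Fin n) A (Ω[A⁄K])) (z : Fin n → A)
  (hbs : ∀ q, bs q = KaehlerDifferential.D K A (z q)) (φ : A →ₐ[K] MvPowerSeries (Fin n) K)

include hbs in
theorem formalCoeff_eq_sum (i : Fin n) (w : Ω[A⁄K]) : formalCoeff φ i w =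
    ∑ q, φ (bs.coord q w) * MvPowerSeries.pderiv K i (φ (z q)) := by
  have h : ∀ s : Finset (Fin n), formalCoeff φ i (∑ q ∈ s, bs.coord q w • bs q) =
      ∑ q ∈ s, φ (bs.coord q w) * MvPowerSeries.pderiv K i (φ (z q)) := by
    intro s
    induction s using Finset.induction_on with
    | empty => simp [formalCoeff_zero]
    | insert a s ha ih =>
      rw [Finset.sum_insert ha, Finset.sum_insert ha, formalCoeff_add, ih, hbs, formalCoeff_smul_D]
  rw [← h]
  exact congrArg _ (bs.sum_repr w).symm

include hbs in
theorem pderiv_chain (i : Fin n) (f : A) : MvPowerSeries.pderiv K i (φ f) =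
    ∑ q, φ (dualDer bs q f) * MvPowerSeries.pderiv K i (φ (z q)) := by
  have h := formalCoeff_eq_sum bs z hbs φ i (KaehlerDifferential.D K A f)
  have h2 := formalCoeff_smul_D φ i 1 f
  rw [one_smul, map_one, one_mul] at h2
  rw [← h2, h]
  rfl

theorem pderiv_comm (i j : Fin n) (f : MvPowerSeries (Fin n) K) :
    MvPowerSeries.pderiv K i (MvPowerSeries.pderiv K j f) =
      MvPowerSeries.pderiv K j (MvPowerSeries.pderiv K i f) := by
  ext d
  simp only [MvPowerSeries.coeff_pderiv]
  rw [add_right_comm]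
  by_cases h : i = j
  · subst h; rfl
  · simp [h, Ne.symm h]
    ring

include hbs in
theorem pderiv_formalCoeff_comm (ξ : Ω[A⁄K])
    (hcl : ∀ p q, dualDer bs p (bs.coord q ξ) = dualDer bs q (bs.coord p ξ)) (i j : Fin n) :
    MvPowerSeries.pderiv K i (formalCoeff φ j ξ) = MvPowerSeries.pderiv K j (formalCoeff φ i ξ) := by
  have key : ∀ i j, MvPowerSeries.pderiv K i (formalCoeff φ j ξ) =
      ∑ q, φ (bs.coord q ξ) *
        MvPowerSeries.pderiv K i (MvPowerSeries.pderiv K j (φ (z q))) +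
      ∑ q, ∑ p, φ (dualDer bs p (bs.coord q ξ)) * MvPowerSeries.pderiv K i (φ (z p)) *
        MvPowerSeries.pderiv K j (φ (z q)) := by
    intro i j
    rw [formalCoeff_eq_sum bs z hbs, map_sum, ← Finset.sum_add_distrib]
    refine Finset.sum_congr rfl fun q _ => ?_
    rw [Derivation.leibniz, smul_eq_mul, smul_eq_mul, pderiv_chain bs z hbs φ i (bs.coord q ξ),
      Finset.mul_sum]
    congr 1
    exact Finset.sum_congr rfl fun p _ => by ring
  rw [key, key, Finset.sum_comm]
  congr 1
  · exact Finset.sum_congr rfl fun q _ => by rw [pderiv_comm]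
  · refine Finset.sum_congr rfl fun q _ => Finset.sum_congr rfl fun p _ => ?_
    rw [hcl]
    ring

theorem quadMatrix_apply [CharZero K] (h : MvPowerSeries (Fin n) K) (i j : Fin n) :
    quadMatrix h i j = 2⁻¹ * MvPowerSeries.constantCoeff
      (MvPowerSeries.pderiv K i (MvPowerSeries.pderiv K j h)) := by
  rw [← MvPowerSeries.coeff_zero_eq_constantCoeff_apply, MvPowerSeries.coeff_pderiv,
    MvPowerSeries.coeff_pderiv, quadMatrix, Matrix.of_apply, zero_add]
  split_ifs with hij
  · subst hij
    rw [← Finsupp.single_add]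
    simp
    ring
  · simp [hij]
    ring

theorem constantCoeff_chart {b : A →ₐ[K] K} (hφ : IsFormalParameters b φ) (f : A) :
    MvPowerSeries.constantCoeff (φ f) = b f := by
  have h := ((hφ 1).1 (f - algebraMap K A (b f))).mpr (by
    rw [pow_one, RingHom.mem_ker]; simp)
  rw [pow_one, RingHom.mem_ker, map_sub, map_sub, AlgHom.commutes, MvPowerSeries.algebraMap_apply] at h
  simpa [sub_eq_zero] using h

theorem constantCoeff_pderiv_of_mem_sq {f : MvPowerSeries (Fin n) K}
    (hf : f ∈ (RingHom.ker (MvPowerSeries.constantCoeff (σ := Fin n) (R := K))) ^ 2) (i : Fin n) :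
    MvPowerSeries.constantCoeff (MvPowerSeries.pderiv K i f) = 0 := by
  rw [← MvPowerSeries.coeff_zero_eq_constantCoeff_apply, MvPowerSeries.coeff_pderiv, zero_add,
    MvPowerSeries.coeff_of_lt_order, zero_mul]
  refine lt_of_lt_of_le ?_ (le_order_of_mem_pow hf)
  simp [Finsupp.degree_single]

/-- The Jacobian matrix at the point `b` of the coordinates `z` along a formal chart. -/
def chartJacobian (z : Fin n → A) (φ : A →ₐ[K] MvPowerSeries (Fin n) K) : Matrix (Fin n) (Fin n) K :=
  Matrix.of fun q i => MvPowerSeries.constantCoeff (MvPowerSeries.pderiv K i (φ (z q)))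

include hbs in
/-- The variables are, modulo the square of the maximal ideal, images of functions, so that the Jacobian
matrix has a left inverse. -/
theorem det_chartJacobian_ne_zero {b : A →ₐ[K] K} (hφ : IsFormalParameters b φ) :
    (chartJacobian z φ).det ≠ 0 := by
  choose f hf using fun i => (hφ 2).2 (MvPowerSeries.X i)
  have h : (Matrix.of fun i q => b (dualDer bs q (f i))) * chartJacobian z φ = 1 := by
    ext i j
    have h1 := constantCoeff_pderiv_of_mem_sq (hf i) j
    rw [map_sub, map_sub, sub_eq_zero, pderiv_chain bs z hbs, map_sum] at h1
    rw [Matrix.mul_apply]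
    simp only [map_mul, constantCoeff_chart φ hφ] at h1
    refine Eq.trans h1.symm ?_
    by_cases hij : i = j
    · subst hij; simp
    · rw [MvPowerSeries.pderiv_X_of_ne hij, Matrix.one_apply_ne hij, map_zero]
  intro h0
  have := congrArg Matrix.det h
  rw [Matrix.det_mul, h0, mul_zero, Matrix.det_one] at this
  exact zero_ne_one this

include hbs in
/-- In any formal parameters at a zero of a closed form, the discriminant differs by a square from
the determinant of half of the Hessian matrix in the coordinates `z`. -/
theorem exists_isPrimitive [CharZero K] {b : A →ₐ[K] K} (hφ : IsFormalParameters b φ) (ξ : Ω[A⁄K])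
    (hcl : ∀ p q, dualDer bs p (bs.coord q ξ) = dualDer bs q (bs.coord p ξ))
    (hb : ∀ q, b (bs.coord q ξ) = 0) :
    ∃ h, IsPrimitive φ ξ h ∧ ∃ u : K, u ≠ 0 ∧ (quadMatrix h).det =
      u ^ 2 * ((2⁻¹ : K) ^ n * (Matrix.of fun p q => b (dualDer bs p (bs.coord q ξ))).det) := by
  obtain ⟨h, h0, hh⟩ := exists_primitive (fun i => formalCoeff φ i ξ) fun i j =>
    pderiv_formalCoeff_comm bs z hbs φ ξ hcl i j
  refine ⟨h, ⟨h0, hh⟩, (chartJacobian z φ).det, det_chartJacobian_ne_zero bs z hbs φ hφ, ?_⟩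
  have hM : quadMatrix h = (2⁻¹ : K) • ((chartJacobian z φ).transpose *
      (Matrix.of fun p q => b (dualDer bs p (bs.coord q ξ))) * chartJacobian z φ) := by
    ext i j
    rw [quadMatrix_apply, hh, formalCoeff_eq_sum bs z hbs, map_sum, map_sum, Matrix.smul_apply,
      Matrix.mul_apply, smul_eq_mul]
    congr 1
    refine Finset.sum_congr rfl fun q _ => ?_
    rw [Derivation.leibniz, smul_eq_mul, smul_eq_mul, map_add, map_mul, map_mul,
      constantCoeff_chart φ hφ, hb, zero_mul, zero_add, mul_comm, pderiv_chain bs z hbs, map_sum,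
      Matrix.mul_apply]
    change _ * (chartJacobian z φ q j) = _
    congr 1
    refine Finset.sum_congr rfl fun p _ => ?_
    rw [map_mul, constantCoeff_chart φ hφ, mul_comm]
    rfl
  rw [hM, Matrix.det_smul, Matrix.det_mul, Matrix.det_mul, Matrix.det_transpose, Fintype.card_fin]
  ring

end Disc

/-! ### Coordinates on a product of affine lines and punctured lines -/

section Zpw
variable {A : Type*} [CommRing A]

/-- Integer powers in a commutative ring; negative powers are only meaningful for units. -/
def zpw (x : A) (n : ℤ) : A := x ^ n.toNat * Ring.inverse x ^ (-n).toNat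

theorem zpw_of_nonneg (x : A) {n : ℤ} (hn : 0 ≤ n) : zpw x n = x ^ n.toNat := by
  rw [zpw, show (-n).toNat = 0 by omega, pow_zero, mul_one]

theorem zpw_zero (x : A) : zpw x 0 = 1 := by simp [zpw]

theorem zpw_one (x : A) : zpw x 1 = x := by simp [zpw]

theorem zpw_neg_one (x : A) : zpw x (-1) = Ring.inverse x := by simp [zpw]

theorem zpw_unit (v : Aˣ) (n : ℤ) : zpw (v : A) n = ((v ^ n : Aˣ) : A) := by
  rw [zpw, Ring.inverse_unit, ← Units.val_pow_eq_pow_val, ← Units.val_pow_eq_pow_val,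
    ← Units.val_mul, ← zpow_natCast, ← zpow_natCast, inv_zpow', ← zpow_add]
  congr 2
  omega

theorem zpw_add {x : A} {m n : ℤ} (h : IsUnit x ∨ 0 ≤ m ∧ 0 ≤ n) :
    zpw x (m + n) = zpw x m * zpw x n := by
  rcases h with ⟨v, rfl⟩ | ⟨hm, hn⟩
  · rw [zpw_unit, zpw_unit, zpw_unit, zpow_add, Units.val_mul]
  · rw [zpw_of_nonneg x hm, zpw_of_nonneg x hn, zpw_of_nonneg x (add_nonneg hm hn), ← pow_add]
    congr 1
    omega

theorem derivation_zpw {R : Type*} [CommRing R] [Algebra R A] (D : Derivation R A A) {x : A} {n : ℤ}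
    (h : IsUnit x ∨ 0 ≤ n) : D (zpw x n) = n * zpw x (n - 1) * D x := by
  rcases le_or_gt 0 n with hn | hn
  · rcases hn.eq_or_lt with rfl | hn
    · simp [zpw_zero]
    obtain ⟨m, rfl⟩ : ∃ m : ℕ, n = m + 1 := ⟨(n - 1).toNat, by omega⟩
    rw [zpw_of_nonneg x hn.le, zpw_of_nonneg x (by omega), Derivation.leibniz_pow]
    have h1 : ((m : ℤ) + 1).toNat = m + 1 := by omega
    have h2 : ((m : ℤ) + 1 - 1).toNat = m := by omega
    rw [h1, h2]
    simp
    ring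
  · obtain ⟨v, rfl⟩ := h.resolve_right (not_le.mpr hn)
    obtain ⟨m, rfl⟩ : ∃ m : ℕ, n = -(m + 1 : ℤ) := ⟨(-n - 1).toNat, by omega⟩
    have h1 : D (↑v⁻¹ : A) = -(↑v⁻¹ : A) ^ 2 • D (v : A) :=
      D.leibniz_of_mul_eq_one v.inv_mul
    have h2 : ∀ j : ℕ, zpw (v : A) (-(j : ℤ)) = (↑v⁻¹ : A) ^ j := by
      intro j
      rw [zpw_unit, zpow_neg, zpow_natCast, ← inv_pow, Units.val_pow_eq_pow_val]
    have h3 : zpw (v : A) (-(m + 1 : ℤ)) = (↑v⁻¹ : A) ^ (m + 1) := by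
      rw [← h2]; push_cast; rfl
    have h4 : zpw (v : A) (-(m + 1 : ℤ) - 1) = (↑v⁻¹ : A) ^ (m + 2) := by
      rw [← h2]; congr 1
    rw [h3, h4, Derivation.leibniz_pow, h1]
    simp
    ring

end Zpw

/-- `A` is the coordinate ring, over `K`, of a product of affine lines and punctured affine lines
with the coordinates `z`; those in `U` are invertible. -/
structure IsTorusCoord (K : Type u) {A : Type u} [Field K] [CommRing A] [Algebra K A]
    {ι : Type} (U : Set ι) (z : ι → A) : Prop where
  isUnit : ∀ q ∈ U, IsUnit (z q)
  lift : ∀ {B : Type u} [CommRing B] (f : K →+* B) (g : ι → B), (∀ q ∈ U, IsUnit (g q)) →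
    ∃ F : A →+* B, F.comp (algebraMap K A) = f ∧ ∀ q, F (z q) = g q
  adjoin : Algebra.adjoin K (Set.range z ∪ {x | ∃ q ∈ U, x * z q = 1}) = ⊤

namespace IsTorusCoord

variable {K A : Type u} [Field K] [CommRing A] [Algebra K A] {ι : Type} {U : Set ι} {z : ι → A}

theorem hom_eq (h : IsTorusCoord K U z) {B : Type*} [CommRing B] {F G : A →+* B}
    (hK : ∀ c, F (algebraMap K A c) = G (algebraMap K A c)) (hz : ∀ q, F (z q) = G (z q)) :
    F = G := by
  ext f
  have hf : f ∈ Algebra.adjoin K (Set.range z ∪ {x | ∃ q ∈ U, x * z q = 1}) := by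
    rw [h.adjoin]; trivial
  induction hf using Algebra.adjoin_induction with
  | mem x hx =>
    obtain ⟨q, rfl⟩ | ⟨q, hq, hx⟩ := hx
    · exact hz q
    · have h1 := congrArg F hx
      have h2 := congrArg G hx
      rw [map_mul, map_one] at h1 h2
      rw [← hz] at h2
      exact left_inv_eq_right_inv h1 (by rw [mul_comm]; exact h2)
  | algebraMap c => exact hK c
  | add x y _ _ hx hy => rw [map_add, map_add, hx, hy]
  | mul x y _ _ hx hy => rw [map_mul, map_mul, hx, hy]

theorem exists_algHom (h : IsTorusCoord K U z) {B : Type u} [CommRing B] [Algebra K B] (g : ι → B)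
    (hg : ∀ q ∈ U, IsUnit (g q)) : ∃ F : A →ₐ[K] B, ∀ q, F (z q) = g q := by
  obtain ⟨F, h1, h2⟩ := h.lift (algebraMap K B) g hg
  exact ⟨{ F with commutes' := fun c => congrArg (fun f => f c) h1 }, h2⟩

/-- A derivation of `A` can be prescribed on the constants and on the coordinates. -/
theorem exists_derivation (h : IsTorusCoord K U z) {k : Type*} [Field k] [Algebra k K] [Algebra k A]
    [IsScalarTower k K A] (δ : Derivation k K K) (v : ι → A) :
    ∃ θ : Derivation k A A, (∀ c, θ (algebraMap K A c) = algebraMap K A (δ c)) ∧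
      ∀ q, θ (z q) = v q := by
  let f : K →+* TrivSqZeroExt A A :=
    { toFun := fun c => TrivSqZeroExt.inl (algebraMap K A c) + TrivSqZeroExt.inr (algebraMap K A (δ c))
      map_one' := by simp
      map_zero' := by simp
      map_add' := fun a b => by ext <;> simp [Algebra.algebraMap_eq_smul_one, add_smul]
      map_mul' := fun a b => by
        ext
        · simp
        · simp only [Derivation.leibniz, smul_eq_mul, map_add, map_mul, TrivSqZeroExt.snd_add,
            TrivSqZeroExt.snd_inl, TrivSqZeroExt.snd_inr, TrivSqZeroExt.snd_mul,
            TrivSqZeroExt.fst_add, TrivSqZeroExt.fst_inl, TrivSqZeroExt.fst_inr,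
            op_smul_eq_smul, add_zero, zero_add] }
  obtain ⟨F, h1, h2⟩ := h.lift f (fun q => TrivSqZeroExt.inl (z q) + TrivSqZeroExt.inr (v q))
    (fun q hq => by
      rw [TrivSqZeroExt.isUnit_iff_isUnit_fst]
      simpa using h.isUnit q hq)
  have hF : ∀ c, F (algebraMap K A c) = f c := fun c => congrArg (fun g => g c) h1
  have hfst : ∀ x, (F x).fst = x := by
    intro x
    have := h.hom_eq (F := (TrivSqZeroExt.fstHom A A A).toRingHom.comp F) (G := RingHom.id A)
      (fun c => by simp [hF, f]) (fun q => by simp [h2])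
    exact congrArg (fun g => g x) this
  refine ⟨Derivation.mk' { toFun := fun x => (F x).snd, map_add' := ?_, map_smul' := ?_ } ?_, ?_, ?_⟩
  · intro x y
    simp
  · intro c x
    rw [← algebraMap_smul K c x, Algebra.smul_def, map_mul, hF, TrivSqZeroExt.snd_mul, hfst]
    simp [f, Algebra.smul_def]
    rw [IsScalarTower.algebraMap_apply k K A]
  · intro x y
    simp [hfst, mul_comm]
  · intro c
    change (F (algebraMap K A c)).snd = _
    rw [hF]
    simp [f, Algebra.algebraMap_eq_smul_one]
  · intro q
    simp [h2]

section Basis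

theorem exists_pd [DecidableEq ι] (h : IsTorusCoord K U z) (q : ι) :
    ∃ D : Derivation K A A, ∀ p, D (z p) = if p = q then 1 else 0 := by
  obtain ⟨D, _, h2⟩ := h.exists_derivation (k := K) 0 (fun p => if p = q then 1 else 0)
  exact ⟨D, h2⟩

theorem span_D (h : IsTorusCoord K U z) :
    Submodule.span A (Set.range fun q => KaehlerDifferential.D K A (z q)) = ⊤ := by
  rw [eq_top_iff, ← KaehlerDifferential.span_range_derivation, Submodule.span_le]
  rintro _ ⟨f, rfl⟩
  have hf : f ∈ Algebra.adjoin K (Set.range z ∪ {x | ∃ q ∈ U, x * z q = 1}) := by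
    rw [h.adjoin]; trivial
  have hz : ∀ q, KaehlerDifferential.D K A (z q) ∈
      Submodule.span A (Set.range fun q => KaehlerDifferential.D K A (z q)) :=
    fun q => Submodule.subset_span ⟨q, rfl⟩
  induction hf using Algebra.adjoin_induction with
  | mem x hx =>
    obtain ⟨q, rfl⟩ | ⟨q, hq, hx⟩ := hx
    · exact hz q
    · rw [SetLike.mem_coe, Derivation.leibniz_of_mul_eq_one _ hx]
      exact Submodule.smul_mem _ _ (hz q)
  | algebraMap c => simp
  | add x y _ _ hx hy => rw [map_add]; exact add_mem hx hy
  | mul x y _ _ hx hy =>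
    rw [Derivation.leibniz]
    exact add_mem (Submodule.smul_mem _ _ hy) (Submodule.smul_mem _ _ hx)

theorem exists_basis [Fintype ι] [DecidableEq ι] (h : IsTorusCoord K U z) :
    ∃ bs : Module.Basis ι A (Ω[A⁄K]), ∀ q, bs q = KaehlerDifferential.D K A (z q) := by
  choose pd hpd using h.exists_pd
  have hli : LinearIndependent A fun q => KaehlerDifferential.D K A (z q) := by
    rw [Fintype.linearIndependent_iff]
    intro g hg q
    have h1 := congrArg (pd q).liftKaehlerDifferential hg
    simpa [hpd] using h1
  exact ⟨Module.Basis.mk hli h.span_D.ge, fun q => by rw [Module.Basis.mk_apply]⟩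

end Basis

end IsTorusCoord

/-! ### Laurent monomials -/

section Mon
variable {K A : Type u} [Field K] [CommRing A] [Algebra K A] {ι : Type}
  {U : Set ι} {z : ι → A}

/-- Only the invertible coordinates may have negative exponents. -/
def Adm (U : Set ι) (e : ι → ℤ) : Prop := ∀ q, q ∉ U → 0 ≤ e q

theorem Adm.add {e e' : ι → ℤ} (h : Adm U e) (h' : Adm U e') : Adm U (e + e') :=
  fun q hq => add_nonneg (h q hq) (h' q hq)

theorem adm_single [DecidableEq ι] (q : ι) {n : ℤ} (hn : q ∈ U ∨ 0 ≤ n) :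
    Adm U (Pi.single q n) := by
  intro p hp
  rw [Pi.single_apply]
  split_ifs with h
  · subst h
    exact hn.resolve_left hp
  · exact le_rfl

theorem adm_zero : Adm U (0 : ι → ℤ) := fun _ _ => le_rfl

theorem derivation_prod_eq_zero {R M : Type*} [CommRing R] [Algebra R A] [AddCommGroup M] [Module A M]
    [Module R M] (D : Derivation R A M) (s : Finset ι) (f : ι → A) (hf : ∀ p ∈ s, D (f p) = 0) :
    D (∏ p ∈ s, f p) = 0 := by
  classical
  induction s using Finset.induction_on with
  | empty => simp
  | insert a s ha ih =>
    rw [Finset.prod_insert ha, Derivation.leibniz, hf a (Finset.mem_insert_self _ _),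
      ih fun p hp => hf p (Finset.mem_insert_of_mem hp), smul_zero, smul_zero, add_zero]

theorem isUnit_or_nonneg (h : IsTorusCoord K U z) {e : ι → ℤ} (he : Adm U e) (q : ι) :
    IsUnit (z q) ∨ 0 ≤ e q := by
  by_cases hq : q ∈ U
  · exact Or.inl (h.isUnit q hq)
  · exact Or.inr (he q hq)

variable [Fintype ι]

/-- The Laurent monomial with the exponents `e`. -/
def mon (z : ι → A) (e : ι → ℤ) : A := ∏ q, zpw (z q) (e q)

theorem mon_zero : mon z 0 = 1 := by simp [mon, zpw_zero]

theorem mon_single [DecidableEq ι] (q : ι) (n : ℤ) : mon z (Pi.single q n) = zpw (z q) n := by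
  rw [mon, Finset.prod_eq_single q (fun p _ hp => by rw [Pi.single_eq_of_ne hp, zpw_zero])
    (by simp), Pi.single_eq_same]

theorem mon_add (h : IsTorusCoord K U z) {e e' : ι → ℤ} (he : Adm U e) (he' : Adm U e') :
    mon z (e + e') = mon z e * mon z e' := by
  rw [mon, mon, mon, ← Finset.prod_mul_distrib]
  refine Finset.prod_congr rfl fun q _ => zpw_add ?_
  by_cases hq : q ∈ U
  · exact Or.inl (h.isUnit q hq)
  · exact Or.inr ⟨he q hq, he' q hq⟩

theorem derivation_mon [DecidableEq ι] (h : IsTorusCoord K U z) {R : Type*} [CommRing R] [Algebra R A]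
    (D : Derivation R A A) (q : ι) (hD : ∀ p ≠ q, D (z p) = 0) {e : ι → ℤ} (he : Adm U e) :
    D (mon z e) = (e q : A) * mon z (e - Pi.single q 1) * D (z q) := by
  have h1 : ∀ e : ι → ℤ, mon z e = zpw (z q) (e q) * ∏ p ∈ Finset.univ.erase q, zpw (z p) (e p) :=
    fun e => (Finset.mul_prod_erase _ _ (Finset.mem_univ q)).symm
  rw [h1 e, h1 (e - _), Derivation.leibniz, derivation_prod_eq_zero, smul_zero, zero_add,
    derivation_zpw D (isUnit_or_nonneg h he q), smul_eq_mul]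
  · have h2 : ∏ p ∈ Finset.univ.erase q, zpw (z p) ((e - Pi.single q 1 : ι → ℤ) p) =
        ∏ p ∈ Finset.univ.erase q, zpw (z p) (e p) := by
      refine Finset.prod_congr rfl fun p hp => ?_
      rw [Pi.sub_apply, Pi.single_eq_of_ne (Finset.ne_of_mem_erase hp), sub_zero]
    rw [h2, Pi.sub_apply, Pi.single_eq_same]
    ring
  · intro p hp
    rw [derivation_zpw D (isUnit_or_nonneg h he p), hD p (Finset.ne_of_mem_erase hp), mul_zero]

theorem derivation_mon_eq_zero (h : IsTorusCoord K U z) {R : Type*} [CommRing R] [Algebra R A]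
    (D : Derivation R A A) (hD : ∀ p, D (z p) = 0) {e : ι → ℤ} (he : Adm U e) :
    D (mon z e) = 0 :=
  derivation_prod_eq_zero D _ _ fun p _ => by
    rw [derivation_zpw D (isUnit_or_nonneg h he p), hD p, mul_zero]

theorem span_mon (h : IsTorusCoord K U z) (f : A) :
    f ∈ Submodule.span K (Set.range fun e : {e : ι → ℤ // Adm U e} => mon z e.1) := by
  classical
  have hmem : ∀ e : ι → ℤ, Adm U e →
      mon z e ∈ Submodule.span K (Set.range fun e : {e : ι → ℤ // Adm U e} => mon z e.1) :=
    fun e he => Submodule.subset_span ⟨⟨e, he⟩, rfl⟩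
  have hf : f ∈ Algebra.adjoin K (Set.range z ∪ {x | ∃ q ∈ U, x * z q = 1}) := by
    rw [h.adjoin]; trivial
  induction hf using Algebra.adjoin_induction with
  | mem x hx =>
    obtain ⟨q, rfl⟩ | ⟨q, hq, hx⟩ := hx
    · rw [← zpw_one (z q), ← mon_single]
      exact hmem _ (adm_single q (Or.inr zero_le_one))
    · have hx' : x = zpw (z q) (-1) := by
        rw [zpw_neg_one]
        obtain ⟨v, hv⟩ := h.isUnit q hq
        rw [← hv, Ring.inverse_unit]
        rw [← hv] at hx
        exact (Units.inv_eq_of_mul_eq_one_left hx).symm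
      rw [hx', ← mon_single]
      exact hmem _ (adm_single q (Or.inl hq))
  | algebraMap c =>
    rw [Algebra.algebraMap_eq_smul_one, ← mon_zero (z := z)]
    exact Submodule.smul_mem _ _ (hmem _ adm_zero)
  | add x y _ _ hx hy => exact add_mem hx hy
  | mul x y _ _ hx hy =>
    have hxy := Submodule.mul_mem_mul hx hy
    rw [Submodule.span_mul_span] at hxy
    refine Submodule.span_le.mpr ?_ hxy
    rintro _ ⟨_, ⟨⟨e, he⟩, rfl⟩, _, ⟨⟨e', he'⟩, rfl⟩, rfl⟩
    change mon z e * mon z e' ∈ _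
    rw [← mon_add h he he']
    exact hmem _ (he.add he')

theorem mon_induction (h : IsTorusCoord K U z) {P : A → Prop} (h0 : P 0)
    (hadd : ∀ x y, P x → P y → P (x + y)) (hsmul : ∀ (c : K) x, P x → P (c • x))
    (hmon : ∀ e, Adm U e → P (mon z e)) (f : A) : P f := by
  induction span_mon h f using Submodule.span_induction with
  | mem x hx =>
    obtain ⟨e, rfl⟩ := hx
    exact hmon _ e.2
  | zero => exact h0
  | add x y _ _ hx hy => exact hadd _ _ hx hy
  | smul c x _ hx => exact hsmul _ _ hx

/-- The Laurent monomials are linearly independent: their values under a functional can be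
prescribed. The functional is constructed on the ring of all Laurent polynomials. -/
theorem exists_functional (h : IsTorusCoord K U z) (c : (ι → ℤ) → K) :
    ∃ L : A →ₗ[K] K, ∀ e, Adm U e → L (mon z e) = c e := by
  classical
  have hunit : ∀ e : ι → ℤ, IsUnit (AddMonoidAlgebra.single e (1 : K)) := fun e =>
    IsUnit.of_mul_eq_one (AddMonoidAlgebra.single (-e) (1 : K)) (by
      rw [AddMonoidAlgebra.single_mul_single, add_neg_cancel, one_mul]; rfl)
  obtain ⟨F, hF⟩ := h.exists_algHom (B := AddMonoidAlgebra K (ι → ℤ))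
    (fun q => AddMonoidAlgebra.single (Pi.single q 1) 1) fun q _ => hunit _
  have hmul : ∀ a b : ι → ℤ, AddMonoidAlgebra.single (a + b) (1 : K) =
      AddMonoidAlgebra.single a 1 * AddMonoidAlgebra.single b 1 := by
    intro a b
    rw [AddMonoidAlgebra.single_mul_single, one_mul]
  have hnat : ∀ (a : ι → ℤ) (n : ℕ), (AddMonoidAlgebra.single a (1 : K)) ^ n =
      AddMonoidAlgebra.single (n • a) 1 := by
    intro a n
    rw [AddMonoidAlgebra.single_pow, one_pow]
  have hz : ∀ q (n : ℤ), IsUnit (z q) ∨ 0 ≤ n →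
      F (zpw (z q) n) = AddMonoidAlgebra.single (Pi.single q n) 1 := by
    intro q n hn
    have hpos : ∀ n : ℕ, F (z q ^ n) = AddMonoidAlgebra.single (Pi.single q (n : ℤ)) 1 := by
      intro n
      rw [map_pow, hF, hnat]
      congr 1
      rw [← Pi.single_smul]
      simp
    rcases le_or_gt 0 n with h0 | h0
    · rw [zpw_of_nonneg _ h0, hpos]
      congr 2
      omega
    · obtain ⟨v, hv⟩ := hn.resolve_right (not_le.mpr h0)
      have h1 : F (zpw (z q) n) * F (z q ^ n.natAbs) = 1 := by
        rw [← map_mul, ← hv, zpw_unit, ← Units.val_pow_eq_pow_val, ← Units.val_mul, ← zpow_natCast,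
          ← zpow_add, show n + n.natAbs = 0 by omega, zpow_zero, Units.val_one, map_one]
      rw [hpos] at h1
      refine left_inv_eq_right_inv h1 ?_
      rw [← hmul, ← Pi.single_add, show (n.natAbs : ℤ) + n = 0 by omega, Pi.single_zero]
      rfl
  have hprod : ∀ (s : Finset ι) (e : ι → ℤ), ∏ q ∈ s, AddMonoidAlgebra.single (Pi.single q (e q)) (1 : K)
      = AddMonoidAlgebra.single (∑ q ∈ s, Pi.single q (e q)) 1 := by
    intro s e
    induction s using Finset.induction_on with
    | empty => rfl
    | insert a s ha ih => rw [Finset.prod_insert ha, Finset.sum_insert ha, ih, hmul]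
  let Lc : AddMonoidAlgebra K (ι → ℤ) →ₗ[K] K :=
    { toFun := fun x => Finsupp.linearCombination K c x.coeff
      map_add' := fun x y => by simp
      map_smul' := fun a x => by simp }
  refine ⟨Lc.comp F.toLinearMap, fun e he => ?_⟩
  have hFe : F (mon z e) = AddMonoidAlgebra.single e 1 := by
    rw [mon, map_prod, Finset.prod_congr rfl fun q _ => hz q (e q) (isUnit_or_nonneg h he q), hprod,
      Finset.univ_sum_single]
  rw [LinearMap.comp_apply, AlgHom.toLinearMap_apply, hFe]
  simp [Lc]

/-- The coefficient functional of a Laurent monomial. -/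
theorem exists_coeff (h : IsTorusCoord K U z) [DecidableEq (ι → ℤ)] (e₀ : ι → ℤ) :
    ∃ L : A →ₗ[K] K, ∀ e, Adm U e → L (mon z e) = if e = e₀ then 1 else 0 :=
  exists_functional h _

/-- The coefficient of `z^(e - 1_q)` in `∂f/∂z_q`. -/
theorem coeff_pd [DecidableEq ι] (h : IsTorusCoord K U z) (D : Derivation K A A) (q : ι)
    (hD : ∀ p, D (z p) = if p = q then 1 else 0) (e₀ : ι → ℤ) (L L' : A →ₗ[K] K)
    (hL : ∀ e, Adm U e → L (mon z e) = if e = e₀ then 1 else 0)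
    (hL' : ∀ e, Adm U e → L' (mon z e) = if e = e₀ - Pi.single q 1 then 1 else 0) (f : A) :
    L' (D f) = e₀ q * L f := by
  refine mon_induction h (P := fun f => L' (D f) = e₀ q * L f) (by simp) (fun x y hx hy => ?_)
    (fun c x hx => ?_) (fun e he => ?_) f
  · rw [map_add, map_add, hx, hy, map_add, mul_add]
  · rw [D.map_smul, map_smul, hx, map_smul, smul_eq_mul, smul_eq_mul]
    ring
  · rw [derivation_mon h D q (fun p hp => by rw [hD, if_neg hp]) he, hD, if_pos rfl, mul_one, hL e he]
    by_cases h0 : e q = 0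
    · rw [h0, Int.cast_zero, zero_mul, map_zero]
      split_ifs with h1
      · rw [← h1, h0]; simp
      · simp
    · have hadm : Adm U (e - Pi.single q 1) := by
        intro p hp
        have := he p hp
        by_cases hpq : p = q
        · subst hpq
          rw [Pi.sub_apply, Pi.single_eq_same]
          omega
        · rwa [Pi.sub_apply, Pi.single_eq_of_ne hpq, sub_zero]
      have h2 : ((e q : ℤ) : A) * mon z (e - Pi.single q 1) =
          ((e q : ℤ) : K) • mon z (e - Pi.single q 1) := by
        rw [Algebra.smul_def]; simp
      rw [h2, map_smul, hL' _ hadm]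
      by_cases h1 : e = e₀
      · subst h1; simp
      · rw [if_neg h1, if_neg (fun h3 => h1 (sub_left_injective h3))]
        simp

/-- In characteristic zero, a function with vanishing derivatives is constant. -/
theorem eq_algebraMap_of_pd_eq_zero [DecidableEq ι] [CharZero K] (h : IsTorusCoord K U z)
    (pd : ι → Derivation K A A)
    (hpd : ∀ q p, pd q (z p) = if p = q then 1 else 0) {f : A} (hf : ∀ q, pd q f = 0) :
    ∃ c : K, f = algebraMap K A c := by
  choose L hL using fun e₀ => exists_coeff h e₀
  have h1 : ∀ e₀, e₀ ≠ 0 → L e₀ f = 0 := by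
    intro e₀ he₀
    obtain ⟨q, hq⟩ : ∃ q, e₀ q ≠ 0 := by
      by_contra! h
      exact he₀ (funext h)
    have h2 := coeff_pd h (pd q) q (hpd q) e₀ (L e₀) (L _) (hL _) (hL _) f
    rw [hf, map_zero] at h2
    exact (mul_eq_zero.mp h2.symm).resolve_left (Int.cast_ne_zero.mpr hq)
  refine ⟨L 0 f, ?_⟩
  obtain ⟨a, ha⟩ := (Finsupp.mem_span_range_iff_exists_finsupp).mp (span_mon h f)
  have h3 : ∀ e : {e : ι → ℤ // Adm U e}, L e.1 f = a e := by
    intro e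
    rw [← ha, Finsupp.sum, map_sum]
    simp only [map_smul, smul_eq_mul]
    rw [Finset.sum_congr rfl fun e' _ => by rw [hL _ _ e'.2]]
    simp only [mul_ite, mul_one, mul_zero, Subtype.coe_inj]
    rw [Finset.sum_ite_eq']
    split_ifs with h4
    · rfl
    · exact (Finsupp.notMem_support_iff.mp h4).symm
  have h5 : f = a ⟨0, adm_zero⟩ • mon z 0 := by
    conv_lhs => rw [← ha]
    rw [Finsupp.sum, Finset.sum_eq_single ⟨0, adm_zero⟩]
    · intro e _ he
      rw [← h3, h1 _ fun h4 => he (Subtype.ext h4), zero_smul]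
    · intro h4
      rw [Finsupp.notMem_support_iff.mp h4, zero_smul]
  rw [h3 ⟨0, adm_zero⟩, Algebra.algebraMap_eq_smul_one, ← mon_zero (z := z)]
  exact h5

end Mon

/-! ### Forms in normal form -/

/-- The four types of coordinates of a form in normal form
`∑ lam (dz/z - dz) + ∑ d(eps z²) + ∑ (lam dx/x + d((1 - x) y))`: the coordinates of the first sum
are of type `gm`, those of the second of type `sq`, and the third sum runs over pairs `(x, y)` with
`x` of type `fst` and `y` of type `snd`. -/
inductive Kind
  | gm
  | sq
  | fst
  | snd
  deriving DecidableEq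

/-- The combinatorial and numerical data of a form in normal form, on a space with coordinates
indexed by `ι` of which those in `U` are invertible. The involution `inv` interchanges the two
members of a pair. -/
structure NormalData (K : Type u) [Field K] {ι : Type} (U : Set ι) where
  kind : ι → Kind
  inv : ι → ι
  lam : ι → K
  eps : ι → K
  inv_inv : ∀ q, inv (inv q) = q
  inv_gm : ∀ q, kind q = .gm → inv q = q
  inv_sq : ∀ q, kind q = .sq → inv q = q
  kind_inv_fst : ∀ q, kind q = .fst → kind (inv q) = .snd
  kind_inv_snd : ∀ q, kind q = .snd → kind (inv q) = .fst
  gm_mem : ∀ q, kind q = .gm → q ∈ U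
  gm_ne : ∀ q, kind q = .gm → lam q ≠ 0
  sq_notMem : ∀ q, kind q = .sq → q ∉ U
  sq_ne : ∀ q, kind q = .sq → eps q ≠ 0
  fst_lam : ∀ q, kind q = .fst → q ∉ U → lam q = 0
  snd_notMem : ∀ q, kind q = .snd → q ∉ U

namespace NormalData

section Coeff
variable {K A : Type u} [Field K] [CommRing A] [Algebra K A] {ι : Type}
  {U : Set ι} {z : ι → A}

/-- The coefficient of `dz_q` in the form in normal form. -/
def coeff (N : NormalData K U) (z : ι → A) (q : ι) : A :=
  match N.kind q with
  | .gm => N.lam q • (Ring.inverse (z q) - 1)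
  | .sq => (2 * N.eps q) • z q
  | .fst => N.lam q • Ring.inverse (z q) - z (N.inv q)
  | .snd => 1 - z (N.inv q)

variable {N : NormalData K U}

theorem coeff_gm {q : ι} (hq : N.kind q = .gm) :
    N.coeff z q = N.lam q • (Ring.inverse (z q) - 1) := by rw [coeff, hq]

theorem coeff_sq {q : ι} (hq : N.kind q = .sq) : N.coeff z q = (2 * N.eps q) • z q := by
  rw [coeff, hq]

theorem coeff_fst {q : ι} (hq : N.kind q = .fst) :
    N.coeff z q = N.lam q • Ring.inverse (z q) - z (N.inv q) := by rw [coeff, hq]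

theorem coeff_snd {q : ι} (hq : N.kind q = .snd) : N.coeff z q = 1 - z (N.inv q) := by
  rw [coeff, hq]

theorem inv_ne {q : ι} (hq : N.kind q = .fst ∨ N.kind q = .snd) : N.inv q ≠ q := by
  intro h
  rcases hq with hq | hq
  · have := N.kind_inv_fst q hq
    rw [h, hq] at this
    cases this
  · have := N.kind_inv_snd q hq
    rw [h, hq] at this
    cases this

variable [Fintype ι] [DecidableEq ι] (h : IsTorusCoord K U z) (pd : ι → Derivation K A A)
  (hpd : ∀ q p, pd q (z p) = if p = q then 1 else 0)
include h hpd

theorem pd_mon (q : ι) {e : ι → ℤ} (he : Adm U e) :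
    pd q (mon z e) = (e q : K) • mon z (e - Pi.single q 1) := by
  rw [derivation_mon h (pd q) q (fun p hp => by rw [hpd, if_neg hp]) he, hpd, if_pos rfl, mul_one,
    Algebra.smul_def]
  simp

omit hpd in
theorem inverse_mul_mon {q : ι} (hq : q ∈ U) {e : ι → ℤ} (he : Adm U e) :
    Ring.inverse (z q) * mon z e = mon z (e - Pi.single q 1) := by
  rw [sub_eq_neg_add, mon_add h _ he, ← Pi.single_neg, mon_single, zpw_neg_one]
  rw [← Pi.single_neg]
  exact adm_single q (Or.inl hq)

omit pd hpd in
theorem mul_mon (q : ι) {e : ι → ℤ} (he : Adm U e) :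
    z q * mon z e = mon z (e + Pi.single q 1) := by
  rw [add_comm, mon_add h (adm_single q (Or.inr zero_le_one)) he, mon_single, zpw_one]

theorem rel_gm {q : ι} (hq : N.kind q = .gm) {e : ι → ℤ} (he : Adm U e) :
    pd q (mon z e) + N.coeff z q * mon z e =
      (e q + N.lam q) • mon z (e - Pi.single q 1) - N.lam q • mon z e := by
  rw [pd_mon h pd hpd q he, coeff_gm hq, smul_mul_assoc, sub_mul, one_mul,
    inverse_mul_mon h (N.gm_mem q hq) he, smul_sub, add_smul, add_sub_assoc]

theorem rel_sq {q : ι} (hq : N.kind q = .sq) {e : ι → ℤ} (he : Adm U e) :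
    pd q (mon z e) + N.coeff z q * mon z e =
      (e q : K) • mon z (e - Pi.single q 1) + (2 * N.eps q) • mon z (e + Pi.single q 1) := by
  rw [pd_mon h pd hpd q he, coeff_sq hq, smul_mul_assoc, mul_mon h q he]

theorem rel_fst {q : ι} (hq : N.kind q = .fst) {e : ι → ℤ} (he : Adm U e) :
    pd q (mon z e) + N.coeff z q * mon z e =
      (e q + N.lam q) • mon z (e - Pi.single q 1) - mon z (e + Pi.single (N.inv q) 1) := by
  rw [pd_mon h pd hpd q he, coeff_fst hq, sub_mul, smul_mul_assoc, mul_mon h _ he, add_smul,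
    add_sub_assoc]
  by_cases hU : q ∈ U
  · rw [inverse_mul_mon h hU he]
  · rw [N.fst_lam q hq hU, zero_smul, zero_smul]

theorem rel_snd {q : ι} (hq : N.kind q = .snd) {e : ι → ℤ} (he : Adm U e) :
    pd q (mon z e) + N.coeff z q * mon z e =
      (e q : K) • mon z (e - Pi.single q 1) + (mon z e - mon z (e + Pi.single (N.inv q) 1)) := by
  rw [pd_mon h pd hpd q he, coeff_snd hq, sub_mul, one_mul, mul_mon h _ he]

end Coeff

/-! ### The twisted top cohomology of a form in normal form -/

section Spanning
variable {K A : Type u} [Field K] [CommRing A] [Algebra K A] {ι : Type}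
  {U : Set ι} {z : ι → A} (N : NormalData K U)

open scoped Classical in
/-- The exponents of the monomial whose class generates the cohomology. On a punctured line with the
form `lam (dz/z - dz)`, the class of `z ^ n` is nonzero for all `n`, unless `lam` is an integer `l`;
then one needs `n < -l`. -/
def baseExp (q : ι) : ℤ :=
  if h : N.kind q = .gm ∧ ∃ l : ℤ, N.lam q = l then -h.2.choose - 1 else 0

theorem baseExp_of_ne {q : ι} (hq : N.kind q ≠ .gm) : N.baseExp q = 0 :=
  dif_neg fun h => hq h.1

theorem adm_baseExp : Adm U N.baseExp := by
  intro q hq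
  rw [baseExp_of_ne N fun h => hq (N.gm_mem q h)]

theorem baseExp_gm [CharZero K] {q : ι} (hq : N.kind q = .gm) {n : ℤ} (hn : n < N.baseExp q) :
    (n + 1 : K) + N.lam q ≠ 0 := by
  intro h
  have hl : N.lam q = ((-n - 1 : ℤ) : K) := by
    push_cast
    linear_combination h
  have hex : N.kind q = .gm ∧ ∃ l : ℤ, N.lam q = l := ⟨hq, _, hl⟩
  have h1 : hex.2.choose = -n - 1 := by
    have := hex.2.choose_spec.symm.trans hl
    exact_mod_cast this
  rw [baseExp, dif_pos hex, h1] at hn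
  omega

variable [Fintype ι] [DecidableEq ι] (h : IsTorusCoord K U z) (pd : ι → Derivation K A A)
  (hpd : ∀ q p, pd q (z p) = if p = q then 1 else 0)

/-- The submodule of the functions whose associated top degree form is exact. -/
abbrev exact (pd : ι → Derivation K A A) : Submodule K A :=
  LinearMap.range (twistedDiv pd (N.coeff z))

omit h hpd in
theorem mem_exact (q : ι) (f : A) : pd q f + N.coeff z q * f ∈ N.exact (z := z) pd := by
  refine ⟨Pi.single q f, ?_⟩
  rw [twistedDiv_apply, Finset.sum_eq_single q]
  · rw [Pi.single_eq_same]
  · intro p _ hp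
    rw [Pi.single_eq_of_ne hp, map_zero, mul_zero, add_zero]
  · simp

/-- The weighted distance of `e` from `baseExp`. The weight two makes it decrease when a coordinate of
type `snd` is eliminated at the cost of its partner. -/
def dist (e : ι → ℤ) : ℕ :=
  ∑ q, (if N.kind q = .snd then 2 else 1) * (e q - N.baseExp q).natAbs

omit h hpd in
theorem dist_add_single (e : ι → ℤ) (q : ι) (n : ℤ) :
    N.dist (e + Pi.single q n) +
        (if N.kind q = .snd then 2 else 1) * (e q - N.baseExp q).natAbs =
      N.dist e + (if N.kind q = .snd then 2 else 1) * (e q + n - N.baseExp q).natAbs := by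
  rw [dist, dist, ← Finset.add_sum_erase _ _ (Finset.mem_univ q),
    ← Finset.add_sum_erase _ (fun q => _ * (e q - N.baseExp q).natAbs) (Finset.mem_univ q)]
  have : ∀ p ∈ Finset.univ.erase q, (if N.kind p = .snd then 2 else 1) *
      ((e + Pi.single q n : ι → ℤ) p - N.baseExp p).natAbs =
      (if N.kind p = .snd then 2 else 1) * (e p - N.baseExp p).natAbs := by
    intro p hp
    rw [Pi.add_apply, Pi.single_eq_of_ne (Finset.ne_of_mem_erase hp), add_zero]
  rw [Finset.sum_congr rfl this, Pi.add_apply, Pi.single_eq_same]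
  ring

omit [Fintype ι] in
theorem adm_add_single {e : ι → ℤ} (he : Adm U e) {q : ι} {n : ℤ} (hn : q ∈ U ∨ 0 ≤ e q + n) :
    Adm U (e + Pi.single q n) := by
  intro p hp
  by_cases hpq : p = q
  · subst hpq
    rw [Pi.add_apply, Pi.single_eq_same]
    exact hn.resolve_left hp
  · rw [Pi.add_apply, Pi.single_eq_of_ne hpq, add_zero]
    exact he p hp

include h hpd in
/-- Every monomial is cohomologous to a multiple of the monomial with exponents `baseExp`. -/
theorem exists_smul_mon_sub_mem [CharZero K] (e : ι → ℤ) (he : Adm U e) :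
    ∃ c : K, mon z e - c • mon z N.baseExp ∈ N.exact (z := z) pd := by
  induction hd : N.dist e using Nat.strong_induction_on generalizing e with
  | _ d ih =>
    subst hd
    -- a relation between `mon e` and a monomial closer to `baseExp`
    have key : ∀ (c : K) (e' : ι → ℤ), c = 0 ∨ (Adm U e' ∧ N.dist e' < N.dist e) →
        mon z e - c • mon z e' ∈ N.exact (z := z) pd →
        ∃ c : K, mon z e - c • mon z N.baseExp ∈ N.exact (z := z) pd := by
      intro c e' hc hm
      rcases hc with rfl | ⟨hA, hlt⟩
      · exact ⟨0, by simpa using hm⟩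
      · obtain ⟨c', hc'⟩ := ih _ hlt e' hA rfl
        refine ⟨c * c', ?_⟩
        have := add_mem hm (Submodule.smul_mem _ c hc')
        rwa [smul_sub, smul_smul, sub_add_sub_cancel] at this
    by_cases hy : ∃ q, N.kind q = .snd ∧ e q ≠ 0
    · obtain ⟨q, hq, hne⟩ := hy
      have hx := N.kind_inv_snd q hq
      have hpos : 0 < e q := lt_of_le_of_ne (he q (N.snd_notMem q hq)) (Ne.symm hne)
      have hxq : N.inv q ≠ q := inv_ne (Or.inr hq)
      have hA : Adm U (e + Pi.single q (-1)) := adm_add_single he (Or.inr (by omega))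
      have hr := rel_fst h pd hpd hx hA
      rw [N.inv_inv, add_assoc e, ← Pi.single_add, neg_add_cancel, Pi.single_zero, add_zero] at hr
      have hv : (e + Pi.single q (-1) : ι → ℤ) (N.inv q) = e (N.inv q) := by
        rw [Pi.add_apply, Pi.single_eq_of_ne hxq, add_zero]
      rw [hv] at hr
      refine key ((e (N.inv q) : K) + N.lam (N.inv q)) (e + Pi.single q (-1) - Pi.single (N.inv q) 1)
        ?_ ?_
      · by_cases h0 : (e (N.inv q) : K) + N.lam (N.inv q) = 0
        · exact Or.inl h0
        · refine Or.inr ⟨?_, ?_⟩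
          · rw [sub_eq_add_neg, ← Pi.single_neg]
            refine adm_add_single hA ?_
            by_cases hU : N.inv q ∈ U
            · exact Or.inl hU
            · refine Or.inr ?_
              rw [N.fst_lam _ hx hU, add_zero] at h0
              have h1 : e (N.inv q) ≠ 0 := fun h1 => h0 (by rw [h1, Int.cast_zero])
              have := he _ hU
              rw [hv]
              omega
          · have h1 := N.dist_add_single e q (-1)
            have h2 := N.dist_add_single (e + Pi.single q (-1)) (N.inv q) (-1)
            rw [hv, if_neg (by rw [hx]; decide)] at h2
            rw [if_pos hq, baseExp_of_ne N (by rw [hq]; decide)] at h1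
            rw [baseExp_of_ne N (by rw [hx]; decide)] at h2
            rw [sub_eq_add_neg, ← Pi.single_neg]
            omega
      · have := neg_mem (N.mem_exact (z := z) pd (N.inv q) (mon z (e + Pi.single q (-1))))
        rwa [hr, neg_sub] at this
    by_cases hxx : ∃ q, N.kind q = .fst ∧ e q ≠ 0
    · obtain ⟨q, hq, hne⟩ := hxx
      have hk := N.kind_inv_fst q hq
      have hqq : N.inv q ≠ q := inv_ne (Or.inl hq)
      have hy0 : e (N.inv q) = 0 := by
        by_contra h0
        exact hy ⟨_, hk, h0⟩
      have hb : N.baseExp q = 0 := baseExp_of_ne N (by rw [hq]; decide)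
      rcases lt_or_gt_of_ne hne with hneg | hpos
      · have hr := rel_snd h pd hpd hk he
        rw [hy0, Int.cast_zero, zero_smul, zero_add, N.inv_inv] at hr
        refine key 1 (e + Pi.single q 1) (Or.inr ⟨adm_add_single he ?_, ?_⟩) ?_
        · by_contra! h0
          have := he q h0.1
          omega
        · have h1 := N.dist_add_single e q 1
          rw [if_neg (by rw [hq]; decide), hb] at h1
          omega
        · rw [one_smul, ← hr]
          exact N.mem_exact pd _ _
      · have hA : Adm U (e + Pi.single q (-1)) := adm_add_single he (Or.inr (by omega))
        have hr := rel_snd h pd hpd hk hA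
        rw [Pi.add_apply, Pi.single_eq_of_ne hqq, add_zero, hy0, Int.cast_zero, zero_smul, zero_add,
          N.inv_inv, add_assoc e, ← Pi.single_add, neg_add_cancel, Pi.single_zero, add_zero] at hr
        refine key 1 (e + Pi.single q (-1)) (Or.inr ⟨hA, ?_⟩) ?_
        · have h1 := N.dist_add_single e q (-1)
          rw [if_neg (by rw [hq]; decide), hb] at h1
          omega
        · rw [one_smul, ← neg_sub, ← hr]
          exact neg_mem (N.mem_exact pd _ _)
    by_cases hs : ∃ q, N.kind q = .sq ∧ e q ≠ 0
    · obtain ⟨q, hq, hne⟩ := hs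
      have hpos : 0 < e q := lt_of_le_of_ne (he q (N.sq_notMem q hq)) (Ne.symm hne)
      have hb : N.baseExp q = 0 := baseExp_of_ne N (by rw [hq]; decide)
      have hA : Adm U (e + Pi.single q (-1)) := adm_add_single he (Or.inr (by omega))
      have hr := rel_sq h pd hpd hq hA
      rw [add_assoc e _ (Pi.single q 1), ← Pi.single_add, neg_add_cancel, Pi.single_zero, add_zero,
        Pi.add_apply, Pi.single_eq_same] at hr
      have h2 : 2 * N.eps q ≠ 0 := mul_ne_zero two_ne_zero (N.sq_ne q hq)
      refine key (-((2 * N.eps q)⁻¹ * ((e q + -1 : ℤ) : K)))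
        (e + Pi.single q (-1) - Pi.single q 1) ?_ ?_
      · by_cases h1 : e q = 1
        · left
          rw [h1]
          simp
        · right
          rw [sub_eq_add_neg, ← Pi.single_neg, add_assoc, ← Pi.single_add]
          refine ⟨adm_add_single he (Or.inr (by omega)), ?_⟩
          have h3 := N.dist_add_single e q (-1 + -1)
          rw [if_neg (by rw [hq]; decide), hb] at h3
          omega
      · have := Submodule.smul_mem _ (2 * N.eps q)⁻¹
          (N.mem_exact (z := z) pd q (mon z (e + Pi.single q (-1))))
        rw [hr, smul_add, smul_smul, smul_smul, inv_mul_cancel₀ h2, one_smul] at this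
        rwa [neg_smul, sub_neg_eq_add, add_comm]
    by_cases hg : ∃ q, N.kind q = .gm ∧ e q ≠ N.baseExp q
    · obtain ⟨q, hq, hne⟩ := hg
      have hl := N.gm_ne q hq
      rcases lt_or_gt_of_ne hne with hlt | hgt
      · have hA : Adm U (e + Pi.single q 1) := adm_add_single he (Or.inl (N.gm_mem q hq))
        have hr := rel_gm h pd hpd hq hA
        rw [add_sub_cancel_right, Pi.add_apply, Pi.single_eq_same] at hr
        have h0 := N.baseExp_gm hq hlt
        push_cast at hr
        refine key ((e q + 1 + N.lam q)⁻¹ * N.lam q) (e + Pi.single q 1) (Or.inr ⟨hA, ?_⟩) ?_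
        · have h3 := N.dist_add_single e q 1
          rw [if_neg (by rw [hq]; decide)] at h3
          omega
        · have := Submodule.smul_mem _ (e q + 1 + N.lam q)⁻¹
            (N.mem_exact (z := z) pd q (mon z (e + Pi.single q 1)))
          rwa [hr, smul_sub, smul_smul, smul_smul, inv_mul_cancel₀ h0, one_smul] at this
      · have hr := rel_gm h pd hpd hq he
        refine key ((N.lam q)⁻¹ * (e q + N.lam q)) (e - Pi.single q 1) (Or.inr ⟨?_, ?_⟩) ?_
        · rw [sub_eq_add_neg, ← Pi.single_neg]
          exact adm_add_single he (Or.inl (N.gm_mem q hq))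
        · rw [sub_eq_add_neg, ← Pi.single_neg]
          have h3 := N.dist_add_single e q (-1)
          rw [if_neg (by rw [hq]; decide)] at h3
          omega
        · have := neg_mem (Submodule.smul_mem _ (N.lam q)⁻¹ (N.mem_exact (z := z) pd q (mon z e)))
          rwa [hr, smul_sub, smul_smul, smul_smul, inv_mul_cancel₀ hl, one_smul, neg_sub] at this
    · have heq : e = N.baseExp := by
        funext q
        push Not at hy hxx hs hg
        rcases hk : N.kind q with _ | _ | _ | _
        · exact hg q hk
        · rw [hs q hk, baseExp_of_ne N (by rw [hk]; decide)]
        · rw [hxx q hk, baseExp_of_ne N (by rw [hk]; decide)]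
        · rw [hy q hk, baseExp_of_ne N (by rw [hk]; decide)]
      exact ⟨1, by rw [heq, one_smul, sub_self]; exact zero_mem _⟩

include h hpd in
theorem exists_smul_sub_mem [CharZero K] (f : A) :
    ∃ c : K, f - c • mon z N.baseExp ∈ N.exact (z := z) pd := by
  refine mon_induction h (P := fun f => ∃ c : K, f - c • mon z N.baseExp ∈ N.exact (z := z) pd)
    ⟨0, by simp⟩ ?_ ?_ (fun e he => N.exists_smul_mon_sub_mem h pd hpd e he) f
  · rintro x y ⟨c, hc⟩ ⟨d, hd⟩
    refine ⟨c + d, ?_⟩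
    rw [add_smul, add_sub_add_comm]
    exact add_mem hc hd
  · rintro a x ⟨c, hc⟩
    refine ⟨a * c, ?_⟩
    rw [mul_smul, ← smul_sub]
    exact Submodule.smul_mem _ _ hc

end Spanning
end NormalData

/-! ### A functional on the top cohomology -/

namespace NormalData

section Sequences
variable {K : Type u} [Field K]

/-- The sequence of the periods of `z ^ n` along a punctured line with the form `lam (dz/z - dz)`. -/
theorem exists_seq_gm (α : ℤ → K) {l : K} (hl : l ≠ 0) (n₀ : ℤ) (hα : ∀ n < n₀, α (n + 1) ≠ 0) :
    ∃ c : ℤ → K, c n₀ = 1 ∧ ∀ n, α n * c (n - 1) = l * c n := by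
  refine ⟨fun n => if n₀ ≤ n then ∏ i ∈ Finset.range (n - n₀).toNat, α (n₀ + 1 + i) / l
    else ∏ i ∈ Finset.range (n₀ - n).toNat, l / α (n₀ - i), by simp, fun n => ?_⟩
  rcases le_or_gt (n₀ + 1) n with h | h
  · obtain ⟨j, rfl⟩ : ∃ j : ℕ, n = n₀ + 1 + j := ⟨(n - n₀ - 1).toNat, by omega⟩
    have h1 : (n₀ + 1 + (j : ℤ) - 1 - n₀).toNat = j := by omega
    have h2 : (n₀ + 1 + (j : ℤ) - n₀).toNat = j + 1 := by omega
    simp only [show n₀ ≤ n₀ + 1 + (j : ℤ) - 1 by omega, show n₀ ≤ n₀ + 1 + (j : ℤ) by omega,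
      if_true, h1, h2]
    rw [Finset.prod_range_succ]
    field_simp
  · obtain ⟨j, rfl⟩ : ∃ j : ℕ, n = n₀ - j := ⟨(n₀ - n).toNat, by omega⟩
    have h1 : (n₀ - (n₀ - (j : ℤ) - 1)).toNat = j + 1 := by omega
    have h2 : (n₀ - (n₀ - (j : ℤ))).toNat = j := by omega
    have h3 : α (n₀ - j) ≠ 0 := by
      have := hα (n₀ - j - 1) (by omega)
      rwa [sub_add_cancel] at this
    have h4 : (if n₀ ≤ n₀ - (j : ℤ) then ∏ i ∈ Finset.range (n₀ - (j : ℤ) - n₀).toNat,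
        α (n₀ + 1 + i) / l else ∏ i ∈ Finset.range (n₀ - (n₀ - (j : ℤ))).toNat, l / α (n₀ - i)) =
        ∏ i ∈ Finset.range j, l / α (n₀ - i) := by
      by_cases hj : j = 0
      · subst hj; simp
      · rw [if_neg (by omega), h2]
    simp only [h4]
    rw [if_neg (by omega), h1, Finset.prod_range_succ]
    field_simp

/-- The sequence of the moments of the form `d(eps z²)`. -/
theorem exists_seq_sq {a : K} (ha : a ≠ 0) : ∃ c : ℕ → K, c 0 = 1 ∧ c 1 = 0 ∧
    ∀ n : ℕ, ((n + 1 : ℕ) : K) * c n + a * c (n + 2) = 0 := by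
  refine ⟨fun n => if Even n then ∏ i ∈ Finset.range (n / 2), (-((2 * i + 1 : ℕ) : K) / a) else 0,
    by simp, by simp, fun n => ?_⟩
  rcases Nat.even_or_odd n with h | h
  · obtain ⟨j, rfl⟩ := even_iff_two_dvd.mp h
    have h1 : (2 * j + 2) / 2 = j + 1 := by omega
    have h2 : Even (2 * j + 2) := by simp [Nat.even_add]
    simp only [h, h2, if_true, h1, Nat.mul_div_cancel_left j two_pos]
    rw [Finset.prod_range_succ]
    field_simp
    ring
  · have h2 : ¬ Even (n + 2) := by simpa [Nat.even_add] using h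
    simp [Nat.not_even_iff_odd.mpr h, h2]

/-- The falling factorial `s (s - 1) ⋯ (s - n + 1)`. -/
def falling (s : K) (n : ℕ) : K := ∏ i ∈ Finset.range n, (s - i)

theorem falling_zero (s : K) : falling s 0 = 1 := rfl

theorem falling_succ (s : K) (n : ℕ) : falling s (n + 1) = falling s n * (s - n) :=
  Finset.prod_range_succ _ _

theorem falling_succ' (s : K) (n : ℕ) : falling s (n + 1) = s * falling (s - 1) n := by
  rw [falling, Finset.prod_range_succ', mul_comm, falling]
  congr 1
  · simp
  · exact Finset.prod_congr rfl fun i _ => by push_cast; ring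

theorem falling_add_one (s : K) (n : ℕ) :
    ((n + 1 : ℕ) : K) * falling s n + falling s (n + 1) = falling (s + 1) (n + 1) := by
  rw [falling_succ s, falling_succ' (s + 1), add_sub_cancel_right]
  push_cast
  ring

end Sequences

variable {K A : Type u} [Field K] [CommRing A] [Algebra K A] {ι : Type}
  {U : Set ι} {z : ι → A} (N : NormalData K U)

/-- The coordinate carrying the factor of the functional that depends on the exponent of `q`: the
first member of the pair of `q`, if `q` belongs to a pair. -/
def head (q : ι) : ι := if N.kind q = .snd then N.inv q else q

variable [Fintype ι] [DecidableEq ι] (h : IsTorusCoord K U z) (pd : ι → Derivation K A A)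
  (hpd : ∀ q p, pd q (z p) = if p = q then 1 else 0)
include h hpd

/-- There is a functional that vanishes on the exact forms, but not on the class of the monomial with
exponents `baseExp`. -/
theorem exists_exact_functional [CharZero K] : ∃ L : A →ₗ[K] K,
    (∀ f ∈ N.exact (z := z) pd, L f = 0) ∧ L (mon z N.baseExp) = 1 := by
  choose cg hcg0 hcg using fun q : {q // N.kind q = .gm} =>
    exists_seq_gm (fun n : ℤ => (n : K) + N.lam q) (N.gm_ne q q.2) (N.baseExp q)
      (fun n hn => by push_cast; exact N.baseExp_gm q.2 hn)
  choose cs hcs0 hcs1 hcs using fun q : {q // N.kind q = .sq} =>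
    exists_seq_sq (mul_ne_zero (two_ne_zero (α := K)) (N.sq_ne q q.2))
  -- the factor of the functional at `q`
  let c : ι → (ι → ℤ) → K := fun q e =>
    if hg : N.kind q = .gm then cg ⟨q, hg⟩ (e q)
    else if hs : N.kind q = .sq then cs ⟨q, hs⟩ (e q).toNat
    else if N.kind q = .fst then falling (e q + N.lam q) (e (N.inv q)).toNat
    else 1
  have c_gm : ∀ q (hq : N.kind q = .gm) e, c q e = cg ⟨q, hq⟩ (e q) := fun q hq e => dif_pos hq
  have c_sq : ∀ q (hq : N.kind q = .sq) e, c q e = cs ⟨q, hq⟩ (e q).toNat := fun q hq e => by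
    simp only [c]
    rw [dif_neg (by rw [hq]; decide), dif_pos hq]
  have c_fst : ∀ q (hq : N.kind q = .fst) e,
      c q e = falling (e q + N.lam q) (e (N.inv q)).toNat := fun q hq e => by
    simp only [c]
    rw [dif_neg (by rw [hq]; decide), dif_neg (by rw [hq]; decide), if_pos hq]
  have c_snd : ∀ q (hq : N.kind q = .snd) e, c q e = 1 := fun q hq e => by
    simp only [c]
    rw [dif_neg (by rw [hq]; decide), dif_neg (by rw [hq]; decide), if_neg (by rw [hq]; decide)]
  obtain ⟨L, hL⟩ := exists_functional h fun e => ∏ q, c q e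
  have hsplit : ∀ (x : ι) (e e' : ι → ℤ), (∀ p, N.head p ≠ x → e' p = e p) →
      (∏ q, c q e') = c x e' * ∏ q ∈ Finset.univ.erase x, c q e := by
    intro x e e' hee
    rw [← Finset.mul_prod_erase _ _ (Finset.mem_univ x)]
    congr 1
    refine Finset.prod_congr rfl fun q hq => ?_
    have hqx := Finset.ne_of_mem_erase hq
    rcases hk : N.kind q with _ | _ | _ | _
    · rw [c_gm q hk, c_gm q hk, hee]
      rwa [head, if_neg (by rw [hk]; decide)]
    · rw [c_sq q hk, c_sq q hk, hee]
      rwa [head, if_neg (by rw [hk]; decide)]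
    · rw [c_fst q hk, c_fst q hk, hee, hee]
      · rwa [head, if_pos (N.kind_inv_fst q hk), N.inv_inv]
      · rwa [head, if_neg (by rw [hk]; decide)]
    · rw [c_snd q hk, c_snd q hk]
  have hLs : ∀ (a : K) (e : ι → ℤ), a = 0 ∨ Adm U e → L (a • mon z e) = a * ∏ q, c q e := by
    intro a e hae
    rw [map_smul, smul_eq_mul]
    rcases hae with rfl | he
    · rw [zero_mul, zero_mul]
    · rw [hL e he]
  have hup : ∀ (e : ι → ℤ), Adm U e → ∀ q, Adm U (e + Pi.single q 1) := fun e he q =>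
    he.add (adm_single q (Or.inr zero_le_one))
  have hdown : ∀ (e : ι → ℤ), Adm U e → ∀ q, (e q : K) = 0 ∨ Adm U (e - Pi.single q 1) := by
    intro e he q
    by_cases h0 : e q = 0
    · left
      rw [h0, Int.cast_zero]
    · right
      rw [sub_eq_add_neg, ← Pi.single_neg]
      refine adm_add_single he ?_
      by_cases hU : q ∈ U
      · exact Or.inl hU
      · have := he q hU
        exact Or.inr (by omega)
  have hmem : ∀ q e, Adm U e → L (pd q (mon z e) + N.coeff z q * mon z e) = 0 := by
    intro q e he
    rcases hk : N.kind q with _ | _ | _ | _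
    · have hhead : ∀ (n : ℤ) p, N.head p ≠ q → (e + Pi.single q n : ι → ℤ) p = e p := by
        intro n p hp
        rw [Pi.add_apply, Pi.single_eq_of_ne, add_zero]
        rintro rfl
        exact hp (if_neg (by rw [hk]; decide))
      have hA : Adm U (e - Pi.single q 1) := by
        rw [sub_eq_add_neg, ← Pi.single_neg]
        exact adm_add_single he (Or.inl (N.gm_mem q hk))
      rw [rel_gm h pd hpd hk he, map_sub, hLs _ _ (Or.inr hA), hLs _ _ (Or.inr he),
        hsplit q e (e - Pi.single q 1) (by rw [sub_eq_add_neg, ← Pi.single_neg]; exact hhead _),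
        hsplit q e e fun _ _ => rfl, c_gm q hk, c_gm q hk, ← mul_assoc, ← mul_assoc,
        Pi.sub_apply, Pi.single_eq_same, ← sub_mul, hcg ⟨q, hk⟩, sub_self, zero_mul]
    · have hhead : ∀ (n : ℤ) p, N.head p ≠ q → (e + Pi.single q n : ι → ℤ) p = e p := by
        intro n p hp
        rw [Pi.add_apply, Pi.single_eq_of_ne, add_zero]
        rintro rfl
        exact hp (if_neg (by rw [hk]; decide))
      rw [rel_sq h pd hpd hk he, map_add, hLs _ _ (hdown e he q), hLs _ _ (Or.inr (hup e he q)),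
        hsplit q e (e - Pi.single q 1) (by rw [sub_eq_add_neg, ← Pi.single_neg]; exact hhead _),
        hsplit q e (e + Pi.single q 1) (hhead 1), c_sq q hk, c_sq q hk, ← mul_assoc, ← mul_assoc,
        ← add_mul, Pi.sub_apply, Pi.add_apply, Pi.single_eq_same]
      convert zero_mul _
      obtain ⟨n, hn⟩ : ∃ n : ℕ, e q = n := Int.eq_ofNat_of_zero_le (he q (N.sq_notMem q hk))
      rw [hn]
      cases n with
      | zero => simp [hcs1]
      | succ n =>
        have := hcs ⟨q, hk⟩ n
        rw [show (((n + 1 : ℕ) : ℤ) - 1).toNat = n by omega,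
          show (((n + 1 : ℕ) : ℤ) + 1).toNat = n + 2 by omega]
        exact_mod_cast this
    · have hk' := N.kind_inv_fst q hk
      have hne : N.inv q ≠ q := inv_ne (Or.inl hk)
      have h1 : ∀ p, N.head p ≠ q → (e - Pi.single q 1 : ι → ℤ) p = e p := by
        intro p hp
        rw [Pi.sub_apply, Pi.single_eq_of_ne, sub_zero]
        rintro rfl
        exact hp (if_neg (by rw [hk]; decide))
      have h2 : ∀ p, N.head p ≠ q → (e + Pi.single (N.inv q) 1 : ι → ℤ) p = e p := by
        intro p hp
        rw [Pi.add_apply, Pi.single_eq_of_ne, add_zero]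
        rintro rfl
        exact hp (by rw [head, if_pos hk', N.inv_inv])
      have hey : 0 ≤ e (N.inv q) := he _ (N.snd_notMem _ hk')
      have h3 : (e q : K) + N.lam q = 0 ∨ Adm U (e - Pi.single q 1) := by
        by_cases hU : q ∈ U
        · right
          rw [sub_eq_add_neg, ← Pi.single_neg]
          exact adm_add_single he (Or.inl hU)
        · rw [N.fst_lam q hk hU, add_zero]
          exact hdown e he q
      have h4 := hLs 1 (e + Pi.single (N.inv q) 1) (Or.inr (hup e he _))
      rw [one_smul, one_mul] at h4
      rw [rel_fst h pd hpd hk he, map_sub, hLs _ _ h3, h4, hsplit q e _ h1, hsplit q e _ h2,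
        c_fst q hk, c_fst q hk, ← mul_assoc, ← sub_mul]
      simp only [Pi.sub_apply, Pi.add_apply, Pi.single_eq_same, Pi.single_eq_of_ne hne,
        Pi.single_eq_of_ne hne.symm]
      convert zero_mul _
      rw [show (e (N.inv q) + 1).toNat = (e (N.inv q)).toNat + 1 by omega, falling_succ',
        sub_zero, add_zero]
      push_cast
      rw [sub_add_eq_add_sub, sub_self]
    · have hk' := N.kind_inv_snd q hk
      have hne : N.inv q ≠ q := inv_ne (Or.inr hk)
      have h1 : ∀ p, N.head p ≠ N.inv q → (e - Pi.single q 1 : ι → ℤ) p = e p := by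
        intro p hp
        rw [Pi.sub_apply, Pi.single_eq_of_ne, sub_zero]
        rintro rfl
        exact hp (if_pos hk)
      have h2 : ∀ p, N.head p ≠ N.inv q → (e + Pi.single (N.inv q) 1 : ι → ℤ) p = e p := by
        intro p hp
        rw [Pi.add_apply, Pi.single_eq_of_ne, add_zero]
        rintro rfl
        exact hp (if_neg (by rw [hk']; decide))
      obtain ⟨n, hn⟩ : ∃ n : ℕ, e q = n := Int.eq_ofNat_of_zero_le (he q (N.snd_notMem q hk))
      have h4 := hLs 1 (e + Pi.single (N.inv q) 1) (Or.inr (hup e he _))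
      have h5 := hLs 1 e (Or.inr he)
      rw [one_smul, one_mul] at h4 h5
      rw [rel_snd h pd hpd hk he, map_add, map_sub, hLs _ _ (hdown e he q), h4, h5,
        hsplit _ e _ h1, hsplit _ e _ h2, hsplit _ e e fun _ _ => rfl,
        c_fst _ hk', c_fst _ hk', c_fst _ hk', ← mul_assoc, ← sub_mul, ← add_mul, N.inv_inv]
      simp only [Pi.sub_apply, Pi.add_apply, Pi.single_eq_same, Pi.single_eq_of_ne hne,
        Pi.single_eq_of_ne hne.symm, sub_zero, add_zero, hn]
      convert zero_mul _
      cases n with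
      | zero => simp [falling_zero]
      | succ n =>
        have := falling_add_one ((e (N.inv q) : K) + N.lam (N.inv q)) n
        rw [show (((n + 1 : ℕ) : ℤ) - 1).toNat = n by omega,
          show (((n + 1 : ℕ) : ℤ)).toNat = n + 1 by omega]
        push_cast at this ⊢
        rw [add_right_comm (e (N.inv q) : K) 1]
        linear_combination this
  refine ⟨L, ?_, ?_⟩
  · rintro _ ⟨g, rfl⟩
    rw [twistedDiv_apply, map_sum]
    refine Finset.sum_eq_zero fun q _ => ?_
    refine mon_induction h (P := fun f => L (pd q f + N.coeff z q * f) = 0) (by simp) ?_ ?_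
      (hmem q) (g q)
    · intro x y hx hy
      rw [map_add (pd q), mul_add, add_add_add_comm, map_add, hx, hy, add_zero]
    · intro a x hx
      rw [(pd q).map_smul, mul_smul_comm, ← smul_add, map_smul, hx, smul_zero]
  · rw [hL _ N.adm_baseExp]
    refine Finset.prod_eq_one fun q _ => ?_
    rcases hk : N.kind q with _ | _ | _ | _
    · rw [c_gm q hk, hcg0]
    · rw [c_sq q hk, baseExp_of_ne N (by rw [hk]; decide)]
      exact hcs0 _
    · rw [c_fst q hk, baseExp_of_ne N (q := N.inv q) (by rw [N.kind_inv_fst q hk]; decide)]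
      exact falling_zero _
    · rw [c_snd q hk]

end NormalData

/-! ### The Gauß–Manin connection of a form in normal form -/

namespace NormalData

section Theta
variable {k : Type v} {K A : Type u} [Field k] [Field K] [CommRing A] [Algebra K A]
  [Algebra k A] {ι : Type} {U : Set ι} {z : ι → A} (N : NormalData K U)

theorem derivation_smul_of (θ : Derivation k A A) (δ : K → K)
    (hc : ∀ c, θ (algebraMap K A c) = algebraMap K A (δ c)) (c : K) (x : A) :
    θ (c • x) = δ c • x + c • θ x := by
  rw [Algebra.smul_def, Derivation.leibniz, hc, smul_eq_mul, smul_eq_mul, mul_comm x,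
    ← Algebra.smul_def, ← Algebra.smul_def, add_comm]

variable (h : IsTorusCoord K U z) (θ : Derivation k A A) (δ : K → K)
  (hc : ∀ c, θ (algebraMap K A c) = algebraMap K A (δ c)) (hz : ∀ q, θ (z q) = 0)
include h hc hz

omit [Field K] [Algebra K A] h hc in
theorem derivation_inverse_eq_zero {q : ι} (hq : IsUnit (z q)) : θ (Ring.inverse (z q)) = 0 := by
  rw [← zpw_neg_one, derivation_zpw θ (Or.inl hq), hz, mul_zero]

theorem derivation_coeff_gm {q : ι} (hq : N.kind q = .gm) :
    θ (N.coeff z q) = δ (N.lam q) • (Ring.inverse (z q) - 1) := by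
  rw [coeff_gm hq, derivation_smul_of θ δ hc, map_sub,
    derivation_inverse_eq_zero θ hz (h.isUnit q (N.gm_mem q hq)), Derivation.map_one_eq_zero,
    sub_self, smul_zero, add_zero]

omit h in
theorem derivation_coeff_sq {q : ι} (hq : N.kind q = .sq)
    (h2 : δ (2 * N.eps q) = 2 * δ (N.eps q)) :
    θ (N.coeff z q) = (2 * δ (N.eps q)) • z q := by
  rw [coeff_sq hq, derivation_smul_of θ δ hc, hz, smul_zero, add_zero, h2]

theorem derivation_coeff_fst {q : ι} (hq : N.kind q = .fst) :
    θ (N.coeff z q) = δ (N.lam q) • Ring.inverse (z q) := by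
  rw [coeff_fst hq, map_sub, hz, sub_zero, derivation_smul_of θ δ hc]
  by_cases hU : q ∈ U
  · rw [derivation_inverse_eq_zero θ hz (h.isUnit q hU), smul_zero, add_zero]
  · rw [N.fst_lam q hq hU, zero_smul, add_zero]

end Theta

section Curvature
variable {k : Type v} {K A : Type u} [Field k] [Field K] [CommRing A] [Algebra K A]
  [Algebra k A] {ι : Type} [Fintype ι] [DecidableEq ι] {U : Set ι} {z : ι → A} (N : NormalData K U)
  (h : IsTorusCoord K U z) (θ : Derivation k A A) (δ : K → K)
  (hc : ∀ c, θ (algebraMap K A c) = algebraMap K A (δ c)) (hz : ∀ q, θ (z q) = 0)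
  (pd : ι → Derivation K A A) (hpd : ∀ q p, pd q (z p) = if p = q then 1 else 0)
  {f : A} (hf : ∀ q, pd q f = θ (N.coeff z q))
include h hc hz hpd hf

/-- A derivative has no residue, so that the residues of the form are horizontal. -/
theorem residue_horizontal {q : ι} (hq : N.kind q = .gm ∨ N.kind q = .fst ∧ q ∈ U) :
    δ (N.lam q) = 0 := by
  classical
  obtain ⟨L, hL⟩ := exists_coeff h (0 : ι → ℤ)
  obtain ⟨L', hL'⟩ := exists_coeff h (0 - Pi.single q 1 : ι → ℤ)
  have h1 := coeff_pd h (pd q) q (hpd q) 0 L L' hL hL' f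
  rw [hf, Pi.zero_apply, Int.cast_zero, zero_mul] at h1
  have hU : q ∈ U := hq.elim (N.gm_mem q) And.right
  have hne : (0 : ι → ℤ) ≠ 0 - Pi.single q 1 := by
    intro h2
    have := congrFun h2 q
    rw [Pi.sub_apply, Pi.single_eq_same] at this
    simp at this
  have hinv : L' (Ring.inverse (z q)) = 1 := by
    rw [← zpw_neg_one, ← mon_single, hL' _ (adm_single q (Or.inl hU)), if_pos]
    rw [Pi.single_neg, zero_sub]
  have hone : L' 1 = 0 := by
    rw [← mon_zero (z := z), hL' _ adm_zero, if_neg hne]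
  rcases hq with hq | ⟨hq, -⟩
  · rw [N.derivation_coeff_gm h θ δ hc hz hq, map_smul, map_sub, hinv, hone, sub_zero, smul_eq_mul,
      mul_one] at h1
    exact h1
  · rw [N.derivation_coeff_fst h θ δ hc hz hq, map_smul, hinv, smul_eq_mul, mul_one] at h1
    exact h1

/-- A function `f` whose partial derivatives are the derivatives along `θ` of the coefficients of the form
(such as `f = Ψ(θ)`) is determined up to a constant: only the coordinates of type `sq` contribute. -/
theorem exists_eq_add_sum_sq [CharZero K] (h2 : ∀ q, δ (2 * N.eps q) = 2 * δ (N.eps q)) (h0 : δ 0 = 0) :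
    ∃ κ : K, f = algebraMap K A κ + ∑ q with N.kind q = .sq, δ (N.eps q) • z q ^ 2 := by
  obtain ⟨κ, hκ⟩ := eq_algebraMap_of_pd_eq_zero h pd hpd
    (f := f - ∑ q with N.kind q = .sq, δ (N.eps q) • z q ^ 2) fun p => by
      have hterm : ∀ q, pd p (δ (N.eps q) • z q ^ 2) =
          if q = p then (2 * δ (N.eps q)) • z q else 0 := by
        intro q
        rw [(pd p).map_smul, Derivation.leibniz_pow, hpd]
        split_ifs with hqp
        · simp [mul_smul, two_smul]
        · simp
      rw [map_sub, hf, map_sum, Finset.sum_congr rfl fun q _ => hterm q, Finset.sum_ite_eq']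
      have hlam : N.kind p = .gm ∨ N.kind p = .fst → δ (N.lam p) = 0 := by
        intro hp
        by_cases hU : p ∈ U
        · exact N.residue_horizontal h θ δ hc hz pd hpd hf (hp.imp id fun hp => ⟨hp, hU⟩)
        · rcases hp with hp | hp
          · exact absurd (N.gm_mem p hp) hU
          · rw [N.fst_lam p hp hU, h0]
      rcases hk : N.kind p with _ | _ | _ | _
      · rw [if_neg (by simp [hk]), sub_zero, N.derivation_coeff_gm h θ δ hc hz hk,
          hlam (Or.inl hk), zero_smul]
      · rw [if_pos (by simp [hk]), N.derivation_coeff_sq θ δ hc hz hk (h2 p), sub_self]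
      · rw [if_neg (by simp [hk]), sub_zero, N.derivation_coeff_fst h θ δ hc hz hk,
          hlam (Or.inr hk), zero_smul]
      · rw [if_neg (by simp [hk]), sub_zero, coeff_snd hk, map_sub, hz,
          Derivation.map_one_eq_zero, sub_zero]
  exact ⟨κ, sub_eq_iff_eq_add.mp hκ⟩

end Curvature

section Point
variable {K A : Type u} [Field K] [CommRing A] [Algebra K A] {ι : Type}
  {U : Set ι} {z : ι → A} (N : NormalData K U)

/-- The coordinates of the zero of a form in normal form. -/
def zeroCoord (q : ι) : K :=
  match N.kind q with
  | .gm => 1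
  | .sq => 0
  | .fst => 1
  | .snd => N.lam (N.inv q)

theorem zeroCoord_gm {q : ι} (hq : N.kind q = .gm) : N.zeroCoord q = 1 := by rw [zeroCoord, hq]
theorem zeroCoord_sq {q : ι} (hq : N.kind q = .sq) : N.zeroCoord q = 0 := by rw [zeroCoord, hq]
theorem zeroCoord_fst {q : ι} (hq : N.kind q = .fst) : N.zeroCoord q = 1 := by rw [zeroCoord, hq]
theorem zeroCoord_snd {q : ι} (hq : N.kind q = .snd) : N.zeroCoord q = N.lam (N.inv q) := by
  rw [zeroCoord, hq]

theorem zeroCoord_of_mem {q : ι} (hq : q ∈ U) : N.zeroCoord q = 1 := by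
  rcases hk : N.kind q with _ | _ | _ | _
  · exact N.zeroCoord_gm hk
  · exact absurd hq (N.sq_notMem q hk)
  · exact N.zeroCoord_fst hk
  · exact absurd hq (N.snd_notMem q hk)

variable (h : IsTorusCoord K U z)
include h

theorem exists_zero : ∃ b : A →ₐ[K] K, ∀ q, b (z q) = N.zeroCoord q :=
  h.exists_algHom _ fun q hq => by
    rw [N.zeroCoord_of_mem hq]
    exact isUnit_one

variable {b : A →ₐ[K] K} (hb : ∀ q, b (z q) = N.zeroCoord q)
include hb

theorem apply_zpw {q : ι} (hq : q ∈ U) (n : ℤ) : b (zpw (z q) n) = 1 := by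
  obtain ⟨v, hv⟩ := h.isUnit q hq
  have h1 : Units.map b.toMonoidHom v = 1 := by
    ext
    change b v = 1
    rw [hv, hb, N.zeroCoord_of_mem hq]
  have h2 : Units.map b.toMonoidHom (v ^ n) = 1 := by
    rw [map_zpow, h1, one_zpow]
  rw [← hv, zpw_unit]
  exact congrArg Units.val h2

theorem apply_inverse {q : ι} (hq : q ∈ U) : b (Ring.inverse (z q)) = 1 := by
  rw [← zpw_neg_one, N.apply_zpw h hb hq]

theorem apply_coeff (q : ι) : b (N.coeff z q) = 0 := by
  rcases hk : N.kind q with _ | _ | _ | _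
  · rw [coeff_gm hk, map_smul, map_sub, N.apply_inverse h hb (N.gm_mem q hk), map_one, sub_self,
      smul_zero]
  · rw [coeff_sq hk, map_smul, hb, N.zeroCoord_sq hk, smul_zero]
  · rw [coeff_fst hk, map_sub, map_smul, hb, N.zeroCoord_snd (N.kind_inv_fst q hk), N.inv_inv]
    by_cases hU : q ∈ U
    · rw [N.apply_inverse h hb hU, smul_eq_mul, mul_one, sub_self]
    · rw [N.fst_lam q hk hU, zero_smul, sub_self]
  · rw [coeff_snd hk, map_sub, map_one, hb, N.zeroCoord_fst (N.kind_inv_snd q hk), sub_self]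

/-- The functions vanishing at the zero are generated by the shifted coordinates. -/
theorem sub_apply_mem_span (f : A) : f - algebraMap K A (b f) ∈
    Ideal.span (Set.range fun q => z q - algebraMap K A (N.zeroCoord q)) := by
  set I := Ideal.span (Set.range fun q => z q - algebraMap K A (N.zeroCoord q))
  have h1 := h.hom_eq (F := Ideal.Quotient.mk I)
    (G := ((Ideal.Quotient.mk I).comp (algebraMap K A)).comp b.toRingHom)
    (fun c => by
      change _ = Ideal.Quotient.mk I (algebraMap K A (b (algebraMap K A c)))
      rw [AlgHom.commutes]; rfl)
    (fun q => by
      change _ = Ideal.Quotient.mk I (algebraMap K A (b (z q)))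
      rw [hb, Ideal.Quotient.eq]
      exact Ideal.subset_span ⟨q, rfl⟩)
  exact Ideal.Quotient.eq.mp (congrArg (fun F => F f) h1)

theorem exists_chart [Fintype ι] (f : A) : ∃ (c : K) (g : ι → A),
    f = algebraMap K A c + ∑ q, (z q - algebraMap K A (N.zeroCoord q)) * g q := by
  obtain ⟨g, hg⟩ := Ideal.mem_span_range_iff_exists_fun.mp (N.sub_apply_mem_span h hb f)
  refine ⟨b f, g, ?_⟩
  rw [Finset.sum_congr rfl fun q _ => mul_comm _ _, hg]
  ring

/-- The zero is unique. -/
theorem eq_ker_of_coeff_mem [CharZero K] {P : Ideal A} (hP : P.IsMaximal) :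
    (∀ q, N.coeff z q ∈ P) ↔ P = RingHom.ker b := by
  constructor
  · intro hcoeff
    have hone : ∀ q, N.kind q = .gm ∨ N.kind q = .fst → z q - 1 ∈ P := by
      intro q hq
      rcases hq with hk | hk
      · obtain ⟨v, hv⟩ := h.isUnit q (N.gm_mem q hk)
        have h1 := hcoeff q
        rw [coeff_gm hk, ← hv, Ring.inverse_unit, Algebra.smul_def] at h1
        have h2 := P.mul_mem_left (algebraMap K A (N.lam q)⁻¹ * v) h1
        have h3 : algebraMap K A (N.lam q)⁻¹ * algebraMap K A (N.lam q) = 1 := by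
          rw [← map_mul, inv_mul_cancel₀ (N.gm_ne q hk), map_one]
        have h4 : algebraMap K A (N.lam q)⁻¹ * v * (algebraMap K A (N.lam q) * (↑v⁻¹ - 1)) =
            1 - z q := by
          rw [← hv]
          linear_combination (v * (↑v⁻¹ - 1) : A) * h3 + v.mul_inv
        rw [h4] at h2
        rw [← neg_sub]
        exact neg_mem h2
      · have h1 := hcoeff (N.inv q)
        rw [coeff_snd (N.kind_inv_fst q hk), N.inv_inv] at h1
        rw [← neg_sub]
        exact neg_mem h1
    have hz : ∀ q, z q - algebraMap K A (N.zeroCoord q) ∈ P := by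
      intro q
      rcases hk : N.kind q with _ | _ | _ | _
      · rw [N.zeroCoord_gm hk, map_one]
        exact hone q (Or.inl hk)
      · have h1 := Submodule.smul_of_tower_mem P (2 * N.eps q)⁻¹ (hcoeff q)
        rw [coeff_sq hk, smul_smul, inv_mul_cancel₀ (mul_ne_zero two_ne_zero (N.sq_ne q hk)),
          one_smul] at h1
        rwa [N.zeroCoord_sq hk, map_zero, sub_zero]
      · rw [N.zeroCoord_fst hk, map_one]
        exact hone q (Or.inr hk)
      · have hk' := N.kind_inv_snd q hk
        have h1 := hcoeff (N.inv q)
        rw [coeff_fst hk', N.inv_inv] at h1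
        rw [N.zeroCoord_snd hk, ← neg_sub]
        refine neg_mem ?_
        by_cases hU : N.inv q ∈ U
        · obtain ⟨v, hv⟩ := h.isUnit _ hU
          have h2 := P.mul_mem_left (N.lam (N.inv q) • (↑v⁻¹ : A)) (hone _ (Or.inr hk'))
          rw [← hv] at h1 h2
          rw [Ring.inverse_unit] at h1
          have := add_mem h1 h2
          rwa [smul_mul_assoc, mul_sub, v.inv_mul, mul_one, smul_sub, sub_add_eq_add_sub,
            add_sub_cancel, ← Algebra.algebraMap_eq_smul_one] at this
        · rw [N.fst_lam _ hk' hU, zero_smul] at h1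
          rwa [N.fst_lam _ hk' hU, map_zero]
    refine ((RingHom.ker_isMaximal_of_surjective b.toRingHom fun c =>
      ⟨algebraMap K A c, b.commutes c⟩).eq_of_le hP.ne_top fun f hf => ?_).symm
    have h1 := N.sub_apply_mem_span h hb f
    have hf' : b f = 0 := hf
    rw [hf', map_zero, sub_zero] at h1
    refine Ideal.span_le.mpr ?_ h1
    rintro _ ⟨q, rfl⟩
    exact hz q
  · rintro rfl q
    exact N.apply_coeff h hb q

end Point
end NormalData

/-! ### The Hessian at the zero -/

namespace NormalData

section Hessian
variable {K A : Type u} [Field K] [CommRing A] [Algebra K A] {ι : Type} [DecidableEq ι]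
  {U : Set ι} {z : ι → A} (N : NormalData K U) (h : IsTorusCoord K U z)
  (pd : ι → Derivation K A A) (hpd : ∀ q p, pd q (z p) = if p = q then 1 else 0)
  {b : A →ₐ[K] K} (hb : ∀ q, b (z q) = N.zeroCoord q)
include h hpd hb

theorem apply_pd_inverse {q : ι} (hq : q ∈ U) (p : ι) :
    b (pd p (Ring.inverse (z q))) = if q = p then -1 else 0 := by
  rw [← zpw_neg_one, derivation_zpw (pd p) (Or.inl (h.isUnit q hq)), hpd, map_mul, map_mul,
    N.apply_zpw h hb hq]
  split_ifs <;> simp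

omit h hb in
theorem apply_pd_coord (p q : ι) : b (pd p (z q)) = if q = p then 1 else 0 := by
  rw [hpd]
  split_ifs <;> simp

theorem hessian_gm {q : ι} (hq : N.kind q = .gm) (p : ι) :
    b (pd p (N.coeff z q)) = if q = p then -N.lam q else 0 := by
  rw [coeff_gm hq, (pd p).map_smul, map_sub, map_smul, map_sub,
    N.apply_pd_inverse h pd hpd hb (N.gm_mem q hq), Derivation.map_one_eq_zero, map_zero, sub_zero]
  split_ifs <;> simp

omit h hb in
theorem hessian_sq {q : ι} (hq : N.kind q = .sq) (p : ι) :
    b (pd p (N.coeff z q)) = if q = p then 2 * N.eps q else 0 := by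
  rw [coeff_sq hq, (pd p).map_smul, map_smul, apply_pd_coord pd hpd]
  split_ifs <;> simp

theorem hessian_fst {q : ι} (hq : N.kind q = .fst) (p : ι) :
    b (pd p (N.coeff z q)) = (if q = p then -N.lam q else 0) - if N.inv q = p then 1 else 0 := by
  rw [coeff_fst hq, map_sub, map_sub, apply_pd_coord pd hpd, (pd p).map_smul, map_smul]
  congr 1
  by_cases hU : q ∈ U
  · rw [N.apply_pd_inverse h pd hpd hb hU]
    split_ifs <;> simp
  · rw [N.fst_lam q hq hU]
    simp

omit h hb in
theorem hessian_snd {q : ι} (hq : N.kind q = .snd) (p : ι) :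
    b (pd p (N.coeff z q)) = if N.inv q = p then -1 else 0 := by
  rw [coeff_snd hq, map_sub, map_sub, apply_pd_coord pd hpd, Derivation.map_one_eq_zero, map_zero]
  split_ifs <;> simp

omit h pd hpd hb

/-- The diagonal entry of the Hessian after `inv` has been applied to its columns. -/
def hessEntry (q : ι) : K :=
  match N.kind q with
  | .gm => -N.lam q
  | .sq => 2 * N.eps q
  | .fst => -1
  | .snd => -1

include h pd hpd hb

/-- After `inv` has been applied to the columns, the Hessian is triangular. -/
theorem det_hessian [Fintype ι] : ∃ s : ℤˣ,
    (Matrix.of fun p q => b (pd p (N.coeff z q))).det = (s : K) * ∏ q, N.hessEntry q := by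
  let σ : Equiv.Perm ι := ⟨N.inv, N.inv, N.inv_inv, N.inv_inv⟩
  let H : Matrix ι ι K := Matrix.of fun p q => b (pd p (N.coeff z q))
  have hH : ∀ p q, (H.submatrix id σ) p q = b (pd p (N.coeff z (N.inv q))) := fun _ _ => rfl
  -- the entries of the permuted matrix
  have hentry : ∀ p q, N.kind q ≠ .snd ∨ N.kind p = .snd →
      (H.submatrix id σ) p q = if p = q then N.hessEntry q else 0 := by
    intro p q hpq
    rw [hH]
    rcases hk : N.kind q with _ | _ | _ | _
    · rw [N.inv_gm q hk, N.hessian_gm h pd hpd hb hk, hessEntry, hk]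
      simp only [eq_comm]
    · rw [N.inv_sq q hk, N.hessian_sq pd hpd hk, hessEntry, hk]
      simp only [eq_comm]
    · rw [N.hessian_snd pd hpd (N.kind_inv_fst q hk), N.inv_inv, hessEntry, hk]
      simp only [eq_comm]
    · have hk' := N.kind_inv_snd q hk
      have hp : N.inv q ≠ p := by
        rintro rfl
        rw [hk, hk'] at hpq
        rcases hpq with hpq | hpq
        · exact hpq rfl
        · cases hpq
      rw [N.hessian_fst h pd hpd hb hk', if_neg hp, N.inv_inv, hessEntry, hk, zero_sub]
      simp only [eq_comm (a := p)]
      split_ifs <;> simp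
  have hdet : (H.submatrix id σ).det = ∏ q, N.hessEntry q := by
    rw [Matrix.twoBlockTriangular_det _ (fun q => N.kind q ≠ .snd)]
    · have h1 : (H.submatrix id σ).toSquareBlockProp (fun q => N.kind q ≠ .snd) =
          Matrix.diagonal fun q => N.hessEntry q.1 := by
        ext p q
        rw [Matrix.toSquareBlockProp_def, Matrix.of_apply, hentry _ _ (Or.inl q.2),
          Matrix.diagonal_apply]
        simp only [Subtype.ext_iff]
        split_ifs with hpq
        · rw [hpq]
        · rfl
      have h2 : (H.submatrix id σ).toSquareBlockProp (fun q => ¬ N.kind q ≠ .snd) =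
          Matrix.diagonal fun q => N.hessEntry q.1 := by
        ext p q
        rw [Matrix.toSquareBlockProp_def, Matrix.of_apply, hentry _ _ (Or.inr (not_not.mp p.2)),
          Matrix.diagonal_apply]
        simp only [Subtype.ext_iff]
        split_ifs with hpq
        · rw [hpq]
        · rfl
      rw [h1, h2, Matrix.det_diagonal, Matrix.det_diagonal]
      exact Fintype.prod_subtype_mul_prod_subtype (fun q => N.kind q ≠ .snd) N.hessEntry
    · intro p hp q hq
      rw [hentry _ _ (Or.inl hq), if_neg]
      rintro rfl
      exact hp hq
  refine ⟨Equiv.Perm.sign σ, ?_⟩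
  have h3 := Matrix.det_permute' σ H
  rw [hdet] at h3
  rw [h3, ← mul_assoc]
  have h4 : ((Equiv.Perm.sign σ : ℤˣ) : K) * ((Equiv.Perm.sign σ : ℤˣ) : K) = 1 := by
    rcases Int.units_eq_one_or (Equiv.Perm.sign σ) with hs | hs <;> simp [hs]
  rw [h4, one_mul]

end Hessian

section LogDerivative
variable {k : Type v} {K : Type u} [Field k] [Field K] [Algebra k K] {ι : Type}

theorem D_prod_of_ne_zero (s : Finset ι) (f : ι → K) (hf : ∀ q ∈ s, f q ≠ 0) :
    KaehlerDifferential.D k K (∏ q ∈ s, f q) =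
      (∏ q ∈ s, f q) • ∑ q ∈ s, (f q)⁻¹ • KaehlerDifferential.D k K (f q) := by
  classical
  induction s using Finset.induction_on with
  | empty => simp
  | insert a s ha ih =>
    rw [Finset.prod_insert ha, Finset.sum_insert ha, Derivation.leibniz,
      ih fun p hp => hf p (Finset.mem_insert_of_mem hp), smul_add, smul_smul, smul_smul, add_comm,
      mul_assoc, mul_comm (∏ q ∈ s, f q), ← mul_assoc,
      mul_inv_cancel₀ (hf a (Finset.mem_insert_self _ _)), one_mul]

/-- The discriminant is the product of the numbers `eps`, up to a square and a horizontal factor. -/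
theorem prod_hessEntry [CharZero K] {U : Set ι} (N : NormalData K U) [Fintype ι]
    (hlam : ∀ q, N.kind q = .gm → KaehlerDifferential.D k K (N.lam q) = 0) :
    ∃ c : K, c ≠ 0 ∧ KaehlerDifferential.D k K c = 0 ∧
      ∏ q, N.hessEntry q = c * ∏ q with N.kind q = .sq, N.eps q := by
  refine ⟨∏ q, (if N.kind q = .sq then 2 else N.hessEntry q), ?_, ?_, ?_⟩
  · refine Finset.prod_ne_zero_iff.mpr fun q _ => ?_
    rcases hk : N.kind q with _ | _ | _ | _ <;> simp [hessEntry, hk]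
    exact N.gm_ne q hk
  · refine derivation_prod_eq_zero _ _ _ fun q _ => ?_
    rcases hk : N.kind q with _ | _ | _ | _ <;> simp [hessEntry, hk]
    · exact hlam q hk
    · exact (KaehlerDifferential.D k K).map_natCast 2
  · rw [Finset.prod_filter, ← Finset.prod_mul_distrib]
    refine Finset.prod_congr rfl fun q _ => ?_
    rcases hk : N.kind q with _ | _ | _ | _ <;> simp [hessEntry, hk]

end LogDerivative
end NormalData

/-! ### Connection form and discriminant for a form in normal form -/

namespace NormalData

variable {k : Type v} {K A : Type u} [Field k] [Field K] [Algebra k K] [CommRing A] [Algebra K A]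
  [Algebra k A] [IsScalarTower k K A] [CharZero K] {n : ℕ} {U : Set (Fin n)} {z : Fin n → A}
  (N : NormalData K U) (h : IsTorusCoord K U z) (bs : Module.Basis (Fin n) A (Ω[A⁄K]))
  (hbs : ∀ q, bs q = KaehlerDifferential.D K A (z q))
  {ξ : Ω[A⁄K]} (hξ : ∀ q, bs.coord q ξ = N.coeff z q) {Ψ : Ω[A⁄k]}
  (hΨ : KaehlerDifferential.map k K A A Ψ = ξ)
  (hcurv : extD k A (form1 k A Ψ) ∈ fil2 k K A)

omit [CharZero K] in
theorem dualDer_coord {bs : Module.Basis (Fin n) A (Ω[A⁄K])}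
    (hbs : ∀ q, bs q = KaehlerDifferential.D K A (z q)) (q p : Fin n) :
    dualDer bs q (z p) = if p = q then 1 else 0 := by
  rw [dualDer_apply, ← hbs, Module.Basis.coord_apply, Module.Basis.repr_self, Finsupp.single_apply]

omit [CharZero K] in
include h in
theorem exists_lift_derivation (l : Ω[K⁄k] →ₗ[K] K) : ∃ θ : Derivation k A A,
    (∀ c, θ (algebraMap K A c) = algebraMap K A (l (KaehlerDifferential.D k K c))) ∧
      ∀ q, θ (z q) = 0 :=
  h.exists_derivation (l.compDer (KaehlerDifferential.D k K)) fun _ => 0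

omit [CharZero K] [Algebra k A] [IsScalarTower k K A] [Algebra k K] in
include h in
/-- The mixed derivatives of the form agree. -/
theorem pd_coeff_comm (pd : Fin n → Derivation K A A)
    (hpd : ∀ q p, pd q (z p) = if p = q then 1 else 0) (p q : Fin n) :
    pd p (N.coeff z q) = pd q (N.coeff z p) := by
  have key : ∀ p q, p ≠ q → pd p (N.coeff z q) = if N.inv q = p then -1 else 0 := by
    intro p q hpq
    have hinv : q ∈ U → pd p (Ring.inverse (z q)) = 0 := fun hq => by
      rw [← zpw_neg_one, derivation_zpw (pd p) (Or.inl (h.isUnit q hq)), hpd, if_neg hpq.symm,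
        mul_zero]
    rcases hk : N.kind q with _ | _ | _ | _
    · rw [coeff_gm hk, (pd p).map_smul, map_sub, hinv (N.gm_mem q hk), Derivation.map_one_eq_zero,
        sub_zero, smul_zero, N.inv_gm q hk, if_neg hpq.symm]
    · rw [coeff_sq hk, (pd p).map_smul, hpd, if_neg hpq.symm, smul_zero, N.inv_sq q hk,
        if_neg hpq.symm]
    · rw [coeff_fst hk, map_sub, (pd p).map_smul, hpd]
      have : N.lam q • pd p (Ring.inverse (z q)) = 0 := by
        by_cases hU : q ∈ U
        · rw [hinv hU, smul_zero]
        · rw [N.fst_lam q hk hU, zero_smul]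
      rw [this]
      split_ifs <;> simp
    · rw [coeff_snd hk, map_sub, hpd, Derivation.map_one_eq_zero]
      split_ifs <;> simp
  by_cases hpq : p = q
  · rw [hpq]
  · rw [key p q hpq, key q p (Ne.symm hpq)]
    refine if_congr ⟨?_, ?_⟩ rfl rfl <;> rintro rfl <;> exact N.inv_inv _

include h hbs hξ hΨ hcurv

omit [CharZero K] in
theorem D_lam_eq_zero {q : Fin n} (hq : N.kind q = .gm) :
    KaehlerDifferential.D k K (N.lam q) = 0 := by
  rw [← Module.forall_dual_apply_eq_zero_iff K]
  intro l
  obtain ⟨θ, hc, hz⟩ := exists_lift_derivation (k := k) h l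
  refine N.residue_horizontal h θ (fun c => l (KaehlerDifferential.D k K c)) hc hz (dualDer bs)
    (dualDer_coord hbs) (f := θ.liftKaehlerDifferential Ψ) (fun q => ?_) (Or.inl hq)
  rw [dualDer_lift_eq bs z hbs l θ hc hz Ψ hcurv, hΨ, hξ]

/-- The connection form of the Gauß–Manin connection. -/
theorem gaussManin {b : A →ₐ[K] K} (hb : ∀ q, b (z q) = N.zeroCoord q) :
    Module.finrank K (DeRhamH ξ n) = 1 ∧
      ∃ nabla : Conn k K (DeRhamH ξ n), IsGaussManin Ψ ξ n nabla ∧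
        (∀ nabla' : Conn k K (DeRhamH ξ n), IsGaussManin Ψ ξ n nabla' → nabla' = nabla) ∧
        nabla.Iso (Conn.ofForm k (restrictPoint b Ψ - (2 : K)⁻¹ •
          ∑ q with N.kind q = .sq, (N.eps q)⁻¹ • KaehlerDifferential.D k K (N.eps q))) := by
  have hpd := dualDer_coord hbs
  have hcoeff : (fun q => bs.coord q ξ) = N.coeff z := funext hξ
  have hzero : ∀ f, topClass bs ξ f = 0 ↔ f ∈ N.exact (z := z) (dualDer bs) := by
    intro f
    rw [topClass_eq_zero_iff bs z hbs, hcoeff]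
  refine exists_gaussManin bs z hbs (exists_lift_derivation h) hΨ hcurv (mon z N.baseExp) ?_ ?_ _ ?_
  · intro f
    obtain ⟨c, hc⟩ := N.exists_smul_sub_mem h _ hpd f
    refine ⟨c, ?_⟩
    rw [← sub_eq_zero, ← map_smul, ← map_sub, hzero]
    exact hc
  · obtain ⟨L, hL, hL1⟩ := N.exists_exact_functional h _ hpd
    intro h0
    rw [hzero] at h0
    rw [hL _ h0] at hL1
    exact zero_ne_one hL1
  · intro l θ hc hz
    have hf : ∀ q, dualDer bs q (θ.liftKaehlerDifferential Ψ) = θ (N.coeff z q) := fun q => by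
      rw [dualDer_lift_eq bs z hbs l θ hc hz Ψ hcurv, hΨ, hξ]
    obtain ⟨κ, hκ⟩ := N.exists_eq_add_sum_sq h θ (fun c => l (KaehlerDifferential.D k K c)) hc hz
      (dualDer bs) hpd hf (fun q => by
        have h2 : KaehlerDifferential.D k K (2 : K) = 0 := (KaehlerDifferential.D k K).map_natCast 2
        rw [Derivation.leibniz, h2, smul_zero, add_zero, map_smul, smul_eq_mul])
      (by rw [map_zero, map_zero])
    have hpoint : l (restrictPoint b Ψ) = κ := by
      rw [apply_restrictPoint bs z hbs l θ hc hz b Ψ, hΨ, Finset.sum_eq_zero, add_zero, hκ, map_add,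
        map_sum, Finset.sum_eq_zero, add_zero]
      · exact b.commutes κ
      · intro q hq
        rw [map_smul, map_pow, hb, N.zeroCoord_sq (Finset.mem_filter.mp hq).2,
          zero_pow two_ne_zero, smul_zero]
      · intro q _
        rw [hξ, N.apply_coeff h hb, zero_mul]
    -- the class of `z² g` for a coordinate `z` of type `sq`
    have hsq : ∀ q, N.kind q = .sq → topClass bs ξ (z q ^ 2 * mon z N.baseExp) =
        (-(2 : K)⁻¹ * (N.eps q)⁻¹) • topClass bs ξ (mon z N.baseExp) := by
      intro q hq
      have hA : Adm U (N.baseExp + Pi.single q 1) :=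
        N.adm_baseExp.add (adm_single q (Or.inr zero_le_one))
      have h1 := N.mem_exact (z := z) (dualDer bs) q (mon z (N.baseExp + Pi.single q 1))
      rw [rel_sq h _ hpd hq hA, add_sub_cancel_right, Pi.add_apply, Pi.single_eq_same,
        baseExp_of_ne N (by rw [hq]; decide), ← mul_mon h q hA, ← mul_mon h q N.adm_baseExp,
        ← mul_assoc, ← sq, ← hzero, map_add, map_smul, map_smul] at h1
      have he := N.sq_ne q hq
      have h2 : (2 : K) ≠ 0 := two_ne_zero
      have h3 := congrArg (fun x => (2 * N.eps q)⁻¹ • x) h1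
      simp only [smul_add, smul_smul, inv_mul_cancel₀ (mul_ne_zero h2 he), one_smul,
        smul_zero] at h3
      rw [← neg_eq_of_add_eq_zero_right h3, ← neg_smul]
      congr 1
      push_cast
      field_simp
    rw [derivation_mon_eq_zero h θ hz N.adm_baseExp, zero_add, hκ, add_mul, Finset.sum_mul, map_add,
      map_sum, ← Algebra.smul_def, map_smul, map_sub, hpoint, sub_smul, sub_eq_add_neg]
    congr 1
    rw [map_smul, map_sum, smul_eq_mul, Finset.mul_sum, Finset.sum_smul, ← Finset.sum_neg_distrib]
    refine Finset.sum_congr rfl fun q hq => ?_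
    rw [smul_mul_assoc, map_smul, hsq q (Finset.mem_filter.mp hq).2, smul_smul, ← neg_smul, map_smul,
      smul_eq_mul]
    congr 1
    ring

/-- For a form in normal form, the zero is unique, and the Gauß–Manin connection exists, is unique and
is given by `Ψ` at the zero and by the discriminant. -/
theorem exists_zero_gaussManin_disc : ∃ b : A →ₐ[K] K,
    (∀ P : Ideal A, P.IsMaximal → (ξ ∈ P • (⊤ : Submodule A (Ω[A⁄K])) ↔ P = RingHom.ker b)) ∧
      Module.finrank K (DeRhamH ξ n) = 1 ∧
      ∃ nabla : Conn k K (DeRhamH ξ n),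
        IsGaussManin Ψ ξ n nabla ∧
        (∀ nabla' : Conn k K (DeRhamH ξ n), IsGaussManin Ψ ξ n nabla' → nabla' = nabla) ∧
        (∃ φ : A →ₐ[K] MvPowerSeries (Fin n) K, IsFormalParameters b φ) ∧
        ∀ φ : A →ₐ[K] MvPowerSeries (Fin n) K, IsFormalParameters b φ →
          ∃ h : MvPowerSeries (Fin n) K, IsPrimitive φ ξ h ∧ (quadMatrix h).det ≠ 0 ∧
            Conn.Iso nabla (Conn.ofForm k (restrictPoint b Ψ +
              (2 : K)⁻¹ • (quadMatrix h).det⁻¹ •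
                KaehlerDifferential.D k K (quadMatrix h).det)) := by
  have hpd := dualDer_coord hbs
  obtain ⟨b, hb⟩ := N.exists_zero h
  obtain ⟨hfin, nabla, hGM, huniq, hiso⟩ := N.gaussManin h bs hbs hξ hΨ hcurv hb
  refine ⟨b, fun P hP => ?_, hfin, nabla, hGM, huniq, ?_, fun φ hφ => ?_⟩
  · rw [← N.eq_ker_of_coeff_mem h hb hP]
    constructor
    · intro hmem q
      rw [← hξ]
      refine Submodule.smul_induction_on hmem (fun r hr x _ => ?_) fun x y hx hy => ?_
      · rw [map_smul, smul_eq_mul]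
        exact P.mul_mem_right _ hr
      · rw [map_add]
        exact add_mem hx hy
    · intro hmem
      rw [← bs.sum_repr ξ]
      refine sum_mem fun q _ => Submodule.smul_mem_smul ?_ trivial
      rw [← Module.Basis.coord_apply, hξ]
      exact hmem q
  · obtain ⟨φ, hφ⟩ := h.exists_algHom
      (fun q => MvPowerSeries.C (N.zeroCoord q) + MvPowerSeries.X q : Fin n → MvPowerSeries (Fin n) K)
      fun q hq => by
        rw [MvPowerSeries.isUnit_iff_constantCoeff, N.zeroCoord_of_mem hq]
        simp
    refine ⟨φ, isFormalParameters_of_chart (fun q => z q - algebraMap K A (N.zeroCoord q)) b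
      (fun q => ?_) (N.exists_chart h hb) φ fun q => ?_⟩
    · rw [map_sub, hb, AlgHom.commutes]
      exact sub_self _
    · rw [map_sub, hφ, AlgHom.commutes]
      exact add_sub_cancel_left _ _
  · have hcoeff : ∀ p q, dualDer bs p (bs.coord q ξ) = dualDer bs q (bs.coord p ξ) := fun p q => by
      rw [hξ, hξ, N.pd_coeff_comm h _ hpd]
    obtain ⟨f, hprim, u, hu, hdet⟩ := exists_isPrimitive bs z hbs φ hφ ξ hcoeff
      fun q => by rw [hξ, N.apply_coeff h hb]
    obtain ⟨s, hs⟩ := N.det_hessian h (dualDer bs) hpd hb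
    obtain ⟨c, hc0, hDc, hc⟩ := N.prod_hessEntry (k := k)
      fun q hq => N.D_lam_eq_zero h bs hbs hξ hΨ hcurv hq
    simp only [hξ] at hdet
    rw [hs, hc] at hdet
    set E := ∏ q with N.kind q = .sq, N.eps q
    have hE : E ≠ 0 := Finset.prod_ne_zero_iff.mpr fun q hq => N.sq_ne q (Finset.mem_filter.mp hq).2
    have hDE : KaehlerDifferential.D k K E = E • ∑ q with N.kind q = .sq, (N.eps q)⁻¹ •
        KaehlerDifferential.D k K (N.eps q) :=
      D_prod_of_ne_zero _ _ fun q hq => N.sq_ne q (Finset.mem_filter.mp hq).2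
    set w := ∑ q with N.kind q = .sq, (N.eps q)⁻¹ • KaehlerDifferential.D k K (N.eps q)
    -- the horizontal factor of the determinant
    set c' : K := 2⁻¹ ^ n * ((s : ℤ) : K) * c with hc'
    have hc'0 : c' ≠ 0 := by
      refine mul_ne_zero (mul_ne_zero (pow_ne_zero _ (inv_ne_zero two_ne_zero)) ?_) hc0
      rcases Int.units_eq_one_or s with hs | hs <;> simp [hs]
    have hDc' : KaehlerDifferential.D k K c' = 0 := by
      have h2 : KaehlerDifferential.D k K (2 : K)⁻¹ = 0 := by
        have : KaehlerDifferential.D k K (2 : K) = 0 := (KaehlerDifferential.D k K).map_natCast 2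
        rw [Derivation.leibniz_inv, this, smul_zero]
      rw [hc', Derivation.leibniz, Derivation.leibniz, Derivation.leibniz_pow, h2, hDc,
        Derivation.map_intCast]
      simp
    have hdet' : (quadMatrix f).det = u ^ 2 * (c' * E) := by
      rw [hdet, hc']
      ring
    have hdet0 : (quadMatrix f).det ≠ 0 := by
      rw [hdet']
      exact mul_ne_zero (pow_ne_zero _ hu) (mul_ne_zero hc'0 hE)
    refine ⟨f, hprim, hdet0, hiso.trans (Conn.ofForm_iso (u := (u * E)⁻¹)
      (inv_ne_zero (mul_ne_zero hu hE)) ?_)⟩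
    have hlog : (quadMatrix f).det⁻¹ • KaehlerDifferential.D k K (quadMatrix f).det =
        (2 * u⁻¹) • KaehlerDifferential.D k K u + w := by
      rw [hdet', Derivation.leibniz, Derivation.leibniz, Derivation.leibniz_pow, hDc', hDE,
        ← Nat.cast_smul_eq_nsmul K]
      simp only [smul_add, smul_smul, smul_zero, add_zero]
      rw [add_comm]
      congr 1
      · congr 1
        push_cast
        field_simp
      · rw [show (u ^ 2 * (c' * E))⁻¹ * (u ^ 2 * (c' * E)) = 1 from
          inv_mul_cancel₀ (hdet' ▸ hdet0), one_smul]
    have hv : KaehlerDifferential.D k K (u * E)⁻¹ =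
        -((u * E)⁻¹ • (u⁻¹ • KaehlerDifferential.D k K u + w)) := by
      rw [Derivation.leibniz_inv, Derivation.leibniz, hDE, neg_smul]
      congr 1
      simp only [smul_add, smul_smul]
      rw [add_comm]
      congr 2 <;> field_simp
    rw [hlog, hv, ← smul_neg, ← smul_add]
    congr 1
    rw [smul_add, smul_smul, ← mul_assoc, inv_mul_cancel₀ two_ne_zero, one_mul]
    have hhalf : w = (2 : K)⁻¹ • w + (2 : K)⁻¹ • w := by
      rw [← two_smul K, smul_smul, mul_inv_cancel₀ two_ne_zero, one_smul]
    rw [eq_sub_iff_add_eq]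
    nth_rewrite 2 [hhalf]
    abel

end NormalData

/-! ### Logarithmic differentials of truncated power series -/

section MapDer
variable {K A : Type*} [Field K] [CommRing A] [Algebra K A]

/-- The derivation of `A⟦T⟧` that applies a derivation of `A` to the coefficients. -/
def mapDer (δ : Derivation K A A) : Derivation K (PowerSeries A) (PowerSeries A) :=
  Derivation.mk'
    { toFun := fun F => PowerSeries.mk fun j => δ (PowerSeries.coeff j F)
      map_add' := fun F G => by ext; simp
      map_smul' := fun c F => by ext; simp }
    (fun F G => by
      ext j
      simp only [LinearMap.coe_mk, AddHom.coe_mk, PowerSeries.coeff_mk, PowerSeries.coeff_mul,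
        map_sum, Derivation.leibniz, smul_eq_mul, map_add, Finset.sum_add_distrib]
      congr 1
      rw [← Finset.Nat.sum_antidiagonal_swap]
      rfl)

@[simp] theorem coeff_mapDer (δ : Derivation K A A) (F : PowerSeries A) (j : ℕ) :
    PowerSeries.coeff j (mapDer δ F) = δ (PowerSeries.coeff j F) := by
  simp [mapDer]

theorem mapDer_C (δ : Derivation K A A) (a : A) :
    mapDer δ (PowerSeries.C a) = PowerSeries.C (δ a) := by
  ext j
  rw [coeff_mapDer, PowerSeries.coeff_C, PowerSeries.coeff_C]
  split_ifs <;> simp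

theorem mapDer_map_algebraMap (δ : Derivation K A A) (F : PowerSeries K) :
    mapDer δ (PowerSeries.map (algebraMap K A) F) = 0 := by
  ext j
  simp

/-- The logarithm `log (1 + W)`, truncated after the term of degree `M` in `W`. -/
def truncLog (M : ℕ) (W : PowerSeries A) : PowerSeries A :=
  ∑ n ∈ Finset.Icc 1 M, ((-1) ^ (n - 1) / n : K) • W ^ n

theorem mapDer_truncLog [CharZero K] (δ : Derivation K A A) (M : ℕ) (W : PowerSeries A) :
    mapDer δ (truncLog (K := K) M W) = (∑ i ∈ Finset.range M, (-W) ^ i) * mapDer δ W := by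
  rw [truncLog, map_sum, Finset.sum_mul]
  have : Finset.Icc 1 M = (Finset.range M).image (· + 1) := by
    ext n
    simp only [Finset.mem_Icc, Finset.mem_image, Finset.mem_range]
    constructor
    · rintro ⟨h1, h2⟩
      exact ⟨n - 1, by omega, by omega⟩
    · rintro ⟨j, hj, rfl⟩
      omega
  rw [this, Finset.sum_image (by intro a _ b _ h; exact Nat.succ_injective h)]
  refine Finset.sum_congr rfl fun i _ => ?_
  rw [Derivation.map_smul, Derivation.leibniz_pow, Nat.add_sub_cancel, smul_eq_mul,
    ← Nat.cast_smul_eq_nsmul K, smul_smul, div_mul_cancel₀ _ (Nat.cast_ne_zero.mpr i.succ_ne_zero),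
    neg_pow W i, mul_assoc, Algebra.smul_def, map_pow, map_neg, map_one]

/-- In degrees at most `M`, the truncated logarithm has the logarithmic derivative `W' / (1 + W)`. -/
theorem coeff_inverse_mul_mapDer [CharZero K] (δ : Derivation K A A) {M : ℕ} {V V' : PowerSeries A}
    (hV : V' * V = 1) (h0 : PowerSeries.coeff 0 V = 1) {j : ℕ} (hj : j ≤ M) :
    PowerSeries.coeff j (V' * mapDer δ V) =
      δ (PowerSeries.coeff j (truncLog (K := K) M (V - 1))) := by
  have h1 : mapDer δ (V - 1) = mapDer δ V := by rw [map_sub, Derivation.map_one_eq_zero, sub_zero]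
  have h2 : (∑ i ∈ Finset.range M, (-(V - 1)) ^ i) = V' * (1 - (-(V - 1)) ^ M) := by
    rw [← mul_neg_geom_sum]
    linear_combination (-∑ i ∈ Finset.range M, (-(V - 1)) ^ i) * hV
  rw [← coeff_mapDer, mapDer_truncLog, h1, h2, mul_assoc, sub_mul, one_mul, mul_sub, map_sub,
    eq_comm, sub_eq_self]
  have hX : ∀ F : PowerSeries A, PowerSeries.coeff 0 F = 0 → PowerSeries.X ∣ F := fun F hF =>
    PowerSeries.X_dvd_iff.mpr (by rwa [← PowerSeries.coeff_zero_eq_constantCoeff_apply])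
  have h3 : (PowerSeries.X : PowerSeries A) ^ (M + 1) ∣
      V' * ((-(V - 1)) ^ M * mapDer δ V) := by
    refine Dvd.dvd.mul_left ?_ _
    rw [pow_succ]
    refine mul_dvd_mul (pow_dvd_pow_of_dvd (hX _ ?_) M) (hX _ ?_)
    · rw [map_neg, map_sub, h0, PowerSeries.coeff_zero_one, sub_self, neg_zero]
    · rw [coeff_mapDer, h0, Derivation.map_one_eq_zero]
  exact PowerSeries.X_pow_dvd_iff.mp h3 j (by omega)

end MapDer

/-! ### The coordinates at one point of the divisor -/

section Local
variable {K A : Type*} [Field K] [CommRing A] [Algebra K A]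
  (L : ℕ → K) (M : ℕ) (c : K) (u : PowerSeries A)

/-- The constant series by which `u / u(0)` is divided in order to simplify the linear part of the
form. -/
def baseSeries : PowerSeries K :=
  PowerSeries.mk fun l => if l = 0 then 1 else if l < M then L (M - l) / L M else 0

/-- The normalized series `V`, determined by `u = u(0) * baseSeries * V`. -/
def normSeries : PowerSeries A :=
  PowerSeries.C (Ring.inverse (PowerSeries.coeff 0 u)) *
    PowerSeries.map (algebraMap K A) (baseSeries L M)⁻¹ * u

/-- The part of degree at least `a` of the normalized series. -/
def tailSeries (a : ℕ) : PowerSeries A :=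
  PowerSeries.mk fun b => if b < a then 0 else PowerSeries.coeff b (normSeries L M u)

/-- The functional `∑ j ≤ M, L j * coeff j`. -/
def lamCoeff : PowerSeries A →ₗ[A] A :=
  ∑ j ∈ Finset.range (M + 1), algebraMap K A (L j) • PowerSeries.coeff j

/-- The part of degree at least two in `W` of the truncated logarithm. -/
def logTail (W : PowerSeries A) : PowerSeries A :=
  ∑ n ∈ Finset.Icc 2 M, ((-1) ^ (n - 1) / n : K) • W ^ n

/-- The partner of the coordinate with index `a`. For `a = 0` it is the last coefficient of `u`,
suitably normalized; for `0 < a` it is the factor of the coefficient `a` in those monomials of the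
potential in which `a` is the smallest index. -/
def partner (a : ℕ) : A :=
  if a = 0 then L M • (Ring.inverse (PowerSeries.coeff 0 u) * PowerSeries.coeff M u)
  else lamCoeff L M (PowerSeries.X ^ a * ∑ n ∈ Finset.Icc 2 M, ((-1) ^ (n - 1) / n : K) •
    ∑ i ∈ Finset.range n, tailSeries L M u a ^ i * tailSeries L M u (a + 1) ^ (n - 1 - i))

/-- The coordinates in which the form is in normal form. -/
def newCoord (j : ℕ) : A :=
  if j = 0 then (c / L M) • PowerSeries.coeff 0 u
  else if 2 * j < M then 1 - PowerSeries.coeff j (normSeries L M u)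
  else if 2 * j = M then PowerSeries.coeff j (normSeries L M u)
  else partner L M u (M - j)

theorem lamCoeff_apply (F : PowerSeries A) :
    lamCoeff L M F = ∑ j ∈ Finset.range (M + 1), L j • PowerSeries.coeff j F := by
  simp [lamCoeff, Algebra.smul_def]

theorem lamCoeff_smul (a : K) (F : PowerSeries A) : lamCoeff L M (a • F) = a • lamCoeff L M F :=
  LinearMap.map_smul_of_tower _ _ _

theorem coeff_zero_baseSeries : PowerSeries.constantCoeff (baseSeries L M) = 1 := by
  rw [← PowerSeries.coeff_zero_eq_constantCoeff_apply, baseSeries, PowerSeries.coeff_mk, if_pos rfl]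

theorem map_baseSeries_mul_inv : PowerSeries.map (algebraMap K A) (baseSeries L M) *
    PowerSeries.map (algebraMap K A) (baseSeries L M)⁻¹ = 1 := by
  rw [← map_mul, PowerSeries.mul_inv_cancel _ (by rw [coeff_zero_baseSeries]; exact one_ne_zero),
    map_one]

variable (hx : IsUnit (PowerSeries.coeff 0 u))
include hx

theorem eq_mul_normSeries : u = PowerSeries.C (PowerSeries.coeff 0 u) *
    PowerSeries.map (algebraMap K A) (baseSeries L M) * normSeries L M u := by
  have h1 := map_baseSeries_mul_inv (A := A) L M
  have h2 : PowerSeries.C (PowerSeries.coeff 0 u) *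
      PowerSeries.C (Ring.inverse (PowerSeries.coeff 0 u)) = 1 := by
    rw [← map_mul, Ring.mul_inverse_cancel _ hx, map_one]
  rw [normSeries]
  linear_combination (-PowerSeries.map (algebraMap K A) (baseSeries L M) *
    PowerSeries.map (algebraMap K A) (baseSeries L M)⁻¹ * u) * h2 - u * h1

theorem coeff_zero_normSeries : PowerSeries.coeff 0 (normSeries L M u) = 1 := by
  have h1 := congrArg PowerSeries.constantCoeff (map_baseSeries_mul_inv (A := A) L M)
  rw [map_mul, ← PowerSeries.coeff_zero_eq_constantCoeff_apply,
    ← PowerSeries.coeff_zero_eq_constantCoeff_apply, PowerSeries.coeff_map,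
    PowerSeries.coeff_zero_eq_constantCoeff_apply, coeff_zero_baseSeries, map_one, one_mul,
    map_one] at h1
  have h2 : ∀ F G : PowerSeries A, PowerSeries.coeff 0 (F * G) =
      PowerSeries.coeff 0 F * PowerSeries.coeff 0 G := fun F G => by simp
  rw [normSeries, h2, h2, h1, PowerSeries.coeff_zero_C, mul_one, Ring.inverse_mul_cancel _ hx]

theorem tailSeries_one : tailSeries L M u 1 = normSeries L M u - 1 := by
  ext b
  rw [tailSeries, PowerSeries.coeff_mk, map_sub, PowerSeries.coeff_one]
  split_ifs with h1 h2 h2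
  · rw [h2, coeff_zero_normSeries L M u hx, sub_self]
  · omega
  · omega
  · rw [sub_zero]

omit hx in
theorem tailSeries_eq_add (a : ℕ) : tailSeries L M u a =
    PowerSeries.X ^ a * PowerSeries.C (PowerSeries.coeff a (normSeries L M u)) +
      tailSeries L M u (a + 1) := by
  ext b
  rw [map_add, tailSeries, tailSeries, PowerSeries.coeff_mk, PowerSeries.coeff_mk, mul_comm,
    PowerSeries.coeff_C_mul, PowerSeries.coeff_X_pow]
  split_ifs with h1 h2 h3 h3 h4 <;> first | omega | simp_all

omit hx in
theorem X_pow_dvd_tailSeries (a : ℕ) : PowerSeries.X ^ a ∣ tailSeries L M u a :=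
  PowerSeries.X_pow_dvd_iff.mpr fun b hb => by rw [tailSeries, PowerSeries.coeff_mk, if_pos hb]

omit hx in
theorem lamCoeff_eq_zero {F : PowerSeries A} {a : ℕ} (ha : M < a) (hF : PowerSeries.X ^ a ∣ F) :
    lamCoeff L M F = 0 := by
  rw [lamCoeff_apply]
  refine Finset.sum_eq_zero fun j hj => ?_
  rw [PowerSeries.X_pow_dvd_iff.mp hF j (by have := Finset.mem_range.mp hj; omega), smul_zero]

omit hx in
theorem X_pow_dvd_smul_tailSeries (a n : ℕ) (r : K) :
    PowerSeries.X ^ (a * n) ∣ r • tailSeries L M u a ^ n := by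
  rw [← algebraMap_smul A r, PowerSeries.smul_eq_C_mul, pow_mul]
  exact Dvd.dvd.mul_left (pow_dvd_pow_of_dvd (X_pow_dvd_tailSeries L M u a) n) _

omit hx in
theorem lamCoeff_logTail_eq_zero {a : ℕ} (ha : M < 2 * a) :
    lamCoeff L M (logTail (K := K) M (tailSeries L M u a)) = 0 := by
  refine lamCoeff_eq_zero L M ha (Finset.dvd_sum fun n hn => ?_)
  refine dvd_trans (pow_dvd_pow _ ?_) (X_pow_dvd_smul_tailSeries L M u a n _)
  rw [mul_comm]
  exact Nat.mul_le_mul_left a (Finset.mem_Icc.mp hn).1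

/-- The linear part of the potential is a multiple of the last coefficient of `u`. -/
theorem lamCoeff_tailSeries_one (hL : L M ≠ 0) (hM : M ≠ 0) :
    lamCoeff L M (tailSeries L M u 1) = partner L M u 0 := by
  have h1 : Ring.inverse (PowerSeries.coeff 0 u) * PowerSeries.coeff M u =
      PowerSeries.coeff M (PowerSeries.map (algebraMap K A) (baseSeries L M) * normSeries L M u) := by
    have h2 := congrArg (PowerSeries.coeff M) (eq_mul_normSeries L M u hx)
    rw [mul_assoc, PowerSeries.coeff_C_mul] at h2
    rw [h2, ← mul_assoc, Ring.inverse_mul_cancel _ hx, one_mul]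
  rw [partner, if_pos rfl, h1, PowerSeries.coeff_mul, Finset.Nat.sum_antidiagonal_eq_sum_range_succ_mk,
    lamCoeff_apply, ← Finset.sum_range_reflect, Finset.smul_sum]
  refine Finset.sum_congr rfl fun j hj => ?_
  have hj' := Finset.mem_range.mp hj
  have e1 : M + 1 - 1 - j = M - j := by omega
  have e2 : M - (M - j) = j := by omega
  simp only [e1, PowerSeries.coeff_map, baseSeries, tailSeries, PowerSeries.coeff_mk]
  by_cases h0 : j = 0
  · subst h0
    simp only [if_true, map_one, one_mul, Nat.sub_zero]
    rw [if_neg (by omega)]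
  · by_cases hjM : j = M
    · subst hjM
      rw [if_neg h0, if_neg (lt_irrefl j), map_zero, zero_mul, smul_zero, Nat.sub_self,
        if_pos (by omega), smul_zero]
    · rw [if_neg h0, if_pos (show j < M by omega), if_neg (show ¬ M - j < 1 by omega), ← Algebra.smul_def, smul_smul,
        mul_div_cancel₀ _ hL]

/-- The contribution of the index `a` to the potential. -/
def potTerm (a : ℕ) : A :=
  if a = 0 then 0
  else if 2 * a < M then PowerSeries.coeff a (normSeries L M u) * partner L M u a
  else if 2 * a = M then (-(L M) / 2) • PowerSeries.coeff a (normSeries L M u) ^ 2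
  else 0

omit hx in
theorem lamCoeff_logTail_sub {a : ℕ} (ha : a ≠ 0) :
    lamCoeff L M (logTail (K := K) M (tailSeries L M u a)) -
      lamCoeff L M (logTail (K := K) M (tailSeries L M u (a + 1))) = potTerm L M u a := by
  rcases lt_trichotomy (2 * a) M with h | h | h
  · rw [potTerm, if_neg ha, if_pos h, partner, if_neg ha, ← map_sub, ← smul_eq_mul, ← map_smul]
    congr 1
    rw [logTail, logTail, ← Finset.sum_sub_distrib, Finset.mul_sum, Finset.smul_sum]
    refine Finset.sum_congr rfl fun n _ => ?_
    rw [← smul_sub, ← geom_sum₂_mul, mul_smul_comm, smul_comm]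
    congr 1
    rw [PowerSeries.smul_eq_C_mul]
    have h1 := tailSeries_eq_add L M u a
    linear_combination (∑ i ∈ Finset.range n, tailSeries L M u a ^ i *
      tailSeries L M u (a + 1) ^ (n - 1 - i)) * h1
  · rw [lamCoeff_logTail_eq_zero L M u (by omega : M < 2 * (a + 1)), sub_zero, potTerm, if_neg ha,
      if_neg (by omega), if_pos h, logTail, map_sum, Finset.sum_eq_single 2]
    · obtain ⟨F, hF⟩ := X_pow_dvd_tailSeries L M u a
      have hF0 : PowerSeries.coeff 0 F = PowerSeries.coeff a (normSeries L M u) := by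
        have h1 : PowerSeries.coeff (0 + a) (tailSeries L M u a) = PowerSeries.coeff 0 F := by
          rw [hF, mul_comm, PowerSeries.coeff_mul_X_pow]
        rw [← h1, zero_add, tailSeries, PowerSeries.coeff_mk, if_neg (lt_irrefl a)]
      have hsq : tailSeries L M u a ^ 2 = F ^ 2 * PowerSeries.X ^ M := by
        rw [hF, ← h]
        ring
      rw [lamCoeff_smul, lamCoeff_apply, Finset.sum_eq_single M]
      · have h2 : PowerSeries.coeff (0 + M) (F ^ 2 * PowerSeries.X ^ M) = PowerSeries.coeff 0 F ^ 2 := by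
          rw [PowerSeries.coeff_mul_X_pow]
          simp
        rw [zero_add] at h2
        rw [hsq, h2, hF0, smul_smul]
        congr 1
        norm_num
        ring
      · intro j hj hjM
        have := Finset.mem_range.mp hj
        rw [hsq, PowerSeries.coeff_mul_X_pow', if_neg (by omega), smul_zero]
      · simp
    · intro n hn hn2
      have hn' := Finset.mem_Icc.mp hn
      have h3 : 3 ≤ n := by omega
      have h4 : a * 3 ≤ a * n := Nat.mul_le_mul_left a h3
      exact lamCoeff_eq_zero L M (by omega) (X_pow_dvd_smul_tailSeries L M u a n _)
    · intro hn
      exfalso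
      apply hn
      rw [Finset.mem_Icc]
      omega
  · rw [lamCoeff_logTail_eq_zero L M u h, lamCoeff_logTail_eq_zero L M u (by omega), potTerm,
      if_neg ha, if_neg (by omega), if_neg (by omega), sub_zero]

omit hx in
theorem lamCoeff_logTail :
    lamCoeff L M (logTail (K := K) M (tailSeries L M u 1)) =
      ∑ a ∈ Finset.range (M + 1), potTerm L M u a := by
  have key : ∀ d, lamCoeff L M (logTail (K := K) M (tailSeries L M u 1)) =
      ∑ a ∈ Finset.range (d + 1), potTerm L M u a +
        lamCoeff L M (logTail (K := K) M (tailSeries L M u (d + 1))) := by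
    intro d
    induction d with
    | zero => simp [potTerm]
    | succ d ih =>
      rw [Finset.sum_range_succ, ← lamCoeff_logTail_sub L M u d.succ_ne_zero, ih]
      ring
  rw [key M, lamCoeff_logTail_eq_zero L M u (by omega : M < 2 * (M + 1)), add_zero]

/-- The potential of the part of the form that does not involve `d log u(0)`. -/
theorem lamCoeff_truncLog (hL : L M ≠ 0) (hM : M ≠ 0) :
    lamCoeff L M (truncLog (K := K) M (normSeries L M u - 1)) =
      partner L M u 0 + ∑ a ∈ Finset.range (M + 1), potTerm L M u a := by
  rw [← lamCoeff_tailSeries_one L M u hx hL hM, ← lamCoeff_logTail, ← map_add,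
    ← tailSeries_one L M u hx, truncLog, ← Finset.add_sum_Ioc_eq_sum_Icc (by omega : 1 ≤ M)]
  congr 2
  simp

/-- The logarithmic differential of `u`, evaluated on a derivation. -/
theorem lamCoeff_inverse_mul_mapDer [CharZero K] (δ : Derivation K A A) {u' : PowerSeries A}
    (hu : u' * u = 1) : lamCoeff L M (u' * mapDer δ u) =
      L 0 • (Ring.inverse (PowerSeries.coeff 0 u) * δ (PowerSeries.coeff 0 u)) +
        δ (lamCoeff L M (truncLog (K := K) M (normSeries L M u - 1))) := by
  set x := PowerSeries.coeff 0 u with hxdef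
  set V := normSeries L M u with hV
  set Gb := PowerSeries.map (algebraMap K A) (baseSeries L M) with hGb
  have hu2 := eq_mul_normSeries L M u hx
  have hV' : (u' * PowerSeries.C x * Gb) * V = 1 := by
    rw [← hu]
    conv_rhs => rw [hu2]
    ring
  have h1 : u' * mapDer δ u = PowerSeries.C (Ring.inverse x * δ x) +
      (u' * PowerSeries.C x * Gb) * mapDer δ V := by
    have h2 : mapDer δ u = PowerSeries.C x * Gb * mapDer δ V + Gb * V * PowerSeries.C (δ x) := by
      conv_lhs => rw [hu2]
      rw [Derivation.leibniz, Derivation.leibniz, mapDer_C, hGb, mapDer_map_algebraMap]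
      simp only [smul_eq_mul]
      ring
    have h3 : PowerSeries.C (Ring.inverse x) * PowerSeries.C x = 1 := by
      rw [← map_mul, Ring.inverse_mul_cancel _ hx, map_one]
    rw [h2, map_mul]
    have h4 : u' * (Gb * V) = PowerSeries.C (Ring.inverse x) := by
      linear_combination PowerSeries.C (Ring.inverse x) * hV' - (u' * Gb * V) * h3
    linear_combination PowerSeries.C (δ x) * h4
  rw [h1, map_add]
  congr 1
  · rw [lamCoeff_apply, Finset.sum_eq_single 0, PowerSeries.coeff_zero_C]
    · intro j _ hj
      rw [PowerSeries.coeff_C, if_neg hj, smul_zero]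
    · simp
  · rw [lamCoeff_apply, lamCoeff_apply, map_sum]
    refine Finset.sum_congr rfl fun j hj => ?_
    rw [Derivation.map_smul, coeff_inverse_mul_mapDer δ hV' (coeff_zero_normSeries L M u hx)
      (Nat.lt_succ_iff.mp (Finset.mem_range.mp hj))]

end Local

/-! ### The normal form at one point of the divisor -/

section Local
variable {K A : Type*} [Field K] [CommRing A] [Algebra K A]
  (L : ℕ → K) (M : ℕ) (c : K) (u : PowerSeries A)

theorem newCoord_zero : newCoord L M c u 0 = (c / L M) • PowerSeries.coeff 0 u := if_pos rfl

theorem newCoord_of_lt {j : ℕ} (h0 : j ≠ 0) (hj : 2 * j < M) :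
    newCoord L M c u j = 1 - PowerSeries.coeff j (normSeries L M u) := by
  rw [newCoord, if_neg h0, if_pos hj]

theorem newCoord_of_eq {j : ℕ} (h0 : j ≠ 0) (hj : 2 * j = M) :
    newCoord L M c u j = PowerSeries.coeff j (normSeries L M u) := by
  rw [newCoord, if_neg h0, if_neg (by omega), if_pos hj]

theorem newCoord_of_gt {j : ℕ} (hj : M < 2 * j) :
    newCoord L M c u j = partner L M u (M - j) := by
  rw [newCoord, if_neg (by omega), if_neg (by omega), if_neg (by omega)]

theorem partner_zero : partner L M u 0 =
    L M • (Ring.inverse (PowerSeries.coeff 0 u) * PowerSeries.coeff M u) := if_pos rfl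

/-- The summand of the normal form, evaluated on the derivation `δ`, that belongs to the index `j` (or
to the pair of `j` and `M - j`). -/
def normalTerm (δ : Derivation K A A) (j : ℕ) : A :=
  if 2 * j = M then
    if j = 0 then L 0 • (Ring.inverse (newCoord L M c u j) * δ (newCoord L M c u j) -
      δ (newCoord L M c u j))
    else δ ((-(L M) / 2) • newCoord L M c u j ^ 2)
  else if 2 * j < M then
    (if j = 0 then L 0 else 0) • (Ring.inverse (newCoord L M c u j) * δ (newCoord L M c u j)) +
      δ ((1 - newCoord L M c u j) * newCoord L M c u (M - j))
  else 0

theorem normalTerm_of_ne_zero (δ : Derivation K A A) {j : ℕ} (hj : j ≠ 0) :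
    normalTerm L M c u δ j = δ (potTerm L M u j) := by
  rw [normalTerm, potTerm, if_neg hj, if_neg hj, if_neg hj]
  rcases lt_trichotomy (2 * j) M with h | h | h
  · rw [if_neg h.ne, if_pos h, if_pos h, zero_smul, zero_add, newCoord_of_lt L M c u hj h,
      newCoord_of_gt L M c u (by omega), sub_sub_cancel, Nat.sub_sub_self (by omega)]
  · rw [if_pos h, if_neg (by omega), if_pos h, newCoord_of_eq L M c u hj h]
  · rw [if_neg (by omega), if_neg (by omega), if_neg (by omega), if_neg (by omega), map_zero]

variable (hx : IsUnit (PowerSeries.coeff 0 u)) (hL : L M ≠ 0) (hc : c ≠ 0)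
include hx hL hc

theorem isUnit_newCoord_zero : IsUnit (newCoord L M c u 0) := by
  rw [newCoord_zero, Algebra.smul_def]
  exact ((isUnit_iff_ne_zero.mpr (div_ne_zero hc hL)).map _).mul hx

theorem inverse_mul_derivation_newCoord_zero (δ : Derivation K A A) :
    Ring.inverse (newCoord L M c u 0) * δ (newCoord L M c u 0) =
      Ring.inverse (PowerSeries.coeff 0 u) * δ (PowerSeries.coeff 0 u) := by
  have h1 := Ring.inverse_mul_cancel _ (isUnit_newCoord_zero L M c u hx hL hc)
  have h2 := Ring.mul_inverse_cancel _ hx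
  have h3 : Ring.inverse (newCoord L M c u 0) * (c / L M) • PowerSeries.coeff 0 u = 1 := by
    rw [← newCoord_zero L M c u, h1]
  rw [newCoord_zero L M c u, δ.map_smul, ← newCoord_zero L M c u]
  rw [mul_smul_comm] at h3 ⊢
  rw [Algebra.smul_def] at h3 ⊢
  linear_combination (Ring.inverse (PowerSeries.coeff 0 u) * δ (PowerSeries.coeff 0 u)) * h3 -
    (algebraMap K A (c / L M) * (Ring.inverse (newCoord L M c u 0) * δ (PowerSeries.coeff 0 u))) * h2

/-- The contribution of one point of the divisor to the form, in normal form. -/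
theorem sum_normalTerm [CharZero K] (δ : Derivation K A A) {u' : PowerSeries A} (hu : u' * u = 1) :
    lamCoeff L M (u' * mapDer δ u) - c • δ (PowerSeries.coeff M u) =
      ∑ j ∈ Finset.range (M + 1), normalTerm L M c u δ j := by
  rw [lamCoeff_inverse_mul_mapDer L M u hx δ hu]
  by_cases hM : M = 0
  · subst hM
    have h1 : lamCoeff L 0 (truncLog (K := K) 0 (normSeries L 0 u - 1)) = 0 := by
      simp [truncLog]
    rw [h1, map_zero, add_zero, zero_add, Finset.sum_range_one, normalTerm, if_pos (mul_zero 2),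
      if_pos rfl, inverse_mul_derivation_newCoord_zero L 0 c u hx hL hc, newCoord_zero, δ.map_smul,
      smul_sub, smul_smul, mul_div_cancel₀ _ hL]
  · rw [lamCoeff_truncLog L M u hx hL hM, map_add, Finset.sum_range_succ', Finset.sum_range_succ',
      Finset.sum_congr rfl fun j _ => normalTerm_of_ne_zero L M c u δ j.succ_ne_zero, map_add,
      map_sum]
    have h0 : potTerm L M u 0 = 0 := if_pos rfl
    have h1 : (1 - newCoord L M c u 0) * newCoord L M c u (M - 0) =
        partner L M u 0 - c • PowerSeries.coeff M u := by
      rw [Nat.sub_zero, newCoord_of_gt L M c u (show M < 2 * M by omega), Nat.sub_self, sub_mul, one_mul,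
        partner_zero, newCoord_zero, smul_mul_smul_comm, ← mul_assoc, Ring.mul_inverse_cancel _ hx,
        one_mul, div_mul_cancel₀ _ hL]
    rw [h0, map_zero, add_zero, normalTerm, if_neg (by omega), if_pos (by omega), if_pos rfl, h1,
      inverse_mul_derivation_newCoord_zero L M c u hx hL hc, map_sub, δ.map_smul]
    ring

omit hx hL hc

/-! ### The new coordinates generate -/

/-- The coefficients of `F` of degree less than `t` lie in `S`, and the constant one is zero. -/
def LowMem (S : Subalgebra K A) (t : ℕ) (F : PowerSeries A) : Prop :=
  PowerSeries.coeff 0 F = 0 ∧ ∀ b < t, PowerSeries.coeff b F ∈ S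

section Low
variable {S : Subalgebra K A} {t : ℕ} {F G : PowerSeries A}

theorem LowMem.coeff_mul_mem (hF : LowMem S t F) (hG : LowMem S t G) {b : ℕ} (hb : b ≤ t) :
    PowerSeries.coeff b (F * G) ∈ S := by
  rw [PowerSeries.coeff_mul]
  refine sum_mem fun p hp => ?_
  have hp' := Finset.HasAntidiagonal.mem_antidiagonal.mp hp
  by_cases h1 : p.1 = 0
  · rw [h1, hF.1, zero_mul]
    exact zero_mem S
  by_cases h2 : p.2 = 0
  · rw [h2, hG.1, mul_zero]
    exact zero_mem S
  exact mul_mem (hF.2 _ (by omega)) (hG.2 _ (by omega))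

theorem LowMem.mul (hF : LowMem S t F) (hG : LowMem S t G) : LowMem S t (F * G) :=
  ⟨by have := hF.1; simp_all, fun _ hb => hF.coeff_mul_mem hG hb.le⟩

theorem LowMem.pow (hF : LowMem S t F) (n : ℕ) : LowMem S t (F ^ (n + 1)) := by
  induction n with
  | zero => rwa [zero_add, pow_one]
  | succ n ih => rw [pow_succ]; exact ih.mul hF

theorem LowMem.coeff_pow_mul_pow_mem (hF : LowMem S t F) (hG : LowMem S t G) {i j : ℕ}
    (hij : 2 ≤ i + j) {b : ℕ} (hb : b ≤ t) : PowerSeries.coeff b (F ^ i * G ^ j) ∈ S := by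
  rcases i with _ | i
  · obtain ⟨j, rfl⟩ : ∃ l, j = l + 2 := ⟨j - 2, by omega⟩
    rw [pow_zero, one_mul, pow_succ]
    exact (hG.pow j).coeff_mul_mem hG hb
  rcases j with _ | j
  · obtain ⟨i, rfl⟩ : ∃ l, i = l + 1 := ⟨i - 1, by omega⟩
    rw [pow_zero, mul_one, pow_succ]
    exact (hF.pow i).coeff_mul_mem hF hb
  exact (hF.pow i).coeff_mul_mem (hG.pow j) hb

end Low

theorem lowMem_tailSeries {S : Subalgebra K A} {t a : ℕ} (ha : a ≠ 0)
    (hS : ∀ b < t, b ≠ 0 → PowerSeries.coeff b (normSeries L M u) ∈ S) :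
    LowMem S t (tailSeries L M u a) := by
  constructor
  · rw [tailSeries, PowerSeries.coeff_mk, if_pos (Nat.pos_of_ne_zero ha)]
  · intro b hb
    rw [tailSeries, PowerSeries.coeff_mk]
    split_ifs with h
    · exact zero_mem S
    · exact hS b hb (by omega)

/-- The partner of the coefficient with index `a` involves, up to earlier coefficients, only the
coefficient with index `M - a`, and that linearly. -/
theorem partner_add_mem [CharZero K] {S : Subalgebra K A} {a : ℕ} (ha : a ≠ 0) (haM : 2 * a < M)
    (hS : ∀ b < M - a, b ≠ 0 → PowerSeries.coeff b (normSeries L M u) ∈ S) :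
    partner L M u a + L M • PowerSeries.coeff (M - a) (normSeries L M u) ∈ S := by
  set w := PowerSeries.coeff (M - a) (normSeries L M u)
  have hF := lowMem_tailSeries L M u ha hS
  have hG := lowMem_tailSeries L M u a.succ_ne_zero hS
  set F := tailSeries L M u a with hFdef
  set G := tailSeries L M u (a + 1) with hGdef
  -- the coefficients of the second factor in the definition of the partner
  have hH : ∀ b ≤ M - a, PowerSeries.coeff b (∑ n ∈ Finset.Icc 2 M, ((-1) ^ (n - 1) / n : K) •
      ∑ i ∈ Finset.range n, F ^ i * G ^ (n - 1 - i)) + (if b = M - a then w else 0) ∈ S := by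
    intro b hb
    rw [← Finset.add_sum_Ioc_eq_sum_Icc (by omega : 2 ≤ M), map_add, add_right_comm, map_sum]
    refine add_mem ?_ (sum_mem fun n hn => ?_)
    · have h1 : (∑ i ∈ Finset.range 2, F ^ i * G ^ (2 - 1 - i)) = G + F := by
        simp [Finset.sum_range_succ]
      rw [h1, PowerSeries.coeff_smul, map_add]
      split_ifs with hbM
      · have h2 : PowerSeries.coeff b F = w := by
          rw [hFdef, tailSeries, PowerSeries.coeff_mk, if_neg (by omega), hbM]
        have h3 : PowerSeries.coeff b G = w := by
          rw [hGdef, tailSeries, PowerSeries.coeff_mk, if_neg (by omega), hbM]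
        have h4 : ((-1) ^ (2 - 1) / (2 : ℕ) : K) • (w + w) + w = 0 := by
          rw [← two_smul K w, smul_smul]
          norm_num
        rw [h2, h3, h4]
        exact zero_mem S
      · rw [add_zero]
        exact S.smul_mem (add_mem (hG.2 b (by omega)) (hF.2 b (by omega))) _
    · have hn' := Finset.mem_Ioc.mp hn
      rw [PowerSeries.coeff_smul, map_sum]
      refine S.smul_mem (sum_mem fun i hi => ?_) _
      have hi' := Finset.mem_range.mp hi
      exact hF.coeff_pow_mul_pow_mem hG (by omega) hb
  rw [partner, if_neg ha, lamCoeff_apply]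
  have h5 : L M • w = ∑ j ∈ Finset.range (M + 1), L j • (if j = M then w else 0) := by
    rw [Finset.sum_eq_single M]
    · rw [if_pos rfl]
    · intro j _ hj
      rw [if_neg hj, smul_zero]
    · simp
  rw [h5, ← Finset.sum_add_distrib]
  refine sum_mem fun j hj => ?_
  have hj' := Finset.mem_range.mp hj
  rw [← smul_add]
  refine S.smul_mem ?_ _
  rw [mul_comm, PowerSeries.coeff_mul_X_pow']
  split_ifs with h6 h7 h7
  · have := hH (j - a) (by omega)
    rwa [if_pos (by omega)] at this
  · have := hH (j - a) (by omega)
    rwa [if_neg (by omega)] at this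
  · omega
  · rw [add_zero]
    exact zero_mem S

theorem coeff_normSeries_mem [CharZero K] (hL : L M ≠ 0) {S : Subalgebra K A}
    (hS : ∀ j < M, newCoord L M c u j ∈ S) {b : ℕ} (hb : b < M) (h0 : b ≠ 0) :
    PowerSeries.coeff b (normSeries L M u) ∈ S := by
  induction b using Nat.strong_induction_on with
  | _ b ih =>
    have h1 := hS b hb
    rcases lt_trichotomy (2 * b) M with h | h | h
    · rw [newCoord_of_lt L M c u h0 h] at h1
      have := sub_mem (one_mem S) h1
      rwa [sub_sub_cancel] at this
    · rwa [newCoord_of_eq L M c u h0 h] at h1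
    · rw [newCoord_of_gt L M c u h] at h1
      have h2 := partner_add_mem L M u (S := S) (a := M - b) (by omega) (by omega)
        fun d hd hd0 => ih d (by omega) (by omega) hd0
      rw [Nat.sub_sub_self hb.le] at h2
      have h3 := S.smul_mem (sub_mem h2 h1) (L M)⁻¹
      rwa [add_sub_cancel_left, smul_smul, inv_mul_cancel₀ hL, one_smul] at h3

include hx hL hc

omit hx in
theorem coeff_zero_mem {S : Subalgebra K A} (hS : newCoord L M c u 0 ∈ S) :
    PowerSeries.coeff 0 u ∈ S := by
  rw [newCoord_zero] at hS
  have h := S.smul_mem hS (c / L M)⁻¹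
  rwa [smul_smul, inv_mul_cancel₀ (div_ne_zero hc hL), one_smul] at h

/-- A subalgebra that contains the new coordinates contains the coefficients of `u`. -/
theorem coeff_mem_of_newCoord_mem [CharZero K] {S : Subalgebra K A}
    (hS : ∀ j < M, newCoord L M c u j ∈ S) {b : ℕ} (hb : b < M) : PowerSeries.coeff b u ∈ S := by
  have hx0 := coeff_zero_mem L M c u hL hc (hS 0 (by omega))
  rw [eq_mul_normSeries L M u hx, mul_assoc, PowerSeries.coeff_C_mul, PowerSeries.coeff_mul]
  refine mul_mem hx0 (sum_mem fun p hp => ?_)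
  have hp' := Finset.HasAntidiagonal.mem_antidiagonal.mp hp
  rw [PowerSeries.coeff_map]
  refine mul_mem (S.algebraMap_mem _) ?_
  by_cases h0 : p.2 = 0
  · rw [h0, coeff_zero_normSeries L M u hx]
    exact one_mem S
  · exact coeff_normSeries_mem L M c u hL hS (by omega) h0

theorem coeff_last_mem_of_newCoord_mem {S : Subalgebra K A} (hS0 : newCoord L M c u 0 ∈ S)
    (hS : newCoord L M c u M ∈ S) : PowerSeries.coeff M u ∈ S := by
  have hx0 := coeff_zero_mem L M c u hL hc hS0
  by_cases hM : M = 0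
  · rwa [hM]
  · rw [newCoord_of_gt L M c u (by omega), Nat.sub_self, partner_zero] at hS
    have h1 := mul_mem hx0 (S.smul_mem hS (L M)⁻¹)
    rwa [smul_smul, inv_mul_cancel₀ hL, one_smul, ← mul_assoc, Ring.mul_inverse_cancel _ hx,
      one_mul] at h1

end Local

/-! ### Change of coordinates -/

theorem injective_of_surjective_ringHom {A : Type*} [CommRing A] [IsNoetherianRing A] (F : A →+* A)
    (hF : Function.Surjective F) : Function.Injective F := by
  rw [injective_iff_map_eq_zero]
  intro x hx
  -- the kernels of the powers of `F` form a chain, which becomes stationary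
  obtain ⟨n, hn⟩ := monotone_stabilizes_iff_noetherian.mpr ‹IsNoetherianRing A›
    ⟨fun n => RingHom.ker (F ^ n), monotone_nat_of_le_succ fun n y hy => by
      rw [RingHom.mem_ker] at hy ⊢
      rw [pow_succ', RingHom.mul_def, RingHom.comp_apply, hy, map_zero]⟩
  have hsurj : Function.Surjective (F ^ n) := by
    rw [RingHom.coe_pow]
    exact hF.iterate n
  obtain ⟨y, rfl⟩ := hsurj x
  have h1 : y ∈ RingHom.ker (F ^ (n + 1)) := by
    rw [RingHom.mem_ker, pow_succ', RingHom.mul_def, RingHom.comp_apply, hx]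
  have h2 : RingHom.ker (F ^ n) = RingHom.ker (F ^ (n + 1)) := hn (n + 1) (Nat.le_succ n)
  rw [← h2] at h1
  exact h1

namespace IsTorusCoord
variable {K A : Type u} [Field K] [CommRing A] [Algebra K A] {ι : Type} {U : Set ι} {X z : ι → A}

theorem reindex {ι' : Type} (h : IsTorusCoord K U z) (σ : ι' ≃ ι) :
    IsTorusCoord K (σ ⁻¹' U) (z ∘ σ) where
  isUnit q hq := h.isUnit _ hq
  lift f g hg := by
    obtain ⟨F, h1, h2⟩ := h.lift f (g ∘ σ.symm) fun q hq => hg _ (by simpa using hq)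
    exact ⟨F, h1, fun q => by simp [h2]⟩
  adjoin := by
    rw [← h.adjoin, σ.surjective.range_comp z]
    congr 2
    ext x
    constructor
    · rintro ⟨q, hq, hx⟩
      exact ⟨σ q, hq, hx⟩
    · rintro ⟨q, hq, hx⟩
      exact ⟨σ.symm q, by simpa using hq, by simpa using hx⟩

/-- A family of the right size that generates is a system of coordinates. -/
theorem of_adjoin [IsNoetherianRing A] (h : IsTorusCoord K U X) (hz : ∀ q ∈ U, IsUnit (z q))
    (h1 : ∀ q, X q ∈ Algebra.adjoin K (Set.range z ∪ {x | ∃ q ∈ U, x * z q = 1}))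
    (h2 : ∀ q ∈ U, ∀ x, x * X q = 1 →
      x ∈ Algebra.adjoin K (Set.range z ∪ {x | ∃ q ∈ U, x * z q = 1})) :
    IsTorusCoord K U z := by
  have hadj : Algebra.adjoin K (Set.range z ∪ {x | ∃ q ∈ U, x * z q = 1}) = ⊤ := by
    rw [eq_top_iff, ← h.adjoin, Algebra.adjoin_le_iff]
    rintro x (⟨q, rfl⟩ | ⟨q, hq, hx⟩)
    · exact h1 q
    · exact h2 q hq x hx
  obtain ⟨F, hF⟩ := h.exists_algHom z hz
  have hsurj : Function.Surjective F := by
    rw [← AlgHom.range_eq_top, eq_top_iff, ← hadj, Algebra.adjoin_le_iff]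
    rintro x (⟨q, rfl⟩ | ⟨q, hq, hx⟩)
    · exact ⟨X q, hF q⟩
    · obtain ⟨v, hv⟩ := h.isUnit q hq
      refine ⟨↑v⁻¹, ?_⟩
      have h3 : z q * F ↑v⁻¹ = 1 := by
        rw [← hF, ← map_mul, ← hv, v.mul_inv, map_one]
      exact (left_inv_eq_right_inv hx h3).symm
  let e : A ≃ₐ[K] A := AlgEquiv.ofBijective F
    ⟨injective_of_surjective_ringHom F.toRingHom hsurj, hsurj⟩
  have he : ∀ q, e.symm (z q) = X q := fun q => by
    rw [AlgEquiv.symm_apply_eq]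
    exact (hF q).symm
  refine ⟨hz, fun f g hg => ?_, hadj⟩
  obtain ⟨G, hG1, hG2⟩ := h.lift f g hg
  refine ⟨G.comp e.symm.toRingEquiv.toRingHom, ?_, fun q => ?_⟩
  · rw [← hG1]
    ext c
    change G (e.symm (algebraMap K A c)) = G (algebraMap K A c)
    rw [AlgEquiv.commutes]
  · change G (e.symm (z q)) = g q
    rw [he, hG2]

end IsTorusCoord

namespace NormalData
variable {K : Type u} [Field K] {ι ι' : Type} {U : Set ι}

/-- Normal form data, with the coordinates renamed. -/
def reindex (N : NormalData K U) (σ : ι' ≃ ι) : NormalData K (σ ⁻¹' U) where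
  kind q := N.kind (σ q)
  inv q := σ.symm (N.inv (σ q))
  lam q := N.lam (σ q)
  eps q := N.eps (σ q)
  inv_inv q := by simp [N.inv_inv]
  inv_gm q hq := by rw [N.inv_gm _ hq, σ.symm_apply_apply]
  inv_sq q hq := by rw [N.inv_sq _ hq, σ.symm_apply_apply]
  kind_inv_fst q hq := by rw [σ.apply_symm_apply, N.kind_inv_fst _ hq]
  kind_inv_snd q hq := by rw [σ.apply_symm_apply, N.kind_inv_snd _ hq]
  gm_mem q hq := N.gm_mem _ hq
  gm_ne q hq := N.gm_ne _ hq
  sq_notMem q hq := N.sq_notMem _ hq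
  sq_ne q hq := N.sq_ne _ hq
  fst_lam q hq hU := N.fst_lam _ hq hU
  snd_notMem q hq := N.snd_notMem _ hq

variable {A : Type u} [CommRing A] [Algebra K A] {z : ι → A} (N : NormalData K U)

theorem coeff_reindex (σ : ι' ≃ ι) (q : ι') :
    (N.reindex σ).coeff (z ∘ σ) q = N.coeff z (σ q) := by
  simp only [coeff, reindex, Function.comp_apply, σ.apply_symm_apply]

/-- The summand of the form in normal form, evaluated on the derivation `δ`, that belongs to a
coordinate of type `gm` or `sq`, or to the pair of a coordinate of type `fst`. -/
def formTerm (z : ι → A) (δ : Derivation K A A) (q : ι) : A :=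
  match N.kind q with
  | .gm => N.lam q • (Ring.inverse (z q) * δ (z q) - δ (z q))
  | .sq => δ (N.eps q • z q ^ 2)
  | .fst => N.lam q • (Ring.inverse (z q) * δ (z q)) + δ ((1 - z q) * z (N.inv q))
  | .snd => 0

theorem sum_coeff_mul_derivation [Fintype ι] (δ : Derivation K A A) :
    ∑ q, N.coeff z q * δ (z q) = ∑ q, N.formTerm z δ q := by
  -- the terms of the coordinates of type `snd` are moved to their partners
  have h1 : ∑ q, (if N.kind q = .snd then (1 - z (N.inv q)) * δ (z q) else 0) =
      ∑ q, (if N.kind q = .fst then (1 - z q) * δ (z (N.inv q)) else 0) := by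
    rw [← Equiv.sum_comp (⟨N.inv, N.inv, N.inv_inv, N.inv_inv⟩ : Equiv.Perm ι)]
    refine Finset.sum_congr rfl fun q _ => ?_
    change (if N.kind (N.inv q) = .snd then (1 - z (N.inv (N.inv q))) * δ (z (N.inv q)) else 0) = _
    rw [N.inv_inv]
    refine if_congr ⟨fun h => ?_, fun h => N.kind_inv_fst q h⟩ rfl rfl
    rw [← N.inv_inv q, N.kind_inv_snd _ h]
  have h2 : ∀ q, N.coeff z q * δ (z q) = (N.formTerm z δ q -
      (if N.kind q = .fst then (1 - z q) * δ (z (N.inv q)) else 0)) +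
      if N.kind q = .snd then (1 - z (N.inv q)) * δ (z q) else 0 := by
    intro q
    rcases hk : N.kind q with _ | _ | _ | _
    · simp [formTerm, hk, coeff_gm hk, sub_mul]
    · simp [formTerm, hk, coeff_sq hk, mul_smul, two_smul, Derivation.leibniz_pow, add_mul]
    · simp [formTerm, hk, coeff_fst hk, Derivation.leibniz, sub_mul]
      ring
    · simp [formTerm, hk, coeff_snd hk]
  rw [Finset.sum_congr rfl fun q _ => h2 q, Finset.sum_add_distrib, h1, ← Finset.sum_add_distrib]
  exact Finset.sum_congr rfl fun q _ => sub_add_cancel _ _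

end NormalData

/-! ### The coordinate ring of `B` -/

section CoordRing
variable (K : Type u) [Field K] {r : ℕ} (m : Fin (r + 1) → ℕ)

/-- The independent coordinates of `B`. -/
def freeCoord (q : FreeIdx m) : CoordB K m :=
  algebraMap (MvPolynomial (FreeIdx m) K) (CoordB K m) (MvPolynomial.X q)

theorem coordU_free (q : FreeIdx m) : coordU K m q.1.1 q.1.2 = freeCoord K m q := by
  obtain ⟨⟨i, j⟩, h1, h2, h3⟩ := q
  rw [coordU, if_neg, if_neg]
  · exact dif_pos ⟨h1, h2, h3⟩
  · rintro ⟨rfl, rfl⟩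
    exact h3 rfl
  · rintro ⟨rfl, rfl⟩
    exact h2 rfl

theorem isTorusCoord_freeCoord :
    IsTorusCoord K {q : FreeIdx m | q.1.2 = 0} (freeCoord K m) where
  isUnit q hq := IsLocalization.map_units (M := unitCoords K m) (CoordB K m)
    ⟨_, Submonoid.subset_closure ⟨q, hq, rfl⟩⟩
  lift {B} _ f g hg := by
    have hu : ∀ y : unitCoords K m, IsUnit (MvPolynomial.eval₂Hom f g y) := by
      rintro ⟨y, hy⟩
      change IsUnit (MvPolynomial.eval₂Hom f g y)
      induction hy using Submonoid.closure_induction with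
      | mem x hx =>
        obtain ⟨q, hq, rfl⟩ := hx
        rw [MvPolynomial.eval₂Hom_X']
        exact hg q hq
      | one => rw [map_one]; exact isUnit_one
      | mul x y _ _ hx hy => rw [map_mul]; exact hx.mul hy
    refine ⟨IsLocalization.lift (M := unitCoords K m) (S := CoordB K m) hu, ?_, fun q => ?_⟩
    · ext c
      rw [RingHom.comp_apply, IsScalarTower.algebraMap_apply K (MvPolynomial (FreeIdx m) K),
        IsLocalization.lift_eq]
      exact MvPolynomial.eval₂Hom_C f g c
    · rw [freeCoord, IsLocalization.lift_eq, MvPolynomial.eval₂Hom_X']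
  adjoin := by
    set S := Algebra.adjoin K (Set.range (freeCoord K m) ∪
      {x | ∃ q ∈ {q : FreeIdx m | q.1.2 = 0}, x * freeCoord K m q = 1})
    have hpoly : ∀ p : MvPolynomial (FreeIdx m) K, algebraMap _ (CoordB K m) p ∈ S := by
      intro p
      induction p using MvPolynomial.induction_on with
      | C c =>
        rw [← MvPolynomial.algebraMap_eq, ← IsScalarTower.algebraMap_apply]
        exact S.algebraMap_mem c
      | add p q hp hq => rw [map_add]; exact add_mem hp hq
      | mul_X p q hp =>
        rw [map_mul]
        exact mul_mem hp (Algebra.subset_adjoin (Or.inl ⟨q, rfl⟩))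
    have hinv : ∀ s ∈ unitCoords K m, ∃ x ∈ S, x * algebraMap _ (CoordB K m) s = 1 := by
      intro s hs
      induction hs using Submonoid.closure_induction with
      | mem s hs =>
        obtain ⟨q, hq, rfl⟩ := hs
        obtain ⟨v, hv⟩ := IsLocalization.map_units (M := unitCoords K m) (CoordB K m)
          ⟨_, Submonoid.subset_closure ⟨q, hq, rfl⟩⟩
        have h1 : (↑v⁻¹ : CoordB K m) * freeCoord K m q = 1 := by
          have : freeCoord K m q = v := hv.symm
          rw [this, v.inv_mul]
        exact ⟨_, Algebra.subset_adjoin (Or.inr ⟨q, hq, h1⟩), h1⟩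
      | one => exact ⟨1, one_mem S, by rw [map_one, one_mul]⟩
      | mul s t _ _ hs ht =>
        obtain ⟨x, hx, hx'⟩ := hs
        obtain ⟨y, hy, hy'⟩ := ht
        refine ⟨x * y, mul_mem hx hy, ?_⟩
        rw [map_mul, mul_mul_mul_comm, hx', hy', one_mul]
    rw [eq_top_iff]
    rintro f -
    obtain ⟨p, s, rfl⟩ := IsLocalization.exists_mk'_eq (unitCoords K m) f
    obtain ⟨x, hx, hx'⟩ := hinv s s.2
    have h1 : IsLocalization.mk' (CoordB K m) p s = x * algebraMap _ (CoordB K m) p := by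
      rw [IsLocalization.mk'_eq_iff_eq_mul]
      linear_combination (-(algebraMap _ (CoordB K m) p)) * hx'
    rw [h1]
    exact mul_mem hx (hpoly p)

/-- The indices of all coordinates `u_{ij}`. -/
def allIdx : Finset (Fin (r + 1) × ℕ) :=
  (Finset.univ.sigma fun i => Finset.range (m i)).map (Equiv.sigmaEquivProd _ _).toEmbedding

theorem mem_allIdx {q : Fin (r + 1) × ℕ} : q ∈ allIdx m ↔ q.2 < m q.1 := by
  obtain ⟨i, j⟩ := q
  simp [allIdx]

theorem sum_allIdx {M : Type*} [AddCommMonoid M] (f : Fin (r + 1) → ℕ → M) :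
    ∑ q ∈ allIdx m, f q.1 q.2 = ∑ i, ∑ j ∈ Finset.range (m i), f i j := by
  rw [allIdx, Finset.sum_map, Finset.sum_sigma]
  rfl

theorem mem_free_iff (q : Fin (r + 1) × ℕ) :
    q ∈ ((allIdx m).erase (0, m 0 - 1)).erase (0, 0) ↔
      q.2 < m q.1 ∧ q ≠ (0, 0) ∧ q ≠ (0, m 0 - 1) := by
  rw [Finset.mem_erase, Finset.mem_erase, mem_allIdx]
  tauto

instance : Fintype (FreeIdx m) := Fintype.subtype _ (mem_free_iff m)

theorem sum_freeIdx {M : Type*} [AddCommMonoid M] (hm0 : 2 ≤ m 0) (f : Fin (r + 1) → ℕ → M) :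
    ∑ i, ∑ j ∈ Finset.range (m i), f i j =
      f 0 (m 0 - 1) + (f 0 0 + ∑ q : FreeIdx m, f q.1.1 q.1.2) := by
  rw [← sum_allIdx, ← Finset.add_sum_erase (allIdx m) _ (a := (0, m 0 - 1)),
    ← Finset.add_sum_erase ((allIdx m).erase (0, m 0 - 1)) _ (a := (0, 0)),
    Finset.sum_subtype _ (mem_free_iff m)]
  · rw [Finset.mem_erase, mem_allIdx]
    refine ⟨fun h => ?_, ?_⟩
    · have := congrArg Prod.snd h
      simp only at this
      omega
    · simp only
      omega
  · rw [mem_allIdx]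
    simp only
    omega

theorem card_freeIdx (hm0 : 2 ≤ m 0) : Fintype.card (FreeIdx m) = (∑ i, m i) - 2 := by
  have h := sum_freeIdx m hm0 fun _ _ => 1
  simp only [Finset.sum_const, Finset.card_range, smul_eq_mul, mul_one, Finset.card_univ] at h
  omega

end CoordRing

/-! ### The normal form of `Ξ` -/

section NormalForm
variable {K : Type u} [Field K] {r : ℕ} (m : Fin (r + 1) → ℕ) (lam : Fin (r + 1) → ℕ → K)

/-- The series `∑ j, u_{ij} T^j`. -/
def coordSeries (K : Type u) [Field K] (m : Fin (r + 1) → ℕ) (i : Fin (r + 1)) :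
    PowerSeries (CoordB K m) :=
  PowerSeries.mk (coordU K m i)

/-- The coordinates of `B` in which `Ξ` is in normal form. -/
def normalCoord (i : Fin (r + 1)) (j : ℕ) : CoordB K m :=
  newCoord (lam i) (m i - 1) (lam 0 (m 0 - 1)) (coordSeries K m i) j

@[simp] theorem coeff_coordSeries (i : Fin (r + 1)) (j : ℕ) :
    PowerSeries.coeff j (coordSeries K m i) = coordU K m i j := PowerSeries.coeff_mk _ _

/-- The data of the normal form of `Ξ`: the coordinates `u_{ij}` and `u_{i, mᵢ - 1 - j}` are
paired. -/
def normalData [CharZero K] (hlam : ∀ i, lam i (m i - 1) ≠ 0) :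
    NormalData K {q : FreeIdx m | q.1.2 = 0} where
  kind q := if 2 * q.1.2 = m q.1.1 - 1 then (if q.1.2 = 0 then .gm else .sq)
    else if 2 * q.1.2 < m q.1.1 - 1 then .fst else .snd
  inv q := ⟨(q.1.1, m q.1.1 - 1 - q.1.2), by
    obtain ⟨⟨i, j⟩, h1, h2, h3⟩ := q
    simp only [ne_eq, Prod.mk.injEq, not_and] at h1 h2 h3 ⊢
    refine ⟨by omega, ?_, ?_⟩
    · rintro rfl h
      have := h3 rfl
      omega
    · rintro rfl h
      have := h2 rfl
      omega⟩
  lam q := if q.1.2 = 0 then lam q.1.1 0 else 0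
  eps q := -(lam q.1.1 (m q.1.1 - 1)) / 2
  inv_inv q := by
    have := q.2.1
    ext
    · rfl
    · change m q.1.1 - 1 - (m q.1.1 - 1 - q.1.2) = q.1.2
      omega
  inv_gm q hq := by
    ext
    · rfl
    · change m q.1.1 - 1 - q.1.2 = q.1.2
      split_ifs at hq
      omega
  inv_sq q hq := by
    ext
    · rfl
    · change m q.1.1 - 1 - q.1.2 = q.1.2
      split_ifs at hq
      omega
  kind_inv_fst q hq := by
    split_ifs at hq
    have := q.2.1
    simp only
    rw [if_neg (by omega), if_neg (by omega)]
  kind_inv_snd q hq := by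
    split_ifs at hq
    have := q.2.1
    simp only
    rw [if_neg (by omega), if_pos (by omega)]
  gm_mem q hq := by
    split_ifs at hq
    assumption
  gm_ne q hq := by
    split_ifs at hq with h1 h2
    rw [if_pos h2]
    have := hlam q.1.1
    rwa [← h1, h2] at this
  sq_notMem q hq := by
    split_ifs at hq
    assumption
  sq_ne q _ := div_ne_zero (neg_ne_zero.mpr (hlam _)) two_ne_zero
  fst_lam q _ hU := if_neg hU
  snd_notMem q hq hU := by
    have hU' : q.1.2 = 0 := hU
    split_ifs at hq
    omega

variable (hm : ∀ i, 1 ≤ m i) (hlam : ∀ i, lam i (m i - 1) ≠ 0)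
include hm

theorem isUnit_coeff_zero_coordSeries (i : Fin (r + 1)) :
    IsUnit (PowerSeries.coeff 0 (coordSeries K m i)) := by
  rw [coeff_coordSeries]
  exact isUnit_coordU K m hm i

include hlam

omit hm in
theorem normalCoord_zero_zero : normalCoord m lam 0 0 = 1 := by
  rw [normalCoord, newCoord_zero, coeff_coordSeries, coordU_zero_zero, div_self (hlam 0), one_smul]

/-- The form `Ξ`, evaluated on a derivation. -/
theorem lift_Xi [CharZero K] (hm0 : 2 ≤ m 0) (δ : Derivation K (CoordB K m) (CoordB K m)) :
    δ.liftKaehlerDifferential (Xi m lam) = ∑ q : FreeIdx m,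
      normalTerm (lam q.1.1) (m q.1.1 - 1) (lam 0 (m 0 - 1)) (coordSeries K m q.1.1) δ q.1.2 := by
  have h1 : ∀ i j, δ.liftKaehlerDifferential (tau K m i j) =
      PowerSeries.coeff j (Ring.inverse (coordSeries K m i) * mapDer δ (coordSeries K m i)) := by
    intro i j
    rw [tau, map_sum, PowerSeries.coeff_mul]
    refine Finset.sum_congr rfl fun p _ => ?_
    rw [map_smul, Derivation.liftKaehlerDifferential_comp_D, coeff_mapDer, coeff_coordSeries]
    rfl
  have h2 : ∀ i, ∑ j ∈ Finset.range (m i), δ.liftKaehlerDifferential (lam i j • tau K m i j) =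
      ∑ j ∈ Finset.range (m i),
        normalTerm (lam i) (m i - 1) (lam 0 (m 0 - 1)) (coordSeries K m i) δ j +
      lam 0 (m 0 - 1) • δ (coordU K m i (m i - 1)) := by
    intro i
    have hu : Ring.inverse (coordSeries K m i) * coordSeries K m i = 1 :=
      Ring.inverse_mul_cancel _ (PowerSeries.isUnit_iff_constantCoeff.mpr (by
        rw [← PowerSeries.coeff_zero_eq_constantCoeff_apply]
        exact isUnit_coeff_zero_coordSeries m hm i))
    have h3 := sum_normalTerm (lam i) (m i - 1) (lam 0 (m 0 - 1)) (coordSeries K m i)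
      (isUnit_coeff_zero_coordSeries m hm i) (hlam i) (hlam 0) δ hu
    rw [Nat.sub_add_cancel (hm i), sub_eq_iff_eq_add, lamCoeff_apply, Nat.sub_add_cancel (hm i),
      coeff_coordSeries] at h3
    rw [← h3]
    refine Finset.sum_congr rfl fun j _ => ?_
    rw [← h1, LinearMap.map_smul_of_tower]
  have h4 := sum_freeIdx m hm0 fun i j =>
    normalTerm (lam i) (m i - 1) (lam 0 (m 0 - 1)) (coordSeries K m i) δ j
  have h5 : normalTerm (lam 0) (m 0 - 1) (lam 0 (m 0 - 1)) (coordSeries K m 0) δ (m 0 - 1) = 0 := by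
    rw [normalTerm, if_neg (by omega), if_neg (by omega)]
  have h6 : normalTerm (lam 0) (m 0 - 1) (lam 0 (m 0 - 1)) (coordSeries K m 0) δ 0 = 0 := by
    have h7 : newCoord (lam 0) (m 0 - 1) (lam 0 (m 0 - 1)) (coordSeries K m 0) 0 = 1 :=
      normalCoord_zero_zero m lam hlam
    rw [normalTerm, if_neg (by omega), if_pos (by omega), h7]
    simp
  rw [h5, h6, zero_add, zero_add] at h4
  rw [← h4, Xi, map_sum]
  simp only [map_sum]
  rw [Finset.sum_congr rfl fun i _ => h2 i, Finset.sum_add_distrib, ← Finset.smul_sum, ← map_sum,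
    sum_coordU K m hm0, map_zero, smul_zero, add_zero]

theorem lift_Xi_eq_sum_coeff [CharZero K] (hm0 : 2 ≤ m 0)
    (δ : Derivation K (CoordB K m) (CoordB K m)) :
    δ.liftKaehlerDifferential (Xi m lam) = ∑ q : FreeIdx m,
      (normalData m lam hlam).coeff (fun q => normalCoord m lam q.1.1 q.1.2) q *
        δ (normalCoord m lam q.1.1 q.1.2) := by
  rw [lift_Xi m lam hm hlam hm0, NormalData.sum_coeff_mul_derivation _ δ]
  refine Finset.sum_congr rfl fun q _ => ?_
  have hq := q.2.1
  rw [normalTerm, NormalData.formTerm]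
  simp only [normalData, normalCoord]
  rcases lt_trichotomy (2 * q.1.2) (m q.1.1 - 1) with h | h | h
  · simp only [h.ne, h, if_true, if_false]
  · by_cases h0 : q.1.2 = 0
    · have hM : m q.1.1 - 1 = 0 := by omega
      simp only [h0, hM, mul_zero, if_true]
    · simp only [h, h0, if_true, if_false]
  · simp only [h.ne', not_lt.mpr h.le, if_false]

theorem isTorusCoord_normalCoord [CharZero K] :
    IsTorusCoord K {q : FreeIdx m | q.1.2 = 0} fun q => normalCoord m lam q.1.1 q.1.2 := by
  have : IsNoetherianRing (CoordB K m) :=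
    IsLocalization.isNoetherianRing (unitCoords K m) _ inferInstance
  set S := Algebra.adjoin K (Set.range (fun q : FreeIdx m => normalCoord m lam q.1.1 q.1.2) ∪
    {x | ∃ q ∈ {q : FreeIdx m | q.1.2 = 0}, x * normalCoord m lam q.1.1 q.1.2 = 1}) with hS
  have hfree : ∀ q : FreeIdx m, normalCoord m lam q.1.1 q.1.2 ∈ S := fun q =>
    Algebra.subset_adjoin (Or.inl ⟨q, rfl⟩)
  have hlt : ∀ i, ∀ j < m i - 1, normalCoord m lam i j ∈ S := by
    intro i j hj
    by_cases h0 : (i, j) = (0, 0)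
    · obtain ⟨rfl, rfl⟩ := Prod.mk.injEq _ _ _ _ ▸ h0
      rw [normalCoord_zero_zero m lam hlam]
      exact one_mem S
    · refine hfree ⟨(i, j), by simp only; omega, h0, fun h => ?_⟩
      obtain ⟨rfl, rfl⟩ := Prod.mk.injEq _ _ _ _ ▸ h
      exact lt_irrefl _ hj
  have hcoord : ∀ q : FreeIdx m, freeCoord K m q ∈ S := by
    intro q
    rw [← coordU_free, ← coeff_coordSeries]
    have hq := q.2.1
    by_cases hj : q.1.2 < m q.1.1 - 1
    · exact coeff_mem_of_newCoord_mem _ _ _ _ (isUnit_coeff_zero_coordSeries m hm _) (hlam _)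
        (hlam 0) (hlt q.1.1) hj
    · have hj' : q.1.2 = m q.1.1 - 1 := by omega
      have h1 := hfree q
      have h0 : normalCoord m lam q.1.1 0 ∈ S := by
        by_cases h0 : q.1.2 = 0
        · rwa [h0] at h1
        · exact hlt _ _ (by omega)
      rw [hj'] at h1 ⊢
      exact coeff_last_mem_of_newCoord_mem _ _ _ _ (isUnit_coeff_zero_coordSeries m hm _) (hlam _)
        (hlam 0) h0 h1
  have hzero : ∀ q : FreeIdx m, q.1.2 = 0 → normalCoord m lam q.1.1 q.1.2 =
      (lam 0 (m 0 - 1) / lam q.1.1 (m q.1.1 - 1)) • freeCoord K m q := by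
    intro q hq
    rw [← coordU_free, hq, normalCoord, newCoord_zero, coeff_coordSeries]
  have hne : ∀ q : FreeIdx m, lam 0 (m 0 - 1) / lam q.1.1 (m q.1.1 - 1) ≠ 0 := fun q =>
    div_ne_zero (hlam 0) (hlam _)
  refine (isTorusCoord_freeCoord K m).of_adjoin (fun q hq => ?_) hcoord fun q hq x hx => ?_
  · have hq' : q.1.2 = 0 := hq
    rw [hq']
    exact isUnit_newCoord_zero _ _ _ _ (isUnit_coeff_zero_coordSeries m hm _) (hlam _) (hlam 0)
  · have h1 : ((lam 0 (m 0 - 1) / lam q.1.1 (m q.1.1 - 1))⁻¹ • x) *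
        normalCoord m lam q.1.1 q.1.2 = 1 := by
      rw [hzero q hq, smul_mul_smul_comm, inv_mul_cancel₀ (hne q), hx, one_smul]
    have h2 := S.smul_mem (Algebra.subset_adjoin (Or.inr ⟨q, hq, h1⟩))
      (lam 0 (m 0 - 1) / lam q.1.1 (m q.1.1 - 1))
    rwa [smul_smul, mul_inv_cancel₀ (hne q), one_smul] at h2

end NormalForm

end GM

end

theorem mainTheorem3 {k K : Type*} [Field k] [IsAlgClosed k] [CharZero k] [Field K] [Algebra k K]
    {r : ℕ} (m : Fin (r + 1) → ℕ) (hm : ∀ i, 1 ≤ m i) (hm0 : 2 ≤ m 0)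
    (lam : Fin (r + 1) → ℕ → K) (hlam : ∀ i, lam i (m i - 1) ≠ 0)
    (Ψ : Ω[GM.CoordB K m⁄k])
    (hΨ : KaehlerDifferential.map k K (GM.CoordB K m) (GM.CoordB K m) Ψ = GM.Xi m lam)
    (hcurv : GM.extD k (GM.CoordB K m) (GM.form1 k (GM.CoordB K m) Ψ) ∈
      GM.fil2 k K (GM.CoordB K m)) :
    -- `b` is a `K`-point of `B` and the only closed point where `Ξ` vanishes
    ∃ b : GM.CoordB K m →ₐ[K] K,
      (∀ P : Ideal (GM.CoordB K m), P.IsMaximal →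
        (GM.Xi m lam ∈ P • (⊤ : Submodule (GM.CoordB K m) (Ω[GM.CoordB K m⁄K])) ↔
          P = RingHom.ker b)) ∧
      Module.finrank K (GM.DeRhamH (GM.Xi m lam) ((∑ i, m i) - 2)) = 1 ∧
      -- the Gauß–Manin connection exists, and it is unique
      ∃ nabla : GM.Conn k K (GM.DeRhamH (GM.Xi m lam) ((∑ i, m i) - 2)),
        GM.IsGaussManin Ψ (GM.Xi m lam) ((∑ i, m i) - 2) nabla ∧
        (∀ nabla' : GM.Conn k K (GM.DeRhamH (GM.Xi m lam) ((∑ i, m i) - 2)),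
          GM.IsGaussManin Ψ (GM.Xi m lam) ((∑ i, m i) - 2) nabla' → nabla' = nabla) ∧
        -- the completion of `B` at `b` is a power series ring, and for every choice of parameters
        (∃ φ : GM.CoordB K m →ₐ[K] MvPowerSeries (Fin ((∑ i, m i) - 2)) K,
          GM.IsFormalParameters b φ) ∧
        ∀ φ : GM.CoordB K m →ₐ[K] MvPowerSeries (Fin ((∑ i, m i) - 2)) K,
          GM.IsFormalParameters b φ →
          ∃ h : MvPowerSeries (Fin ((∑ i, m i) - 2)) K,
            GM.IsPrimitive φ (GM.Xi m lam) h ∧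
            (GM.quadMatrix h).det ≠ 0 ∧
            GM.Conn.Iso nabla (GM.Conn.ofForm k
              (GM.restrictPoint b Ψ +
                (2 : K)⁻¹ • (GM.quadMatrix h).det⁻¹ •
                  KaehlerDifferential.D k K (GM.quadMatrix h).det)) := by
  have : CharZero K := charZero_of_injective_algebraMap (algebraMap k K).injective
  let σ : Fin ((∑ i, m i) - 2) ≃ GM.FreeIdx m :=
    (Fintype.equivFinOfCardEq (GM.card_freeIdx m hm0)).symm
  have h := (GM.isTorusCoord_normalCoord m lam hm hlam).reindex σ
  obtain ⟨bs, hbs⟩ := h.exists_basis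
  refine ((GM.normalData m lam hlam).reindex σ).exists_zero_gaussManin_disc h bs hbs (fun q => ?_) hΨ hcurv
  -- the derivation dual to `dz_q` computes the coefficient of `dz_q`
  have h1 : (GM.dualDer bs q).liftKaehlerDifferential = bs.coord q := by
    apply Derivation.liftKaehlerDifferential_unique
    rw [Derivation.liftKaehlerDifferential_comp]
    rfl
  rw [← h1, GM.lift_Xi_eq_sum_coeff m lam hm hlam hm0, ← Equiv.sum_comp σ,
    Finset.sum_eq_single q, GM.NormalData.coeff_reindex]
  · have h2 := GM.NormalData.dualDer_coord hbs q q
    rw [if_pos rfl] at h2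
    exact (congrArg _ h2).trans (mul_one _)
  · intro p _ hp
    have h2 := GM.NormalData.dualDer_coord hbs q p
    rw [if_neg hp] at h2
    exact (congrArg _ h2).trans (mul_zero _)
  · simp
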